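/- **Definitions.** A *convex cone* in a finite-dimensional real vector space is the set of nonnegative linear combinations of finitely many vectors; a *cone* is a finite (possibly empty) union of convex cones. For $n\ge 0$ let $L_n$ be the abelian group generated by symbols $\langle P\rangle_n$, one for each cone $P\subset\mathbb R^n$, with the relations $\langle\emptyset\rangle_n=0$, $\langle P\cup Q\rangle_n+\langle P\cap Q\rangle_n=\langle P\rangle_n+\langle Q\rangle_n$, and $\langle gP\rangle_n=\langle P\rangle_n$ for $g\in O(n)$; put $L_{-1}=0$. Extending additively, every conical constructible set (a set obtained from cones by finite unions, intersections and differences) in $\mathbb R^n$ has a class in $L_n$. Through isometries onto subsets of $\mathbb R^n$, the class $\langle P\rangle_n$ is also defined for convex cones of dimension at most $n$ in any Euclidean space, and by inclusion-exclusion for every *Euclidean cone* $P$ of dimension at most $n$, that is, a finite union of convex cones $C_i$ in some $\mathbb R^N$, each equipped with a linear injection of its span into $\mathbb R^n$, such that the norms so induced on $C_i$ and $C_j$ agree on $C_i\cap C_j$. The group $L=\bigoplus_{n\ge 0}L_n$ is a commutative graded ring with $\langle P\rangle_i\langle Q\rangle_j=\langle P\times Q\rangle_{i+j}$ and unit the class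 of the point $\mathbb R^0$. Let $t,d,s\in L_1$ be the classes of the origin of the line, of a closed half-line, and of the whole line. The *duality operator* $D:L_n\to L_n$ is the homomorphism taking the class of a convex cone $C\subset\mathbb R^n$ to that of its dual cone $\{w:\langle w,v\rangle\le 0 \text{ for all } v\in C\}$. The *interior operator* $I:L_n\to L_n$ is the homomorphism taking the class of a convex cone $C$ to $(-1)^{\dim C}$ times the class of the relative interior of $C$. The same formula defines $I$ on the group of conical constructible functions $\mathbb R^n\to\mathbb Z$ (the functions generated by the characteristic functions of convex cones). For such a function $\xi$ the function $\xi-(-1)^nI\xi$ is supported in dimension at most $n-1$, i.e. it is an integral combination of characteristic functions of convex cones of dimension at most $n-1$, and so has a class in $L_{n-1}$; this induces a homomorphism $\delta_n:L_n\to L_{n-1}$ (with $\delta_0=0$). Let $L_n^+=\ker\delta_n$, let $\bar\delta_n=D\circ\delta_n\circ D:L_n\to L_{n-1}$, and let $D(L^+)=\bigoplus_n D(L_n^+)\subset L$. An *interior manifold cone* is a nonempty Euclidean cone that is a PL manifold with empty boundary. $L_n^{ev}$ (respectively $L_n^{od}$) is the subgroup of $L_n$ generated by the classes $\langle M\rangle_n$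 of even-dimensional (respectively odd-dimensional) interior manifold cones $M$ of dimension at most $n$. **Theorem.** 1. For every $n\ge 0$, $D(L_n^+)=\ker(\bar\delta_n)=\operatorname{im}(\bar\delta_{n+1})$. 2. $D(L^+)$ is a subring of $L$, and $L$ is a free module over $D(L^+)$ with basis $\{1,d\}$; moreover $Dd=d$. 3. For every $n>0$, $D(L_n^+)=\operatorname{im}(1+I:L_n\to L_n)$. 4. For every $n\ge 0$, $D(L_n^+)=L_n^{ev}$. 5. For every $k\ge 0$, $L_{2k+1}^{ev}=tL_{2k}^+$ and $L_{2k+1}^+=L_{2k+1}^{od}=D(L_{2k+1}^{ev})=sL_{2k}^+$. -/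

import Mathlib

noncomputable section
set_option linter.unusedSectionVars false

namespace ConeRing
section Convex
variable {V W : Type*} [NormedAddCommGroup V] [InnerProductSpace ℝ V] [FiniteDimensional ℝ V]
  [NormedAddCommGroup W] [InnerProductSpace ℝ W] [FiniteDimensional ℝ W]

/-- A convex cone: the set of all nonnegative linear combinations of finitely many vectors. -/
def IsConvexCone (P : Set V) : Prop :=
  ∃ s : Finset V, P = (PointedCone.hull ℝ (s : Set V) : Set V)

/-- A cone: the union of finitely many convex cones (possibly none). -/
def IsCone (P : Set V) : Prop :=
  ∃ S : Set (Set V), S.Finite ∧ (∀ C ∈ S, IsConvexCone C) ∧ P = ⋃₀ S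

/-- The dimension of a convex cone, i.e. of its linear span. -/
def dim (C : Set V) : ℕ := Module.finrank ℝ (Submodule.span ℝ C)

/-- The dual of a set `P`: the vectors `w` with `⟪w, v⟫ ≤ 0` for all `v ∈ P`. -/
def dualCone (P : Set V) : Set V := {w | ∀ v ∈ P, inner ℝ w v ≤ 0}

/-- The (relative) interior of a convex cone. -/
def relint (C : Set V) : Set V := {x | x ∈ C ∧ ∀ y ∈ C, ∃ ε : ℝ, 0 < ε ∧ x - ε • y ∈ C}

/-- The solution set of finitely many conditions `0 ≤ ⟪a, x⟫`. -/
def hcone (T : Finset V) : Set V := {x | ∀ a ∈ T, 0 ≤ inner ℝ a x}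

theorem hcone_add_ray (T : Finset V) (v : V) :
    ∃ T' : Finset V, hcone T' = {x | ∃ t : ℝ, 0 ≤ t ∧ x - t • v ∈ hcone T} := by
  classical
  refine ⟨T.filter (fun a => 0 ≤ inner ℝ a v) ∪
    ((T.filter (fun a => 0 < inner ℝ a v)) ×ˢ (T.filter (fun a => inner ℝ a v < 0))).image
      (fun p => (inner ℝ p.1 v) • p.2 - (inner ℝ p.2 v) • p.1), ?_⟩
  ext x
  simp only [hcone, Set.mem_ofPred_eq, inner_sub_right, real_inner_smul_right]
  constructor
  · intro h
    have h1 : ∀ a ∈ T, 0 ≤ inner ℝ a v → 0 ≤ inner ℝ a x := fun a ha hav =>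
      h a (Finset.mem_union_left _ (Finset.mem_filter.2 ⟨ha, hav⟩))
    have h2 : ∀ a ∈ T, ∀ b ∈ T, 0 < inner ℝ a v → inner ℝ b v < 0 →
        inner ℝ b v * inner ℝ a x ≤ inner ℝ a v * inner ℝ b x := by
      intro a ha b hb hav hbv
      have := h ((inner ℝ a v) • b - (inner ℝ b v) • a)
        (Finset.mem_union_right _ (Finset.mem_image.2 ⟨(a, b), by simp [ha, hb, hav, hbv], rfl⟩))
      simp only [inner_sub_left, real_inner_smul_left] at this
      linarith
    by_cases hne : (T.filter (fun a => inner ℝ a v < 0)).Nonempty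
    · obtain ⟨b, hb, hmax⟩ := Finset.exists_max_image _ (fun b => inner ℝ b x / inner ℝ b v) hne
      rw [Finset.mem_filter] at hb
      refine ⟨max 0 (inner ℝ b x / inner ℝ b v), le_max_left _ _, fun a ha => ?_⟩
      rcases lt_trichotomy (inner ℝ a v) 0 with hav | hav | hav
      · have := hmax a (Finset.mem_filter.2 ⟨ha, hav⟩)
        have h3 := this.trans (le_max_right 0 (inner ℝ b x / inner ℝ b v))
        rw [div_le_iff_of_neg hav] at h3
        linarith
      · rw [hav]; simpa using h1 a ha hav.ge
      · rcases le_total (inner ℝ b x / inner ℝ b v) 0 with h0 | h0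
        · rw [max_eq_left h0]; simpa using h1 a ha hav.le
        · rw [max_eq_right h0]
          have := h2 a ha b hb.1 hav hb.2
          have h4 : inner ℝ b x / inner ℝ b v * inner ℝ a v ≤ inner ℝ a x := by
            rw [div_mul_eq_mul_div, div_le_iff_of_neg hb.2]; linarith
          linarith
    · refine ⟨0, le_rfl, fun a ha => ?_⟩
      have : 0 ≤ inner ℝ a v := by
        by_contra hc
        exact hne ⟨a, Finset.mem_filter.2 ⟨ha, not_le.1 hc⟩⟩
      simpa using h1 a ha this
  · rintro ⟨t, ht, h⟩ c hc
    rcases Finset.mem_union.1 hc with hc | hc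
    · rw [Finset.mem_filter] at hc
      have := h c hc.1
      nlinarith [mul_nonneg ht hc.2]
    · obtain ⟨⟨a, b⟩, hab, rfl⟩ := Finset.mem_image.1 hc
      simp only [Finset.mem_product, Finset.mem_filter] at hab
      obtain ⟨⟨ha, hav⟩, hb, hbv⟩ := hab
      have e1 := h a ha
      have e2 := h b hb
      simp only [inner_sub_left, real_inner_smul_left]
      nlinarith [mul_nonneg hav.le e2, mul_nonneg (neg_pos.2 hbv).le e1]

theorem exists_hcone_hull (s : Finset V) :
    ∃ T : Finset V, (PointedCone.hull ℝ (s : Set V) : Set V) = hcone T := by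
  classical
  induction s using Finset.induction_on with
  | empty =>
    let b := stdOrthonormalBasis ℝ V
    refine ⟨Finset.univ.image b ∪ Finset.univ.image (fun i => - b i), ?_⟩
    ext x
    simp only [Finset.coe_empty, Submodule.span_empty, Submodule.bot_coe, Set.mem_singleton_iff,
      hcone, Set.mem_ofPred_eq]
    constructor
    · rintro rfl; simp
    · intro h
      apply b.toBasis.ext_elem
      intro i
      have h1 := h (b i) (by simp)
      have h2 := h (- b i) (by simp)
      rw [inner_neg_left] at h2
      have : inner ℝ (b i) x = 0 := le_antisymm (by linarith) h1
      simp [b.repr_apply_apply, this]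
  | insert v s _ ih =>
    obtain ⟨T, hT⟩ := ih
    obtain ⟨T', hT'⟩ := hcone_add_ray T v
    refine ⟨T', ?_⟩
    rw [hT', Finset.coe_insert]
    ext x
    rw [SetLike.mem_coe, PointedCone.hull, Submodule.mem_span_insert]
    constructor
    · rintro ⟨a, z, hz, rfl⟩
      refine ⟨a, a.2, ?_⟩
      rw [← hT]
      have : (a • v + z - (a : ℝ) • v) = z := by
        change ((a : ℝ) • v + z - (a : ℝ) • v) = z
        abel
      rw [this]; exact hz
    · rintro ⟨t, ht, h⟩
      rw [← hT] at h
      refine ⟨⟨t, ht⟩, _, h, ?_⟩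
      change x = t • v + (x - t • v)
      abel

theorem hcone_eq_hull (T : Finset V) :
    ∃ s : Finset V, hcone T = (PointedCone.hull ℝ (s : Set V) : Set V) := by
  obtain ⟨S, hS⟩ := exists_hcone_hull T
  obtain ⟨S', hS'⟩ := exists_hcone_hull S
  have key : ∀ (A : Finset V) (x : V), x ∈ hcone A →
      ∀ a ∈ PointedCone.hull ℝ (A : Set V), 0 ≤ inner ℝ a x := by
    intro A x hx a ha
    induction ha using Submodule.span_induction with
    | mem a h => exact hx a h
    | zero => simp
    | add a b _ _ h1 h2 => rw [inner_add_left]; linarith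
    | smul c a _ h =>
      change 0 ≤ inner ℝ ((c : ℝ) • a) x
      rw [real_inner_smul_left]; exact mul_nonneg c.2 h
  refine ⟨S, Set.Subset.antisymm ?_ ?_⟩
  · intro x hx
    rw [hS']
    intro a' ha'
    refine key T x hx a' ?_
    rw [← SetLike.mem_coe, hS]
    intro s hs
    have : s ∈ hcone S' := by rw [← hS']; exact Submodule.subset_span hs
    rw [real_inner_comm]
    exact this a' ha'
  · intro x hx a ha
    have : a ∈ hcone S := by rw [← hS]; exact Submodule.subset_span ha
    rw [real_inner_comm]
    exact key S a this x hx

theorem isConvexCone_iff {P : Set V} : IsConvexCone P ↔ ∃ T : Finset V, P = hcone T := by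
  constructor
  · rintro ⟨s, rfl⟩; exact exists_hcone_hull s
  · rintro ⟨T, rfl⟩; exact hcone_eq_hull T

theorem IsConvexCone.zero_mem {P : Set V} (h : IsConvexCone P) : (0 : V) ∈ P := by
  obtain ⟨s, rfl⟩ := h; exact Submodule.zero_mem _

theorem IsConvexCone.add_mem {P : Set V} (h : IsConvexCone P) {x y : V} (hx : x ∈ P)
    (hy : y ∈ P) : x + y ∈ P := by
  obtain ⟨s, rfl⟩ := h; exact Submodule.add_mem _ hx hy

theorem IsConvexCone.smul_mem {P : Set V} (h : IsConvexCone P) {c : ℝ} (hc : 0 ≤ c) {x : V}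
    (hx : x ∈ P) : c • x ∈ P := by
  obtain ⟨s, rfl⟩ := h; exact PointedCone.smul_mem _ hc hx

theorem IsConvexCone.isClosed {P : Set V} (h : IsConvexCone P) : IsClosed P := by
  obtain ⟨T, rfl⟩ := isConvexCone_iff.1 h
  simp only [hcone, Set.ofPred_forall]
  exact isClosed_biInter fun a _ => isClosed_le continuous_const (by fun_prop)

theorem IsConvexCone.inter {P Q : Set V} (hP : IsConvexCone P) (hQ : IsConvexCone Q) :
    IsConvexCone (P ∩ Q) := by
  classical
  obtain ⟨T, rfl⟩ := isConvexCone_iff.1 hP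
  obtain ⟨U, rfl⟩ := isConvexCone_iff.1 hQ
  refine isConvexCone_iff.2 ⟨T ∪ U, ?_⟩
  ext x
  simp only [hcone, Set.mem_inter_iff, Set.mem_ofPred_eq, Finset.mem_union]
  exact ⟨fun h a ha => ha.elim (h.1 a) (h.2 a), fun h => ⟨fun a ha => h a (.inl ha),
    fun a ha => h a (.inr ha)⟩⟩

theorem isConvexCone_ge (a : V) : IsConvexCone {x : V | 0 ≤ inner ℝ a x} :=
  isConvexCone_iff.2 ⟨{a}, by simp [hcone]⟩

theorem isConvexCone_le (a : V) : IsConvexCone {x : V | inner ℝ a x ≤ 0} :=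
  isConvexCone_iff.2 ⟨{-a}, by simp [hcone]⟩

theorem isConvexCone_eq (a : V) : IsConvexCone {x : V | inner ℝ a x = 0} := by
  have : {x : V | inner ℝ a x = 0} = {x : V | 0 ≤ inner ℝ a x} ∩ {x : V | inner ℝ a x ≤ 0} := by
    ext x; simp [le_antisymm_iff, and_comm]
  rw [this]; exact (isConvexCone_ge a).inter (isConvexCone_le a)

theorem isConvexCone_univ : IsConvexCone (Set.univ : Set V) :=
  isConvexCone_iff.2 ⟨∅, by simp [hcone]⟩

theorem isConvexCone_zero : IsConvexCone ({0} : Set V) := ⟨∅, by simp⟩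

theorem IsConvexCone.image {P : Set V} (h : IsConvexCone P) (f : V →ₗ[ℝ] W) :
    IsConvexCone (f '' P) := by
  classical
  obtain ⟨s, rfl⟩ := h
  refine ⟨s.image f, ?_⟩
  rw [← PointedCone.coe_map, PointedCone.map, Submodule.map_span, Finset.coe_image]
  rfl

theorem IsConvexCone.preimage {P : Set W} (h : IsConvexCone P) (f : V →ₗ[ℝ] W) :
    IsConvexCone (f ⁻¹' P) := by
  classical
  obtain ⟨T, rfl⟩ := isConvexCone_iff.1 h
  refine isConvexCone_iff.2 ⟨T.image (LinearMap.adjoint f), ?_⟩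
  ext x
  simp [hcone, LinearMap.adjoint_inner_left]

theorem IsConvexCone.dualCone {P : Set V} (h : IsConvexCone P) : IsConvexCone (dualCone P) := by
  classical
  obtain ⟨s, rfl⟩ := h
  refine isConvexCone_iff.2 ⟨s.image (fun a => -a), ?_⟩
  ext x
  simp only [ConeRing.dualCone, hcone, Set.mem_ofPred_eq, Finset.mem_image, forall_exists_index,
    and_imp, forall_apply_eq_imp_iff₂, inner_neg_left, SetLike.mem_coe]
  constructor
  · intro h a ha
    have := h a (Submodule.subset_span ha)
    rw [real_inner_comm] at this; linarith
  · intro h v hv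
    induction hv using Submodule.span_induction with
    | mem a ha => have := h a ha; rw [real_inner_comm]; linarith
    | zero => simp
    | add a b _ _ h1 h2 => rw [inner_add_right]; linarith
    | smul c a _ h =>
      change inner ℝ x ((c : ℝ) • a) ≤ 0
      rw [real_inner_smul_right]; exact mul_nonpos_of_nonneg_of_nonpos c.2 h

theorem IsConvexCone.isCone {P : Set V} (h : IsConvexCone P) : IsCone P :=
  ⟨{P}, by simp, by simpa using h, by simp⟩

theorem isCone_empty : IsCone (∅ : Set V) := ⟨∅, by simp⟩

theorem IsCone.union {P Q : Set V} (hP : IsCone P) (hQ : IsCone Q) : IsCone (P ∪ Q) := by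
  obtain ⟨S, hS, hS', rfl⟩ := hP
  obtain ⟨T, hT, hT', rfl⟩ := hQ
  refine ⟨S ∪ T, hS.union hT, ?_, by rw [Set.sUnion_union]⟩
  rintro C (h | h)
  exacts [hS' C h, hT' C h]

theorem IsCone.inter {P Q : Set V} (hP : IsCone P) (hQ : IsCone Q) : IsCone (P ∩ Q) := by
  obtain ⟨S, hS, hS', rfl⟩ := hP
  obtain ⟨T, hT, hT', rfl⟩ := hQ
  refine ⟨Set.image2 (· ∩ ·) S T, hS.image2 _ hT, ?_, ?_⟩
  · rintro C ⟨A, hA, B, hB, rfl⟩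
    exact (hS' A hA).inter (hT' B hB)
  · ext x
    simp only [Set.mem_inter_iff, Set.mem_sUnion, Set.mem_image2]
    constructor
    · rintro ⟨⟨A, hA, hxA⟩, B, hB, hxB⟩
      exact ⟨A ∩ B, ⟨A, hA, B, hB, rfl⟩, hxA, hxB⟩
    · rintro ⟨_, ⟨A, hA, B, hB, rfl⟩, hxA, hxB⟩
      exact ⟨⟨A, hA, hxA⟩, B, hB, hxB⟩

theorem IsCone.image {P : Set V} (h : IsCone P) (f : V →ₗ[ℝ] W) : IsCone (f '' P) := by
  obtain ⟨S, hS, hS', rfl⟩ := h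
  refine ⟨Set.image f '' S, hS.image _, ?_, by rw [Set.image_sUnion]⟩
  rintro _ ⟨A, hA, rfl⟩
  exact (hS' A hA).image f

theorem IsCone.preimage {P : Set W} (h : IsCone P) (f : V →ₗ[ℝ] W) : IsCone (f ⁻¹' P) := by
  obtain ⟨S, hS, hS', rfl⟩ := h
  refine ⟨Set.preimage f '' S, hS.image _, ?_, by rw [Set.sUnion_image, Set.preimage_sUnion]⟩
  rintro _ ⟨A, hA, rfl⟩
  exact (hS' A hA).preimage f

end Convex
end ConeRing

namespace ConeRing
section Valuations
variable {V W : Type*} [NormedAddCommGroup V] [InnerProductSpace ℝ V] [FiniteDimensional ℝ V]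
  [NormedAddCommGroup W] [InnerProductSpace ℝ W] [FiniteDimensional ℝ W]
  {A : Type*} [AddCommGroup A]

/-- The characteristic function of a set. -/
def ind (P : Set V) : V → ℤ := P.indicator 1

/-- A convex cone of dimension at most `k`. -/
def KC (k : ℕ) (C : Set V) : Prop := IsConvexCone C ∧ dim C ≤ k

variable (V) in
/-- The group of conical constructible functions on `V` supported in dimension at most `k`: the
functions `V → ℤ` generated by the characteristic functions of convex cones of dimension
at most `k`. -/
def Sig (k : ℕ) : AddSubgroup (V → ℤ) := AddSubgroup.closure {f | ∃ C : Set V, KC k C ∧ f = ind C}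

/-- The closed half-space `0 ≤ ⟪a, x⟫`. -/
def ge (a : V) : Set V := {x | 0 ≤ inner ℝ a x}

/-- The hyperplane `⟪a, x⟫ = 0` (or the whole space when `a = 0`). -/
def eqz (a : V) : Set V := {x | inner ℝ a x = 0}

/-- The hyperplane cutting relation for a function of convex cones of dimension at most `k`. -/
def Cut (k : ℕ) (F : Set V → A) : Prop :=
  ∀ P, KC k P → ∀ a : V, F P + F (P ∩ eqz a) = F (P ∩ ge a) + F (P ∩ ge (-a))

theorem dim_mono {P Q : Set V} (h : P ⊆ Q) : dim P ≤ dim Q :=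
  Submodule.finrank_mono (Submodule.span_mono h)

theorem dim_le (P : Set V) : dim P ≤ Module.finrank ℝ V := Submodule.finrank_le _

theorem KC.ge {k : ℕ} {P : Set V} (h : KC k P) (a : V) : KC k (P ∩ ge a) :=
  ⟨h.1.inter (isConvexCone_ge a), (dim_mono Set.inter_subset_left).trans h.2⟩

theorem KC.eqz {k : ℕ} {P : Set V} (h : KC k P) (a : V) : KC k (P ∩ eqz a) :=
  ⟨h.1.inter (isConvexCone_eq a), (dim_mono Set.inter_subset_left).trans h.2⟩

theorem eqz_neg (a : V) : eqz (-a) = eqz a := by ext; simp [eqz]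

theorem ind_of_mem {P : Set V} {x : V} (h : x ∈ P) : ind P x = 1 := by simp [ind, h]

theorem ind_of_notMem {P : Set V} {x : V} (h : x ∉ P) : ind P x = 0 := by simp [ind, h]

theorem ind_union_add_inter (P Q : Set V) : ind (P ∪ Q) + ind (P ∩ Q) = ind P + ind Q := by
  ext x
  by_cases h1 : x ∈ P <;> by_cases h2 : x ∈ Q <;> simp [ind, h1, h2]

/-- `F` behaves like a valuation concentrated on the region `Ω`. -/
structure Supp (k : ℕ) (F : Set V → A) (Ω : Set V) : Prop where
  add : ∀ x ∈ Ω, ∀ y ∈ Ω, ∀ ε : ℝ, 0 < ε → x + ε • y ∈ Ω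
  cut : Cut k F
  congr : ∀ P Q, KC k P → KC k Q → P ∩ Ω = Q ∩ Ω → F P = F Q
  empty : ∀ P, KC k P → P ∩ Ω = ∅ → F P = 0

theorem Supp.zer {k : ℕ} {F : Set V → A} {Ω : Set V} (h : Supp k F Ω) (a : V) :
    Supp k (fun P => F (P ∩ eqz a)) (Ω ∩ eqz a) where
  add x hx y hy ε hε := ⟨h.add x hx.1 y hy.1 ε hε, by
    have h1 : inner ℝ a x = 0 := hx.2
    have h2 : inner ℝ a y = 0 := hy.2
    simp [eqz, inner_add_right, real_inner_smul_right, h1, h2]⟩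
  cut P hP b := by
    have := h.cut _ (hP.eqz a) b
    rwa [Set.inter_right_comm, Set.inter_right_comm P _ (ConeRing.ge b),
      Set.inter_right_comm P _ (ConeRing.ge (-b))] at this
  congr P Q hP hQ e := h.congr _ _ (hP.eqz a) (hQ.eqz a) (by
    rw [Set.inter_assoc, Set.inter_comm (eqz a), e, Set.inter_comm Ω, Set.inter_assoc])
  empty P hP e := h.empty _ (hP.eqz a) (by rw [Set.inter_assoc, Set.inter_comm (eqz a), e])

theorem Supp.pos {k : ℕ} {F : Set V → A} {Ω : Set V} (h : Supp k F Ω) (a : V) :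
    Supp k (fun P => F (P ∩ ge a) - F (P ∩ eqz a)) (Ω ∩ {x | 0 < inner ℝ a x}) := by
  have hempty : ∀ P, KC k P → P ∩ (Ω ∩ {x | 0 < inner ℝ a x}) = ∅ →
      F (P ∩ ConeRing.ge a) - F (P ∩ eqz a) = 0 := by
    intro P hP e
    rw [sub_eq_zero]
    refine h.congr _ _ (hP.ge a) (hP.eqz a) ?_
    ext x
    constructor
    · rintro ⟨⟨hx, hx'⟩, hxΩ⟩
      refine ⟨⟨hx, ?_⟩, hxΩ⟩
      by_contra hne
      have : x ∈ P ∩ (Ω ∩ {x | 0 < inner ℝ a x}) :=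
        ⟨hx, hxΩ, lt_of_le_of_ne hx' (fun h => hne h.symm)⟩
      rw [e] at this; exact this
    · rintro ⟨⟨hx, hx'⟩, hxΩ⟩
      exact ⟨⟨hx, le_of_eq (Eq.symm hx')⟩, hxΩ⟩
  refine ⟨?_, ?_, ?_, hempty⟩
  · rintro x ⟨hx, hx'⟩ y ⟨hy, hy'⟩ ε hε
    refine ⟨h.add x hx y hy ε hε, ?_⟩
    simp only [Set.mem_ofPred_eq] at hx' hy' ⊢
    rw [inner_add_right, real_inner_smul_right]
    positivity
  · intro P hP b
    have h1 := h.cut _ (hP.ge a) b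
    have h2 := h.cut _ (hP.eqz a) b
    rw [Set.inter_right_comm, Set.inter_right_comm P _ (ConeRing.ge b),
      Set.inter_right_comm P _ (ConeRing.ge (-b))] at h1 h2
    have : ∀ x1 x2 x3 x4 y1 y2 y3 y4 : A, x1 + x2 = x3 + x4 → y1 + y2 = y3 + y4 →
        x1 - y1 + (x2 - y2) = x3 - y3 + (x4 - y4) := by
      intro x1 x2 x3 x4 y1 y2 y3 y4 e1 e2
      calc _ = (x1 + x2) - (y1 + y2) := by abel
        _ = _ := by rw [e1, e2]; abel
    exact this _ _ _ _ _ _ _ _ h1 h2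
  · intro P Q hP hQ e
    by_cases hne : P ∩ (Ω ∩ {x | 0 < inner ℝ a x}) = ∅
    · have h1 := hempty P hP hne
      have h2 := hempty Q hQ (e ▸ hne)
      exact h1.trans h2.symm
    · obtain ⟨y, hy⟩ := Set.nonempty_iff_ne_empty.2 hne
      have key : ∀ P Q : Set V, KC k P → KC k Q →
          P ∩ (Ω ∩ {x | 0 < inner ℝ a x}) = Q ∩ (Ω ∩ {x | 0 < inner ℝ a x}) →
          y ∈ P ∩ (Ω ∩ {x | 0 < inner ℝ a x}) → ∀ x ∈ P, x ∈ Ω → 0 ≤ inner ℝ a x → x ∈ Q := by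
        intro P Q hP hQ e hy x hx hxΩ hax
        have hmem : ∀ ε : ℝ, 0 < ε → x + ε • y ∈ Q := by
          intro ε hε
          have : x + ε • y ∈ P ∩ (Ω ∩ {x | 0 < inner ℝ a x}) := by
            refine ⟨hP.1.add_mem hx (hP.1.smul_mem hε.le hy.1), h.add _ hxΩ _ hy.2.1 _ hε, ?_⟩
            have : (0 : ℝ) < inner ℝ a y := hy.2.2
            simp only [Set.mem_ofPred_eq, inner_add_right, real_inner_smul_right]
            positivity
          rw [e] at this; exact this.1
        have ht : Filter.Tendsto (fun ε : ℝ => x + ε • y) (nhdsWithin 0 (Set.Ioi 0)) (nhds x) := by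
          have : ContinuousAt (fun ε : ℝ => x + ε • y) 0 := by fun_prop
          have h0 := this.tendsto
          simp only [zero_smul, add_zero] at h0
          exact h0.mono_left nhdsWithin_le_nhds
        exact hQ.1.isClosed.mem_of_tendsto ht
          (Filter.eventually_of_mem self_mem_nhdsWithin fun ε hε => hmem ε hε)
      have hy' : y ∈ Q ∩ (Ω ∩ {x | 0 < inner ℝ a x}) := e ▸ hy
      congr 1
      · refine h.congr _ _ (hP.ge a) (hQ.ge a) ?_
        ext x
        constructor
        · rintro ⟨⟨h1, h2⟩, h3⟩; exact ⟨⟨key P Q hP hQ e hy x h1 h3 h2, h2⟩, h3⟩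
        · rintro ⟨⟨h1, h2⟩, h3⟩; exact ⟨⟨key Q P hQ hP e.symm hy' x h1 h3 h2, h2⟩, h3⟩
      · refine h.congr _ _ (hP.eqz a) (hQ.eqz a) ?_
        ext x
        constructor
        · rintro ⟨⟨h1, h2⟩, h3⟩
          exact ⟨⟨key P Q hP hQ e hy x h1 h3 (le_of_eq (Eq.symm h2)), h2⟩, h3⟩
        · rintro ⟨⟨h1, h2⟩, h3⟩
          exact ⟨⟨key Q P hQ hP e.symm hy' x h1 h3 (le_of_eq (Eq.symm h2)), h2⟩, h3⟩

theorem Supp.sum_eq_zero {k : ℕ} (ξ : {C : Set V // KC k C} →₀ ℤ) (T : List V) :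
    ∀ (F : Set V → A) (Ω : Set V), Supp k F Ω →
      (∀ C ∈ ξ.support, ∀ x ∈ Ω, ∀ y ∈ Ω,
        (∀ a ∈ T, SignType.sign (inner ℝ a x) = SignType.sign (inner ℝ a y)) →
          x ∈ C.1 → y ∈ C.1) →
      (∀ x ∈ Ω, ξ.sum (fun C c => c * ind C.1 x) = 0) → ξ.sum (fun C c => c • F C.1) = 0 := by
  induction T with
  | nil =>
    intro F Ω h hdet hsum
    rcases Ω.eq_empty_or_nonempty with rfl | ⟨ω, hω⟩
    · refine Finset.sum_eq_zero fun C _ => ?_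
      simp only
      rw [h.empty _ C.2 (Set.inter_empty _), smul_zero]
    · by_cases hex : ∃ C ∈ ξ.support, ω ∈ C.1
      · obtain ⟨C₀, hC₀, hωC₀⟩ := hex
        have hfull : ∀ C ∈ ξ.support, ω ∈ C.1 → C.1 ∩ Ω = Ω := by
          intro C hC hωC
          exact Set.inter_eq_right.2 fun y hy => hdet C hC ω hω y hy (by simp) hωC
        have : ξ.sum (fun C c => c • F C.1) = ξ.sum (fun C c => (c * ind C.1 ω) • F C₀.1) := by
          refine Finset.sum_congr rfl fun C hC => ?_
          by_cases hωC : ω ∈ C.1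
          · simp only [ind_of_mem hωC, mul_one]
            rw [h.congr _ _ C.2 C₀.2 (by rw [hfull C hC hωC, hfull C₀ hC₀ hωC₀])]
          · simp only [ind_of_notMem hωC, mul_zero, zero_smul]
            rw [h.empty _ C.2, smul_zero]
            refine Set.eq_empty_of_forall_notMem fun y hy => hωC ?_
            exact hdet C hC y hy.2 ω hω (by simp) hy.1
        rw [this, Finsupp.sum, ← Finset.sum_smul]
        have h0 := hsum ω hω
        rw [Finsupp.sum] at h0
        rw [h0, zero_smul]
      · push Not at hex
        refine Finset.sum_eq_zero fun C hC => ?_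
        simp only
        rw [h.empty _ C.2, smul_zero]
        refine Set.eq_empty_of_forall_notMem fun y hy => hex C hC ?_
        exact hdet C hC y hy.2 ω hω (by simp) hy.1
  | cons a T ih =>
    intro F Ω h hdet hsum
    have h1 := ih _ _ (h.pos a)
      (fun C hC x hx y hy hs hxC => hdet C hC x hx.1 y hy.1 (by
        intro b hb
        rcases List.mem_cons.1 hb with rfl | hb
        · rw [sign_pos hx.2, sign_pos hy.2]
        · exact hs b hb) hxC) (fun x hx => hsum x hx.1)
    have h2 := ih _ _ (h.pos (-a))
      (fun C hC x hx y hy hs hxC => hdet C hC x hx.1 y hy.1 (by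
        intro b hb
        rcases List.mem_cons.1 hb with rfl | hb
        · have h1 := hx.2
          have h2 := hy.2
          simp only [Set.mem_ofPred_eq, inner_neg_left, Left.neg_pos_iff] at h1 h2
          rw [sign_neg h1, sign_neg h2]
        · exact hs b hb) hxC) (fun x hx => hsum x hx.1)
    have h3 := ih _ _ (h.zer a)
      (fun C hC x hx y hy hs hxC => hdet C hC x hx.1 y hy.1 (by
        intro b hb
        rcases List.mem_cons.1 hb with rfl | hb
        · have h1 : inner ℝ b x = 0 := hx.2
          have h2 : inner ℝ b y = 0 := hy.2
          rw [h1, h2]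
        · exact hs b hb) hxC) (fun x hx => hsum x hx.1)
    have : ξ.sum (fun C c => c • F C.1) =
        ξ.sum (fun C c => c • (F (C.1 ∩ ConeRing.ge a) - F (C.1 ∩ eqz a))) +
        ξ.sum (fun C c => c • (F (C.1 ∩ ConeRing.ge (-a)) - F (C.1 ∩ eqz (-a)))) +
        ξ.sum (fun C c => c • F (C.1 ∩ eqz a)) := by
      rw [← Finsupp.sum_add, ← Finsupp.sum_add]
      refine Finset.sum_congr rfl fun C _ => ?_
      simp only [← smul_add]
      congr 1
      rw [eqz_neg, ← add_left_inj (F (C.1 ∩ eqz a)), h.cut _ C.2 a]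
      abel
    rw [this, h1, h2, h3]; simp

theorem Cut.sum_eq_zero {k : ℕ} {F : Set V → A} (hF : Cut k F)
    (ξ : {C : Set V // KC k C} →₀ ℤ) (hξ : ξ.sum (fun C c => c • ind C.1) = 0) :
    ξ.sum (fun C c => c • F C.1) = 0 := by
  classical
  choose T hT using fun C : {C : Set V // KC k C} => isConvexCone_iff.1 C.2.1
  refine Supp.sum_eq_zero ξ (ξ.support.biUnion T).toList F Set.univ
    ⟨by simp, hF, fun P Q _ _ h => by simpa using congrArg F (by simpa using h), ?_⟩ ?_ ?_
  · intro P hP h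
    have := hP.1.zero_mem
    rw [Set.inter_univ] at h
    rw [h] at this; exact this.elim
  · intro C hC x _ y _ hs hx
    rw [hT C] at hx ⊢
    intro a ha
    have h1 := hs a (by simp only [Finset.mem_toList, Finset.mem_biUnion]; exact ⟨C, hC, ha⟩)
    have h2 := hx a ha
    rw [← sign_nonneg_iff] at h2 ⊢
    rwa [← h1]
  · intro x _
    have := congrFun hξ x
    simpa [Finsupp.sum] using this

theorem ind_mem_Sig {k : ℕ} {C : Set V} (h : KC k C) : ind C ∈ Sig V k :=
  AddSubgroup.subset_closure ⟨C, h, rfl⟩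

/-- A function of convex cones satisfying the hyperplane cutting relation extends to a
homomorphism on the group of conical constructible functions. -/
theorem exists_ext {k : ℕ} {F : Set V → A} (hF : Cut k F) :
    ∃ Φ : Sig V k →+ A, ∀ (C : Set V) (h : KC k C), Φ ⟨ind C, ind_mem_Sig h⟩ = F C := by
  let i := Finsupp.linearCombination ℤ (fun C : {C : Set V // KC k C} => ind C.1)
  let g := Finsupp.linearCombination ℤ (fun C : {C : Set V // KC k C} => F C.1)
  have hi : ∀ ξ, i ξ ∈ Sig V k := by
    intro ξ
    rw [Finsupp.linearCombination_apply]
    exact AddSubgroup.sum_mem _ fun C _ => AddSubgroup.zsmul_mem _ (ind_mem_Sig C.2) _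
  let p : ({C : Set V // KC k C} →₀ ℤ) →+ Sig V k := i.toAddMonoidHom.codRestrict (Sig V k) hi
  have hp1 : ∀ (C : Set V) (h : KC k C), p (Finsupp.single ⟨C, h⟩ 1) = ⟨ind C, ind_mem_Sig h⟩ := by
    intro C h
    apply Subtype.ext
    change i _ = _
    simp [i]
  have hp : Function.Surjective p := by
    rintro ⟨f, hf⟩
    induction hf using AddSubgroup.closure_induction with
    | mem f h => obtain ⟨C, hC, rfl⟩ := h; exact ⟨_, hp1 C hC⟩
    | zero => exact ⟨0, map_zero p⟩
    | add f f' _ _ h h' =>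
      obtain ⟨a, ha⟩ := h
      obtain ⟨b, hb⟩ := h'
      exact ⟨a + b, by rw [map_add, ha, hb]; rfl⟩
    | neg f _ h => obtain ⟨a, ha⟩ := h; exact ⟨-a, by rw [map_neg, ha]; rfl⟩
  have hker : p.ker ≤ g.toAddMonoidHom.ker := by
    intro ξ hξ
    rw [AddMonoidHom.mem_ker] at hξ ⊢
    have h1 : i ξ = 0 := congrArg Subtype.val hξ
    have h2 : g ξ = 0 := by
      rw [Finsupp.linearCombination_apply] at h1 ⊢
      exact hF.sum_eq_zero ξ h1
    exact h2
  refine ⟨p.liftOfRightInverse _ (Function.rightInverse_surjInv hp) ⟨g.toAddMonoidHom, hker⟩, ?_⟩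
  intro C h
  rw [← hp1 C h, AddMonoidHom.liftOfRightInverse_comp_apply]
  change g _ = _
  simp [g]

/-- The extension of a function of convex cones satisfying the hyperplane cutting relation. -/
def ext {k : ℕ} {F : Set V → A} (hF : Cut k F) : Sig V k →+ A := (exists_ext hF).choose

theorem ext_ind {k : ℕ} {F : Set V → A} (hF : Cut k F) {C : Set V} (h : KC k C) :
    ext hF ⟨ind C, ind_mem_Sig h⟩ = F C := (exists_ext hF).choose_spec C h

theorem Sig.hom_ext {k : ℕ} {Φ Ψ : Sig V k →+ A}
    (h : ∀ (C : Set V) (hC : KC k C), Φ ⟨ind C, ind_mem_Sig hC⟩ = Ψ ⟨ind C, ind_mem_Sig hC⟩) :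
    Φ = Ψ := by
  ext ⟨f, hf⟩
  induction hf using AddSubgroup.closure_induction with
  | mem f h' => obtain ⟨C, hC, rfl⟩ := h'; exact h C hC
  | zero => exact (map_zero Φ).trans (map_zero Ψ).symm
  | add f f' hf hf' h h' =>
    have e : (⟨f + f', AddSubgroup.add_mem _ hf hf'⟩ : Sig V k) = ⟨f, hf⟩ + ⟨f', hf'⟩ := rfl
    rw [e, map_add, map_add, h, h']
  | neg f hf h =>
    have e : (⟨-f, AddSubgroup.neg_mem _ hf⟩ : Sig V k) = -⟨f, hf⟩ := rfl
    rw [e, map_neg, map_neg, h]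

theorem ind_sUnion_mem {k : ℕ} (l : List (Set V)) :
    ∀ P : Set V, (∀ C ∈ l, KC k C) → P = ⋃₀ {C | C ∈ l} → ind P ∈ Sig V k := by
  induction' hn : l.length with n ih generalizing l
  · intro P _ hP
    rw [List.length_eq_zero_iff] at hn
    subst hn
    have : ind P = 0 := by rw [hP]; ext x; simp [ind]
    rw [this]; exact zero_mem _
  · rcases l with _ | ⟨C, l⟩
    · simp at hn
    · intro P hl hP
      have hlen : l.length = n := by simpa using hn
      have hC := hl C (by simp)
      have h1 := ih l hlen _ (fun D hD => hl D (by simp [hD])) rfl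
      have h2 := ih (l.map (C ∩ ·)) (by simpa using hlen) (C ∩ ⋃₀ {D | D ∈ l}) (by
          intro D hD
          obtain ⟨D', hD', rfl⟩ := List.mem_map.1 hD
          have hD'' := hl D' (by simp [hD'])
          exact ⟨hC.1.inter hD''.1, (dim_mono Set.inter_subset_left).trans hC.2⟩) (by
          ext x
          simp only [Set.mem_inter_iff, Set.mem_sUnion, Set.mem_ofPred_eq, List.mem_map]
          constructor
          · rintro ⟨hx, D, hD, hxD⟩; exact ⟨_, ⟨D, hD, rfl⟩, hx, hxD⟩
          · rintro ⟨_, ⟨D, hD, rfl⟩, hx, hxD⟩; exact ⟨hx, D, hD, hxD⟩)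
      have hPu : P = C ∪ ⋃₀ {D | D ∈ l} := by
        rw [hP]; ext x; simp
      have : ind P = ind C + ind (⋃₀ {D | D ∈ l}) - ind (C ∩ ⋃₀ {D | D ∈ l}) := by
        rw [hPu, ← ind_union_add_inter]; abel
      rw [this]
      exact sub_mem (add_mem (ind_mem_Sig hC) h1) h2

theorem ind_iUnion_mem {k : ℕ} {ι : Type*} (s : Finset ι) (C : ι → Set V)
    (h : ∀ i ∈ s, KC k (C i)) : ind (⋃ i ∈ s, C i) ∈ Sig V k := by
  classical
  refine ind_sUnion_mem (s.image C).toList _ ?_ ?_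
  · intro D hD
    obtain ⟨i, hi, rfl⟩ := Finset.mem_image.1 (Finset.mem_toList.1 hD)
    exact h i hi
  · ext x; simp

theorem IsCone.ind_mem {P : Set V} (h : IsCone P) {k : ℕ} (hk : Module.finrank ℝ V ≤ k) :
    ind P ∈ Sig V k := by
  obtain ⟨S, hS, hS', rfl⟩ := h
  refine ind_sUnion_mem hS.toFinset.toList _ ?_ ?_
  · intro C hC
    exact ⟨hS' C (by simpa using hC), (dim_le C).trans hk⟩
  · simp

/-! ### The interior of a convex cone -/

theorem inner_eq_zero_of_mem_span {C : Set V} {a x : V}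
    (hx : x ∈ Submodule.span ℝ (C ∩ eqz a)) : inner ℝ a x = 0 := by
  induction hx using Submodule.span_induction with
  | mem x hx => exact hx.2
  | zero => simp
  | add x y _ _ h1 h2 => rw [inner_add_right, h1, h2, add_zero]
  | smul c x _ h1 => rw [real_inner_smul_right, h1, mul_zero]

theorem relint_ind_mem {C : Set V} (hC : IsConvexCone C) {k : ℕ} (hk : dim C ≤ k + 1) :
    ind C - ind (relint C) ∈ Sig V k := by
  classical
  obtain ⟨T, hT⟩ := isConvexCone_iff.1 hC
  let T' := T.filter fun a => ∃ x ∈ C, inner ℝ a x ≠ 0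
  have hT' : ∀ a ∈ T', ∃ p ∈ C, 0 < inner ℝ a p := by
    intro a ha
    obtain ⟨haT, p, hp, hne⟩ := Finset.mem_filter.1 ha
    refine ⟨p, hp, lt_of_le_of_ne ?_ hne.symm⟩
    rw [hT] at hp
    exact hp a haT
  have hrel : relint C = C \ ⋃ a ∈ T', C ∩ eqz a := by
    ext x
    simp only [relint, Set.mem_ofPred_eq, Set.mem_sdiff, Set.mem_iUnion, not_exists]
    refine and_congr_right fun hx => ⟨?_, ?_⟩
    · rintro h a ha ⟨-, hax⟩
      obtain ⟨p, hp, hap⟩ := hT' a ha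
      obtain ⟨ε, hε, hmem⟩ := h p hp
      rw [hT] at hmem
      have := hmem a (Finset.mem_filter.1 ha).1
      rw [inner_sub_right, real_inner_smul_right] at this
      have hax : inner ℝ a x = 0 := hax
      nlinarith [mul_pos hε hap]
    · intro h y hy
      have hpos : ∀ a ∈ T', 0 < inner ℝ a x := by
        intro a ha
        have h1 : 0 ≤ inner ℝ a x := by
          have hx' := hx
          rw [hT] at hx'
          exact hx' a (Finset.mem_filter.1 ha).1
        refine lt_of_le_of_ne h1 fun h0 => h a ha ⟨hx, h0.symm⟩
      have hev : ∀ᶠ ε : ℝ in nhdsWithin 0 (Set.Ioi 0), ∀ a ∈ T', 0 < inner ℝ a (x - ε • y) := by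
        rw [Filter.eventually_all_finset]
        intro a ha
        apply Filter.Eventually.filter_mono nhdsWithin_le_nhds
        have hc : ContinuousAt (fun ε : ℝ => inner ℝ a (x - ε • y)) 0 := by fun_prop
        exact hc.eventually_const_lt (by simpa using hpos a ha)
      obtain ⟨ε, hε, hε0⟩ := (hev.and self_mem_nhdsWithin).exists
      refine ⟨ε, hε0, ?_⟩
      rw [hT]
      intro a ha
      by_cases haT : a ∈ T'
      · exact (hε a haT).le
      · have hz : ∀ z ∈ C, inner ℝ a z = 0 := by
          intro z hz
          by_contra hne
          exact haT (Finset.mem_filter.2 ⟨ha, z, hz, hne⟩)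
        rw [inner_sub_right, real_inner_smul_right, hz x hx, hz y hy]; simp
  have hsub : (⋃ a ∈ T', C ∩ eqz a) ⊆ C := by
    simp only [Set.iUnion_subset_iff]; exact fun a _ => Set.inter_subset_left
  have : ind C - ind (relint C) = ind (⋃ a ∈ T', C ∩ eqz a) := by
    rw [hrel]
    ext x
    by_cases hx : x ∈ C <;> by_cases hx' : x ∈ ⋃ a ∈ T', C ∩ eqz a
    · simp only [Pi.sub_apply, ind_of_mem hx, ind_of_mem hx',
        ind_of_notMem (fun h : x ∈ C \ ⋃ a ∈ T', C ∩ eqz a => h.2 hx')]; rfl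
    · simp only [Pi.sub_apply, ind_of_mem hx, ind_of_notMem hx',
        ind_of_mem (show x ∈ C \ ⋃ a ∈ T', C ∩ eqz a from ⟨hx, hx'⟩)]; rfl
    · exact absurd (hsub hx') hx
    · simp only [Pi.sub_apply, ind_of_notMem hx, ind_of_notMem hx',
        ind_of_notMem (fun h : x ∈ C \ ⋃ a ∈ T', C ∩ eqz a => hx h.1)]; rfl
  rw [this]
  refine ind_iUnion_mem T' _ fun a ha => ⟨hC.inter (isConvexCone_eq a), ?_⟩
  obtain ⟨p, hp, hap⟩ := hT' a ha
  have hlt : dim (C ∩ eqz a) < dim C := by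
    apply Submodule.finrank_lt_finrank_of_lt
    refine lt_of_le_of_ne (Submodule.span_mono Set.inter_subset_left) fun h => ?_
    have hp' : p ∈ Submodule.span ℝ (C ∩ eqz a) := by rw [h]; exact Submodule.subset_span hp
    have : inner ℝ a p = 0 := inner_eq_zero_of_mem_span hp'
    linarith
  omega

theorem relint_ge {C : Set V} (hC : IsConvexCone C) {a p : V} (hp : p ∈ C)
    (hap : 0 < inner ℝ a p) : relint (C ∩ ge a) = relint C ∩ {x | 0 < inner ℝ a x} := by
  ext x
  constructor
  · rintro ⟨⟨hx, hax⟩, h⟩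
    refine ⟨⟨hx, fun y hy => ?_⟩, ?_⟩
    · by_cases hay : 0 ≤ inner ℝ a y
      · obtain ⟨ε, hε, hm⟩ := h y ⟨hy, hay⟩
        exact ⟨ε, hε, hm.1⟩
      · push Not at hay
        have hl : 0 ≤ -inner ℝ a y / inner ℝ a p := div_nonneg (by linarith) hap.le
        obtain ⟨ε, hε, hm⟩ := h (y + (-inner ℝ a y / inner ℝ a p) • p)
          ⟨hC.add_mem hy (hC.smul_mem hl hp), by
            change 0 ≤ inner ℝ a _
            rw [inner_add_right, real_inner_smul_right, div_mul_cancel₀ _ hap.ne']; simp⟩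
        refine ⟨ε, hε, ?_⟩
        have := hC.add_mem hm.1 (hC.smul_mem (mul_nonneg hε.le hl) hp)
        convert this using 1
        rw [smul_add, mul_smul]; abel
    · obtain ⟨ε, hε, hm⟩ := h p ⟨hp, hap.le⟩
      have h2 : 0 ≤ inner ℝ a (x - ε • p) := hm.2
      rw [inner_sub_right, real_inner_smul_right] at h2
      change 0 < inner ℝ a x
      nlinarith [mul_pos hε hap]
  · rintro ⟨⟨hx, h⟩, hax⟩
    have hax : 0 < inner ℝ a x := hax
    refine ⟨⟨hx, hax.le⟩, fun y hy => ?_⟩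
    obtain ⟨ε, hε, hm⟩ := h y hy.1
    have hay : 0 ≤ inner ℝ a y := hy.2
    refine ⟨min ε (inner ℝ a x / (inner ℝ a y + 1)), lt_min hε (by positivity), ?_, ?_⟩
    · set δ := min ε (inner ℝ a x / (inner ℝ a y + 1))
      have hδ : δ ≤ ε := min_le_left _ _
      have := hC.add_mem hm (hC.smul_mem (sub_nonneg.2 hδ) hy.1)
      convert this using 1
      rw [sub_smul]; abel
    · change 0 ≤ inner ℝ a _
      rw [inner_sub_right, real_inner_smul_right, sub_nonneg]
      calc _ ≤ inner ℝ a x / (inner ℝ a y + 1) * inner ℝ a y :=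
            mul_le_mul_of_nonneg_right (min_le_right _ _) hay
        _ ≤ inner ℝ a x := by
            rw [div_mul_eq_mul_div, div_le_iff₀ (by positivity)]; nlinarith

theorem relint_eqz {C : Set V} (hC : IsConvexCone C) {a p q : V} (hp : p ∈ C)
    (hap : 0 < inner ℝ a p) (hq : q ∈ C) (haq : inner ℝ a q < 0) :
    relint (C ∩ eqz a) = relint C ∩ eqz a := by
  ext x
  constructor
  · rintro ⟨⟨hx, hax⟩, h⟩
    refine ⟨⟨hx, fun y hy => ?_⟩, hax⟩
    have key : ∀ r ∈ C, ∀ l : ℝ, 0 ≤ l → inner ℝ a (y + l • r) = 0 →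
        ∃ ε : ℝ, 0 < ε ∧ x - ε • y ∈ C := by
      intro r hr l hl h0
      obtain ⟨ε, hε, hm⟩ := h (y + l • r) ⟨hC.add_mem hy (hC.smul_mem hl hr), h0⟩
      refine ⟨ε, hε, ?_⟩
      have := hC.add_mem hm.1 (hC.smul_mem (mul_nonneg hε.le hl) hr)
      convert this using 1
      rw [smul_add, mul_smul]; abel
    rcases le_total 0 (inner ℝ a y) with hay | hay
    · refine key q hq (inner ℝ a y / (-inner ℝ a q)) (div_nonneg hay (by linarith)) ?_
      rw [inner_add_right, real_inner_smul_right]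
      have : inner ℝ a q ≠ 0 := haq.ne
      field_simp; ring
    · refine key p hp (-inner ℝ a y / inner ℝ a p) (div_nonneg (by linarith) hap.le) ?_
      rw [inner_add_right, real_inner_smul_right]
      have : inner ℝ a p ≠ 0 := hap.ne'
      field_simp; ring
  · rintro ⟨⟨hx, h⟩, hax⟩
    refine ⟨⟨hx, hax⟩, fun y hy => ?_⟩
    obtain ⟨ε, hε, hm⟩ := h y hy.1
    refine ⟨ε, hε, hm, ?_⟩
    have h1 : inner ℝ a x = 0 := hax
    have h2 : inner ℝ a y = 0 := hy.2
    change inner ℝ a _ = 0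
    rw [inner_sub_right, real_inner_smul_right, h1, h2]; simp

theorem dim_ge {C : Set V} (hC : IsConvexCone C) {a p : V} (hp : p ∈ C)
    (hap : 0 < inner ℝ a p) : dim (C ∩ ge a) = dim C := by
  suffices h : Submodule.span ℝ (C ∩ ge a) = Submodule.span ℝ C by rw [dim, dim, h]
  refine le_antisymm (Submodule.span_mono Set.inter_subset_left) (Submodule.span_le.2 ?_)
  intro y hy
  have hp' : p ∈ Submodule.span ℝ (C ∩ ge a) := Submodule.subset_span ⟨hp, hap.le⟩
  by_cases hay : 0 ≤ inner ℝ a y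
  · exact Submodule.subset_span ⟨hy, hay⟩
  · push Not at hay
    have hl : 0 ≤ -inner ℝ a y / inner ℝ a p := div_nonneg (by linarith) hap.le
    have h1 : y + (-inner ℝ a y / inner ℝ a p) • p ∈ Submodule.span ℝ (C ∩ ge a) :=
      Submodule.subset_span ⟨hC.add_mem hy (hC.smul_mem hl hp), by
        change 0 ≤ inner ℝ a _
        rw [inner_add_right, real_inner_smul_right, div_mul_cancel₀ _ hap.ne']; simp⟩
    have := Submodule.sub_mem _ h1 (Submodule.smul_mem _ (-inner ℝ a y / inner ℝ a p) hp')
    simpa using this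

theorem dim_eqz {C : Set V} (hC : IsConvexCone C) {a p q : V} (hp : p ∈ C)
    (hap : 0 < inner ℝ a p) (hq : q ∈ C) (haq : inner ℝ a q < 0) :
    dim C = dim (C ∩ eqz a) + 1 := by
  set S := Submodule.span ℝ (C ∩ eqz a) with hS
  have hS0 : ∀ x ∈ S, inner ℝ a x = 0 := fun x hx => inner_eq_zero_of_mem_span hx
  have hp0 : p ≠ 0 := by rintro rfl; simp at hap
  have hspan : Submodule.span ℝ C = S ⊔ Submodule.span ℝ {p} := by
    refine le_antisymm (Submodule.span_le.2 ?_) (sup_le (Submodule.span_mono Set.inter_subset_left)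
      (Submodule.span_mono (by simpa using hp)))
    have hneg : ∀ y ∈ C, inner ℝ a y ≤ 0 → y ∈ S ⊔ Submodule.span ℝ {p} := by
      intro y hy hay
      have hl : 0 ≤ -inner ℝ a y / inner ℝ a p := div_nonneg (by linarith) hap.le
      have h1 : y + (-inner ℝ a y / inner ℝ a p) • p ∈ S :=
        Submodule.subset_span ⟨hC.add_mem hy (hC.smul_mem hl hp), by
          change inner ℝ a _ = 0
          rw [inner_add_right, real_inner_smul_right, div_mul_cancel₀ _ hap.ne']; simp⟩
      have := Submodule.sub_mem _ (Submodule.mem_sup_left (T := Submodule.span ℝ {p}) h1)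
        (Submodule.mem_sup_right (S := S) (Submodule.smul_mem _ (-inner ℝ a y / inner ℝ a p)
          (Submodule.mem_span_singleton_self p)))
      simpa using this
    intro y hy
    rcases le_total (inner ℝ a y) 0 with hay | hay
    · exact hneg y hy hay
    · have hl : 0 ≤ inner ℝ a y / (-inner ℝ a q) := div_nonneg hay (by linarith)
      have h1 : y + (inner ℝ a y / (-inner ℝ a q)) • q ∈ S ⊔ Submodule.span ℝ {p} := by
        refine hneg _ (hC.add_mem hy (hC.smul_mem hl hq)) (le_of_eq ?_)
        rw [inner_add_right, real_inner_smul_right]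
        have : inner ℝ a q ≠ 0 := haq.ne
        field_simp; ring
      have := Submodule.sub_mem _ h1
        (Submodule.smul_mem _ (inner ℝ a y / (-inner ℝ a q)) (hneg q hq haq.le))
      simpa using this
  have hinf : S ⊓ Submodule.span ℝ {p} = ⊥ := by
    rw [eq_bot_iff]
    rintro x ⟨h1, h2⟩
    obtain ⟨c, rfl⟩ := Submodule.mem_span_singleton.1 h2
    have := hS0 _ h1
    rw [real_inner_smul_right] at this
    have : c = 0 := by
      rcases mul_eq_zero.1 this with h | h
      · exact h
      · exact absurd h hap.ne'
    simp [this]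
  have := Submodule.finrank_sup_add_finrank_inf_eq S (Submodule.span ℝ {p})
  rw [hinf, finrank_bot, finrank_span_singleton hp0, ← hspan] at this
  simpa [dim] using this

end Valuations
end ConeRing

namespace ConeRing
section Interior
variable {V W : Type*} [NormedAddCommGroup V] [InnerProductSpace ℝ V] [FiniteDimensional ℝ V]
  [NormedAddCommGroup W] [InnerProductSpace ℝ W] [FiniteDimensional ℝ W]
  {A : Type*} [AddCommGroup A]

/-- The value of the interior operator on a convex cone: `(-1) ^ dim C` times the characteristic
function of the interior of `C`. -/
def signedInterior (C : Set V) : V → ℤ := (-1 : ℤ) ^ dim C • ind (relint C)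

theorem cut_of_trivial {k : ℕ} {F : Set V → A}
    (h : ∀ P, KC k P → ∀ a p q : V, p ∈ P → 0 < inner ℝ a p → q ∈ P → inner ℝ a q < 0 →
      F P + F (P ∩ eqz a) = F (P ∩ ge a) + F (P ∩ ge (-a))) : Cut k F := by
  intro P hP a
  by_cases h1 : ∃ p ∈ P, 0 < inner ℝ a p
  · obtain ⟨p, hp, hap⟩ := h1
    by_cases h2 : ∃ q ∈ P, inner ℝ a q < 0
    · obtain ⟨q, hq, haq⟩ := h2
      exact h P hP a p q hp hap hq haq
    · push Not at h2
      have e1 : P ∩ ge a = P := Set.inter_eq_left.2 fun x hx => h2 x hx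
      have e2 : P ∩ ge (-a) = P ∩ eqz a := by
        ext x
        refine and_congr_right fun hx => ?_
        simp only [ge, eqz, Set.mem_ofPred_eq, inner_neg_left]
        have := h2 x hx
        constructor <;> intro h <;> linarith
      rw [e1, e2]
  · push Not at h1
    have e1 : P ∩ ge (-a) = P := Set.inter_eq_left.2 fun x hx => by
      have := h1 x hx
      simp only [ge, Set.mem_ofPred_eq, inner_neg_left]; linarith
    have e2 : P ∩ ge a = P ∩ eqz a := by
      ext x
      refine and_congr_right fun hx => ?_
      simp only [ge, eqz, Set.mem_ofPred_eq]
      have := h1 x hx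
      constructor <;> intro h <;> linarith
    rw [e1, e2, add_comm]

theorem cut_signedInterior (k : ℕ) : Cut k (signedInterior : Set V → V → ℤ) := by
  apply cut_of_trivial
  intro P hP a p q hp hap hq haq
  have hap' : inner ℝ (-a) p < 0 := by rw [inner_neg_left]; linarith
  have haq' : 0 < inner ℝ (-a) q := by rw [inner_neg_left]; linarith
  have h1 : dim P = dim (P ∩ eqz a) + 1 := dim_eqz hP.1 hp hap hq haq
  rw [signedInterior, signedInterior, signedInterior, signedInterior,
    relint_ge hP.1 hp hap, relint_ge hP.1 hq haq', relint_eqz hP.1 hp hap hq haq,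
    dim_ge hP.1 hp hap, dim_ge hP.1 hq haq', h1, pow_succ]
  have : ind (relint P) = ind (relint P ∩ {x | 0 < inner ℝ a x}) +
      ind (relint P ∩ {x | 0 < inner ℝ (-a) x}) + ind (relint P ∩ eqz a) := by
    ext x
    simp only [Pi.add_apply]
    by_cases hx : x ∈ relint P
    · rcases lt_trichotomy (inner ℝ a x) 0 with h | h | h
      · rw [ind_of_mem hx, ind_of_notMem (fun h' => lt_asymm h h'.2),
          ind_of_mem (show x ∈ relint P ∩ {x | 0 < inner ℝ (-a) x} from
            ⟨hx, by simpa [inner_neg_left] using h⟩), ind_of_notMem (fun h' => h.ne h'.2)]; rfl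
      · rw [ind_of_mem hx, ind_of_notMem (fun h' => (ne_of_gt h'.2) h),
          ind_of_notMem (fun h' => by
            have := h'.2; simp only [Set.mem_ofPred_eq, inner_neg_left] at this; linarith),
          ind_of_mem (show x ∈ relint P ∩ eqz a from ⟨hx, h⟩)]; rfl
      · rw [ind_of_mem hx, ind_of_mem (show x ∈ relint P ∩ {x | 0 < inner ℝ a x} from ⟨hx, h⟩),
          ind_of_notMem (fun h' => by
            have := h'.2; simp only [Set.mem_ofPred_eq, inner_neg_left] at this; linarith),
          ind_of_notMem (fun h' => h.ne' h'.2)]; rfl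
    · rw [ind_of_notMem hx, ind_of_notMem (fun h => hx h.1), ind_of_notMem (fun h => hx h.1),
        ind_of_notMem (fun h => hx h.1)]; rfl
  rw [this]
  module

theorem Sig.mono {k l : ℕ} (h : k ≤ l) : Sig V k ≤ Sig V l := by
  refine AddSubgroup.closure_mono ?_
  rintro f ⟨C, hC, rfl⟩
  exact ⟨C, ⟨hC.1, hC.2.trans h⟩, rfl⟩

theorem ind_relint_mem {k : ℕ} {C : Set V} (h : KC k C) : ind (relint C) ∈ Sig V k := by
  have := sub_mem (ind_mem_Sig h) (relint_ind_mem (k := k) h.1 (h.2.trans (Nat.le_succ k)))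
  simpa using this

theorem interior_mem (k : ℕ) (f : Sig V k) : ext (cut_signedInterior k) f ∈ Sig V k := by
  obtain ⟨f, hf⟩ := f
  induction hf using AddSubgroup.closure_induction with
  | mem f h =>
    obtain ⟨C, hC, rfl⟩ := h
    rw [ext_ind _ hC]
    exact AddSubgroup.zsmul_mem _ (ind_relint_mem hC) _
  | zero =>
    have e : (⟨0, AddSubgroup.zero_mem _⟩ : Sig V k) = 0 := rfl
    rw [e, map_zero]; exact zero_mem _
  | add f f' hf hf' h h' =>
    have e : (⟨f + f', AddSubgroup.add_mem _ hf hf'⟩ : Sig V k) = ⟨f, hf⟩ + ⟨f', hf'⟩ := rfl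
    rw [e, map_add]; exact add_mem h h'
  | neg f hf h =>
    have e : (⟨-f, AddSubgroup.neg_mem _ hf⟩ : Sig V k) = -⟨f, hf⟩ := rfl
    rw [e, map_neg]; exact neg_mem h

variable (V) in
/-- The interior operator `I` on conical constructible functions: on (the characteristic function
of) a convex cone `C` it is `(-1) ^ dim C` times the interior of `C`. -/
def interiorSig (k : ℕ) : Sig V k →+ Sig V k :=
  (ext (cut_signedInterior k)).codRestrict (Sig V k) (interior_mem k)

theorem interiorSig_ind {k : ℕ} {C : Set V} (h : KC k C) :
    interiorSig V k ⟨ind C, ind_mem_Sig h⟩ = (-1 : ℤ) ^ dim C • (⟨ind (relint C), ind_relint_mem h⟩ : Sig V k) :=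
  Subtype.ext (ext_ind _ h)

theorem boundary_mem (k : ℕ) (f : Sig V (k + 1)) :
    (f - (-1 : ℤ) ^ (k + 1) • interiorSig V (k + 1) f : V → ℤ) ∈ Sig V k := by
  obtain ⟨f, hf⟩ := f
  induction hf using AddSubgroup.closure_induction with
  | mem f h =>
    obtain ⟨C, hC, rfl⟩ := h
    rw [interiorSig_ind hC]
    simp only [AddSubgroup.coe_zsmul]
    rcases Nat.lt_or_ge (dim C) (k + 1) with h | h
    · have hC' : KC k C := ⟨hC.1, Nat.lt_succ_iff.1 h⟩
      exact sub_mem (ind_mem_Sig hC') (zsmul_mem (zsmul_mem (ind_relint_mem hC') _) _)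
    · have e : dim C = k + 1 := le_antisymm hC.2 h
      rw [e, smul_smul, ← mul_pow]
      simpa using relint_ind_mem hC.1 hC.2
  | zero =>
    have e : (⟨0, AddSubgroup.zero_mem _⟩ : Sig V (k + 1)) = 0 := rfl
    rw [e, map_zero]; simp
  | add f f' hf hf' h h' =>
    have e : (⟨f + f', AddSubgroup.add_mem _ hf hf'⟩ : Sig V (k + 1)) = ⟨f, hf⟩ + ⟨f', hf'⟩ := rfl
    rw [e, map_add]
    convert add_mem h h' using 1
    simp only [AddSubgroup.coe_add, smul_add]
    abel
  | neg f hf h =>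
    have e : (⟨-f, AddSubgroup.neg_mem _ hf⟩ : Sig V (k + 1)) = -⟨f, hf⟩ := rfl
    rw [e, map_neg]
    convert neg_mem h using 1
    simp only [AddSubgroup.coe_neg, smul_neg]
    abel

variable (V) in
/-- The boundary operator `ξ ↦ ξ - (-1) ^ (k + 1) I ξ`, which lowers the dimension filtration. -/
def boundarySig (k : ℕ) : Sig V (k + 1) →+ Sig V k :=
  ((Sig V (k + 1)).subtype - (-1 : ℤ) ^ (k + 1) •
    (Sig V (k + 1)).subtype.comp (interiorSig V (k + 1))).codRestrict (Sig V k) (boundary_mem k)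

theorem boundarySig_coe (k : ℕ) (f : Sig V (k + 1)) :
    (boundarySig V k f : V → ℤ) = f - (-1 : ℤ) ^ (k + 1) • interiorSig V (k + 1) f := rfl

/-! ### The action of linear isometries -/

theorem ind_image (g : V ≃ₗᵢ[ℝ] V) (P : Set V) : ind (g '' P) = ind P ∘ g.symm := by
  ext x
  by_cases hx : g.symm x ∈ P
  · rw [Function.comp_apply, ind_of_mem hx,
      ind_of_mem (show x ∈ g '' P from ⟨_, hx, by simp⟩)]
  · rw [Function.comp_apply, ind_of_notMem hx, ind_of_notMem]
    rintro ⟨y, hy, rfl⟩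
    exact hx (by simpa using hy)

theorem dim_image (g : V ≃ₗᵢ[ℝ] V) (P : Set V) : dim (g '' P) = dim P := by
  have : Submodule.span ℝ (g '' P) = (Submodule.span ℝ P).map g.toLinearEquiv.toLinearMap := by
    rw [Submodule.map_span]; rfl
  rw [dim, dim, this]
  exact LinearEquiv.finrank_map_eq g.toLinearEquiv _

theorem IsConvexCone.image_iso {P : Set V} (h : IsConvexCone P) (g : V ≃ₗᵢ[ℝ] V) :
    IsConvexCone (g '' P) := h.image g.toLinearEquiv.toLinearMap

theorem IsCone.image_iso {P : Set V} (h : IsCone P) (g : V ≃ₗᵢ[ℝ] V) :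
    IsCone (g '' P) := h.image g.toLinearEquiv.toLinearMap

theorem KC.image {k : ℕ} {P : Set V} (h : KC k P) (g : V ≃ₗᵢ[ℝ] V) : KC k (g '' P) :=
  ⟨h.1.image_iso g, (dim_image g P).trans_le h.2⟩

theorem relint_image (g : V ≃ₗᵢ[ℝ] V) (P : Set V) : relint (g '' P) = g '' relint P := by
  ext x
  constructor
  · rintro ⟨⟨y, hy, rfl⟩, h⟩
    refine ⟨y, ⟨hy, fun z hz => ?_⟩, rfl⟩
    obtain ⟨ε, hε, w, hw, hw'⟩ := h (g z) ⟨z, hz, rfl⟩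
    refine ⟨ε, hε, ?_⟩
    have : w = y - ε • z := g.injective (by rw [hw', map_sub, map_smul])
    rwa [← this]
  · rintro ⟨y, ⟨hy, h⟩, rfl⟩
    refine ⟨⟨y, hy, rfl⟩, ?_⟩
    rintro _ ⟨z, hz, rfl⟩
    obtain ⟨ε, hε, hm⟩ := h z hz
    exact ⟨ε, hε, _, hm, by rw [map_sub, map_smul]⟩

theorem comp_mem_Sig {k : ℕ} (g : V ≃ₗᵢ[ℝ] V) {f : V → ℤ} (hf : f ∈ Sig V k) :
    f ∘ g.symm ∈ Sig V k := by
  induction hf using AddSubgroup.closure_induction with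
  | mem f h =>
    obtain ⟨C, hC, rfl⟩ := h
    rw [← ind_image]; exact ind_mem_Sig (hC.image g)
  | zero => exact zero_mem _
  | add f f' _ _ h h' => exact add_mem h h'
  | neg f _ h => exact neg_mem h

/-- The action of a linear isometry on conical constructible functions. -/
def isoSig (k : ℕ) (g : V ≃ₗᵢ[ℝ] V) : Sig V k →+ Sig V k where
  toFun f := ⟨f.1 ∘ g.symm, comp_mem_Sig g f.2⟩
  map_zero' := rfl
  map_add' _ _ := rfl

theorem isoSig_ind {k : ℕ} (g : V ≃ₗᵢ[ℝ] V) {P : Set V} (h : ind P ∈ Sig V k)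
    (h' : ind (g '' P) ∈ Sig V k) : isoSig k g ⟨ind P, h⟩ = ⟨ind (g '' P), h'⟩ :=
  Subtype.ext (ind_image g P).symm

theorem interiorSig_isoSig (k : ℕ) (g : V ≃ₗᵢ[ℝ] V) (f : Sig V k) :
    interiorSig V k (isoSig k g f) = isoSig k g (interiorSig V k f) := by
  have : (interiorSig V k).comp (isoSig k g) = (isoSig k g).comp (interiorSig V k) := by
    refine Sig.hom_ext fun C hC => ?_
    simp only [AddMonoidHom.comp_apply]
    rw [isoSig_ind g _ (ind_mem_Sig (hC.image g)), interiorSig_ind (hC.image g),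
      interiorSig_ind hC, map_zsmul, dim_image]
    congr 1
    refine Subtype.ext ?_
    change ind (relint (g '' C)) = ind (relint C) ∘ g.symm
    rw [relint_image, ind_image]
  exact DFunLike.congr_fun this f

theorem boundarySig_isoSig (k : ℕ) (g : V ≃ₗᵢ[ℝ] V) (f : Sig V (k + 1)) :
    boundarySig V k (isoSig (k + 1) g f) = isoSig k g (boundarySig V k f) := by
  refine Subtype.ext ?_
  rw [boundarySig_coe, interiorSig_isoSig]
  rfl

/-- Two valuations of cones that agree on convex cones agree. -/
theorem valuation_unique {F G : Set V → A} (hF0 : F ∅ = 0) (hG0 : G ∅ = 0)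
    (hF : ∀ P Q, IsCone P → IsCone Q → F (P ∪ Q) + F (P ∩ Q) = F P + F Q)
    (hG : ∀ P Q, IsCone P → IsCone Q → G (P ∪ Q) + G (P ∩ Q) = G P + G Q)
    (h : ∀ C, IsConvexCone C → F C = G C) {P : Set V} (hP : IsCone P) : F P = G P := by
  suffices key : ∀ (n : ℕ) (l : List (Set V)), l.length = n → (∀ C ∈ l, IsConvexCone C) →
      F (⋃₀ {C | C ∈ l}) = G (⋃₀ {C | C ∈ l}) by
    obtain ⟨S, hS, hS', rfl⟩ := hP
    have := key _ hS.toFinset.toList rfl (by simpa using hS')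
    simpa using this
  intro n
  induction n with
  | zero =>
    intro l hn _
    rw [List.length_eq_zero_iff] at hn
    subst hn
    simp [hF0, hG0]
  | succ n ih =>
    rintro (_ | ⟨C, l⟩) hn hl
    · simp at hn
    · have hlen : l.length = n := by simpa using hn
      have hC := hl C (by simp)
      have hcone : IsCone (⋃₀ {D | D ∈ l}) := ⟨{D | D ∈ l}, l.finite_toSet,
        fun D hD => hl D (by simp only [Set.mem_ofPred_eq] at hD; simp [hD]), rfl⟩
      have h1 := ih l hlen (fun D hD => hl D (by simp [hD]))
      have h2 := ih (l.map (C ∩ ·)) (by simpa using hlen) (by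
          intro D hD
          obtain ⟨D', hD', rfl⟩ := List.mem_map.1 hD
          exact hC.inter (hl D' (by simp [hD'])))
      have e1 : ⋃₀ {D | D ∈ l.map (C ∩ ·)} = C ∩ ⋃₀ {D | D ∈ l} := by
          ext x
          simp only [Set.mem_inter_iff, Set.mem_sUnion, Set.mem_ofPred_eq, List.mem_map]
          constructor
          · rintro ⟨_, ⟨D, hD, rfl⟩, hx, hxD⟩; exact ⟨hx, D, hD, hxD⟩
          · rintro ⟨hx, D, hD, hxD⟩; exact ⟨_, ⟨D, hD, rfl⟩, hx, hxD⟩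
      have e2 : ⋃₀ {D | D ∈ C :: l} = C ∪ ⋃₀ {D | D ∈ l} := by ext x; simp
      rw [e1] at h2
      have h3 := hF _ _ hC.isCone hcone
      have h4 := hG _ _ hC.isCone hcone
      rw [h C hC, h1, h2, ← h4] at h3
      rw [e2]
      exact add_right_cancel h3

end Interior
end ConeRing

namespace ConeRing

/-- Euclidean space `ℝⁿ`. -/
abbrev E (n : ℕ) : Type := EuclideanSpace ℝ (Fin n)

/-- The cones in `ℝⁿ`. -/
abbrev Cone (n : ℕ) : Type := {P : Set (E n) // IsCone P}

/-- The defining relations of `L n`: additivity, vanishing on the empty cone, and invariance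
under linear isometries of `ℝⁿ`. -/
inductive Relation (n : ℕ) : FreeAbelianGroup (Cone n) → Prop
  | empty : Relation n (FreeAbelianGroup.of ⟨∅, isCone_empty⟩)
  | union (P Q : Cone n) : Relation n
      (FreeAbelianGroup.of ⟨P.1 ∪ Q.1, P.2.union Q.2⟩ - FreeAbelianGroup.of P -
        FreeAbelianGroup.of Q + FreeAbelianGroup.of ⟨P.1 ∩ Q.1, P.2.inter Q.2⟩)
  | isometry (g : E n ≃ₗᵢ[ℝ] E n) (P : Cone n) : Relation n
      (FreeAbelianGroup.of ⟨g '' P.1, P.2.image_iso g⟩ - FreeAbelianGroup.of P)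

/-- The group `Lₙ`: the recipient of the universal valuation of cones in `ℝⁿ` that is invariant
under linear isometries. -/
def L (n : ℕ) : Type :=
  FreeAbelianGroup (Cone n) ⧸ AddSubgroup.closure {r | Relation n r}

instance (n : ℕ) : AddCommGroup (L n) :=
  inferInstanceAs (AddCommGroup (FreeAbelianGroup (Cone n) ⧸ AddSubgroup.closure {r | Relation n r}))

open Classical in
/-- The class `⟨P⟩ₙ ∈ Lₙ` of a cone `P` in `ℝⁿ` (and `0` if `P` is not a cone). -/
def cls (n : ℕ) (P : Set (E n)) : L n :=
  if h : IsCone P then QuotientAddGroup.mk' (AddSubgroup.closure {r | Relation n r})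
    (FreeAbelianGroup.of (⟨P, h⟩ : Cone n)) else 0

section Basic
variable {n : ℕ} {A : Type*} [AddCommGroup A]

theorem cls_of {P : Set (E n)} (h : IsCone P) :
    cls n P = QuotientAddGroup.mk' (AddSubgroup.closure {r | Relation n r})
      (FreeAbelianGroup.of (⟨P, h⟩ : Cone n)) := dif_pos h

theorem mk_relation {r : FreeAbelianGroup (Cone n)} (h : Relation n r) :
    QuotientAddGroup.mk' (AddSubgroup.closure {r | Relation n r}) r = 0 :=
  (QuotientAddGroup.eq_zero_iff _).2 (AddSubgroup.subset_closure h)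

theorem cls_empty : cls n ∅ = 0 := by
  rw [cls_of isCone_empty]; exact mk_relation .empty

theorem cls_union {P Q : Set (E n)} (hP : IsCone P) (hQ : IsCone Q) :
    cls n (P ∪ Q) + cls n (P ∩ Q) = cls n P + cls n Q := by
  have := mk_relation (.union ⟨P, hP⟩ ⟨Q, hQ⟩)
  rw [map_add, map_sub, map_sub, ← cls_of, ← cls_of, ← cls_of, ← cls_of] at this
  have e : cls n (P ∪ Q) - cls n P - cls n Q + cls n (P ∩ Q) = 0 := this
  rw [← sub_eq_zero]; refine Eq.trans ?_ e; abel

theorem cls_image {P : Set (E n)} (hP : IsCone P) (g : E n ≃ₗᵢ[ℝ] E n) :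
    cls n (g '' P) = cls n P := by
  have := mk_relation (.isometry g ⟨P, hP⟩)
  rw [map_sub, ← cls_of, ← cls_of] at this
  exact sub_eq_zero.1 this

theorem L.hom_ext {Φ Ψ : L n →+ A} (h : ∀ P, IsCone P → Φ (cls n P) = Ψ (cls n P)) : Φ = Ψ := by
  refine QuotientAddGroup.addMonoidHom_ext _ (FreeAbelianGroup.lift_ext _ _ ?_)
  rintro ⟨P, hP⟩
  have := h P hP
  rw [cls_of hP] at this
  exact this

theorem exists_lift (F : Set (E n) → A) (h0 : F ∅ = 0)
    (h1 : ∀ P Q, IsCone P → IsCone Q → F (P ∪ Q) + F (P ∩ Q) = F P + F Q)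
    (h2 : ∀ P, IsCone P → ∀ g : E n ≃ₗᵢ[ℝ] E n, F (g '' P) = F P) :
    ∃ Φ : L n →+ A, ∀ P, IsCone P → Φ (cls n P) = F P := by
  refine ⟨QuotientAddGroup.lift _ (FreeAbelianGroup.lift fun P : Cone n => F P.1) ?_, ?_⟩
  · rw [AddSubgroup.closure_le]
    rintro r (_ | ⟨P, Q⟩ | ⟨g, P⟩)
    · simpa using h0
    · have := h1 P.1 Q.1 P.2 Q.2
      simp only [SetLike.mem_coe, AddMonoidHom.mem_ker, map_add, map_sub,
        FreeAbelianGroup.lift_apply_of]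
      rw [eq_sub_of_add_eq this]; abel
    · simp [h2 P.1 P.2 g]
  · intro P hP
    rw [cls_of hP]
    exact FreeAbelianGroup.lift_apply_of (fun P : Cone n => F P.1) ⟨P, hP⟩

/-- The homomorphism on `L n` given by an invariant valuation of cones. -/
def lift (F : Set (E n) → A) (h0 : F ∅ = 0)
    (h1 : ∀ P Q, IsCone P → IsCone Q → F (P ∪ Q) + F (P ∩ Q) = F P + F Q)
    (h2 : ∀ P, IsCone P → ∀ g : E n ≃ₗᵢ[ℝ] E n, F (g '' P) = F P) : L n →+ A :=
  (exists_lift F h0 h1 h2).choose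

theorem lift_cls {F : Set (E n) → A} {h0 h1 h2} {P : Set (E n)} (hP : IsCone P) :
    lift F h0 h1 h2 (cls n P) = F P :=
  (exists_lift F h0 h1 h2).choose_spec P hP

theorem cut_of_valuation {V : Type*} [NormedAddCommGroup V] [InnerProductSpace ℝ V]
    [FiniteDimensional ℝ V] {F : Set V → A} {k : ℕ}
    (h : ∀ P Q, IsConvexCone P → IsConvexCone Q → F (P ∪ Q) + F (P ∩ Q) = F P + F Q) :
    Cut k F := by
  intro P hP a
  have := h _ _ (hP.ge a).1 (hP.ge (-a)).1
  have e1 : P ∩ ge a ∪ P ∩ ge (-a) = P := by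
    rw [← Set.inter_union_distrib_left, Set.inter_eq_left]
    intro x _
    simp only [ge, Set.mem_union, Set.mem_ofPred_eq, inner_neg_left, Left.nonneg_neg_iff]
    exact le_total _ _
  have e2 : P ∩ ge a ∩ (P ∩ ge (-a)) = P ∩ eqz a := by
    ext x
    simp only [ge, eqz, Set.mem_inter_iff, Set.mem_ofPred_eq, inner_neg_left,
      Left.nonneg_neg_iff, le_antisymm_iff]
    tauto
  rw [e1, e2] at this
  exact this

theorem ind_mem {P : Set (E n)} (hP : IsCone P) : ind P ∈ Sig (E n) n :=
  hP.ind_mem (by simp)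

theorem kc {C : Set (E n)} (hC : IsConvexCone C) : KC n C :=
  ⟨hC, (dim_le C).trans (by simp)⟩

open Classical in
/-- The value of a homomorphism on the characteristic function of a cone. -/
def evalCone (Φ : Sig (E n) n →+ A) (P : Set (E n)) : A :=
  if h : IsCone P then Φ ⟨ind P, ind_mem h⟩ else 0

theorem evalCone_of (Φ : Sig (E n) n →+ A) {P : Set (E n)} (h : IsCone P) :
    evalCone Φ P = Φ ⟨ind P, ind_mem h⟩ := dif_pos h

theorem evalCone_empty (Φ : Sig (E n) n →+ A) : evalCone Φ ∅ = 0 := by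
  rw [evalCone_of _ isCone_empty]
  have : (⟨ind ∅, ind_mem isCone_empty⟩ : Sig (E n) n) = 0 := Subtype.ext (Set.indicator_empty _)
  rw [this, map_zero]

theorem evalCone_union (Φ : Sig (E n) n →+ A) (P Q : Set (E n)) (hP : IsCone P) (hQ : IsCone Q) :
    evalCone Φ (P ∪ Q) + evalCone Φ (P ∩ Q) = evalCone Φ P + evalCone Φ Q := by
  rw [evalCone_of _ hP, evalCone_of _ hQ, evalCone_of _ (hP.union hQ), evalCone_of _ (hP.inter hQ),
    ← map_add, ← map_add]
  congr 1
  exact Subtype.ext (ind_union_add_inter P Q)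

/-- An isometry-invariant homomorphism on conical constructible functions on `ℝⁿ` induces
a homomorphism on `L n`. -/
def liftSig (Φ : Sig (E n) n →+ A) (h : ∀ g f, Φ (isoSig n g f) = Φ f) : L n →+ A :=
  lift (evalCone Φ) (evalCone_empty Φ) (evalCone_union Φ) fun P hP g => by
    rw [evalCone_of _ (hP.image_iso g), evalCone_of _ hP, ← h g ⟨ind P, _⟩,
      isoSig_ind g (ind_mem hP) (ind_mem (hP.image_iso g))]

theorem liftSig_cls {Φ : Sig (E n) n →+ A} {h} {P : Set (E n)} (hP : IsCone P) :
    liftSig Φ h (cls n P) = Φ ⟨ind P, ind_mem hP⟩ :=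
  (lift_cls hP).trans (evalCone_of _ hP)

theorem cut_cls : Cut n (cls n) := cut_of_valuation fun _ _ hP hQ => cls_union hP.isCone hQ.isCone

variable (n) in
/-- The quotient map from conical constructible functions on `ℝⁿ` to `L n`. -/
def clsSig : Sig (E n) n →+ L n := ext cut_cls

theorem clsSig_ind {P : Set (E n)} (hP : IsCone P) : clsSig n ⟨ind P, ind_mem hP⟩ = cls n P := by
  rw [← evalCone_of _ hP]
  refine valuation_unique (evalCone_empty _) cls_empty (evalCone_union _)
    (fun _ _ => cls_union) (fun C hC => ?_) hP
  rw [evalCone_of _ hC.isCone]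
  exact ext_ind cut_cls (kc hC)

theorem clsSig_isoSig (g : E n ≃ₗᵢ[ℝ] E n) (f : Sig (E n) n) :
    clsSig n (isoSig n g f) = clsSig n f := by
  have : (clsSig n).comp (isoSig n g) = clsSig n := by
    refine Sig.hom_ext fun C hC => ?_
    rw [AddMonoidHom.comp_apply, isoSig_ind g _ (ind_mem (hC.1.image_iso g).isCone),
      clsSig_ind (hC.1.image_iso g).isCone, clsSig_ind hC.1.isCone, cls_image hC.1.isCone]
  exact DFunLike.congr_fun this f

/-! ### The interior involution -/

variable (n) in
/-- The interior operator `I` on `L n`. -/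
def I : L n →+ L n :=
  liftSig ((clsSig n).comp (interiorSig (E n) n)) fun g f => by
    rw [AddMonoidHom.comp_apply, interiorSig_isoSig, clsSig_isoSig]; rfl

/-! ### The duality involution -/

theorem dualCone_union (P Q : Set (E n)) : dualCone (P ∪ Q) = dualCone P ∩ dualCone Q := by
  ext x
  simp only [dualCone, Set.mem_union, Set.mem_ofPred_eq, Set.mem_inter_iff]
  exact ⟨fun h => ⟨fun v hv => h v (.inl hv), fun v hv => h v (.inr hv)⟩,
    fun h v hv => hv.elim (h.1 v) (h.2 v)⟩

theorem dualCone_cut {P : Set (E n)} (hP : IsConvexCone P) (a : E n) :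
    dualCone (P ∩ eqz a) = dualCone (P ∩ ge a) ∪ dualCone (P ∩ ge (-a)) := by
  ext x
  constructor
  · intro h
    by_contra hx
    simp only [Set.mem_union, not_or] at hx
    obtain ⟨h1, h2⟩ := hx
    simp only [dualCone, Set.mem_ofPred_eq, not_forall, not_le] at h1 h2
    obtain ⟨v, ⟨hv, hav⟩, hxv⟩ := h1
    obtain ⟨w, ⟨hw, haw⟩, hxw⟩ := h2
    simp only [ge, Set.mem_ofPred_eq, inner_neg_left, Left.nonneg_neg_iff] at hav haw
    rcases haw.eq_or_lt with h0 | h0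
    · exact absurd (h w ⟨hw, h0⟩) (not_le.2 hxw)
    · have := h ((-inner ℝ a w) • v + (inner ℝ a v) • w)
        ⟨hP.add_mem (hP.smul_mem (by linarith) hv) (hP.smul_mem hav hw), by
          change inner ℝ a _ = 0
          rw [inner_add_right, real_inner_smul_right, real_inner_smul_right]; ring⟩
      rw [inner_add_right, real_inner_smul_right, real_inner_smul_right] at this
      nlinarith [mul_pos (neg_pos.2 h0) hxv, mul_nonneg hav hxw.le]
  · have hsub1 : P ∩ eqz a ⊆ P ∩ ge a := fun y hy => ⟨hy.1, le_of_eq (Eq.symm hy.2)⟩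
    have hsub2 : P ∩ eqz a ⊆ P ∩ ge (-a) := fun y hy => ⟨hy.1, by
      have : inner ℝ a y = 0 := hy.2
      simp [ge, this]⟩
    rintro (h | h) v hv
    · exact h v (hsub1 hv)
    · exact h v (hsub2 hv)

theorem cut_dual : Cut n fun P => cls n (dualCone P) := by
  intro P hP a
  have e1 : P ∩ ge a ∪ P ∩ ge (-a) = P := by
    rw [← Set.inter_union_distrib_left, Set.inter_eq_left]
    intro x _
    simp only [ge, Set.mem_union, Set.mem_ofPred_eq, inner_neg_left, Left.nonneg_neg_iff]
    exact le_total _ _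
  have h1 := cls_union (hP.ge a).1.dualCone.isCone (hP.ge (-a)).1.dualCone.isCone
  rw [← dualCone_union, e1, ← dualCone_cut hP.1] at h1
  simp only
  rw [← h1, add_comm]

theorem dualCone_image (g : E n ≃ₗᵢ[ℝ] E n) (P : Set (E n)) :
    dualCone (g '' P) = g '' dualCone P := by
  ext x
  simp only [dualCone, Set.mem_ofPred_eq, Set.mem_image]
  constructor
  · intro h
    exact ⟨g.symm x, fun v hv => by
      have := h (g v) ⟨v, hv, rfl⟩
      rwa [← g.inner_map_map, g.apply_symm_apply], g.apply_symm_apply x⟩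
  · rintro ⟨y, hy, rfl⟩ _ ⟨v, hv, rfl⟩
    rw [g.inner_map_map]; exact hy v hv

variable (n) in
/-- The duality operator `D` on `L n`: it takes the class of a convex cone to the class of the
dual convex cone. -/
def D : L n →+ L n :=
  liftSig (ext cut_dual) fun g f => by
    have : (ext cut_dual).comp (isoSig n g) = ext (cut_dual (n := n)) := by
      refine Sig.hom_ext fun C hC => ?_
      rw [AddMonoidHom.comp_apply, isoSig_ind g _ (ind_mem_Sig (hC.image g)),
        ext_ind _ (hC.image g), ext_ind _ hC, dualCone_image, cls_image hC.1.dualCone.isCone]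
    exact DFunLike.congr_fun this f

theorem D_cls {C : Set (E n)} (hC : IsConvexCone C) : D n (cls n C) = cls n (dualCone C) := by
  rw [D, liftSig_cls hC.isCone]
  exact ext_ind cut_dual (kc hC)

theorem I_cls {C : Set (E n)} (hC : IsConvexCone C) :
    I n (cls n C) = (-1 : ℤ) ^ dim C • clsSig n ⟨ind (relint C), ind_relint_mem (kc hC)⟩ := by
  rw [I, liftSig_cls hC.isCone, AddMonoidHom.comp_apply, interiorSig_ind (kc hC), map_zsmul]

end Basic

/-! ### Cones of dimension at most `k` in a larger Euclidean space -/

theorem exists_isometry_of_le {n k : ℕ} {C : Set (E n)} (h : dim C ≤ k) :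
    ∃ φ : E n →ₗ[ℝ] E k, ∀ x ∈ Submodule.span ℝ C, ‖φ x‖ = ‖x‖ := by
  set S := Submodule.span ℝ C
  let b := stdOrthonormalBasis ℝ S
  let v : Fin (Module.finrank ℝ S) → E k := fun i => EuclideanSpace.basisFun (Fin k) ℝ (Fin.castLE h i)
  have hv : Orthonormal ℝ v :=
    (EuclideanSpace.basisFun (Fin k) ℝ).orthonormal.comp _ (Fin.castLE_injective h)
  let ψ : S →ₗ[ℝ] E k := b.toBasis.constr ℝ v
  have hψ : ∀ x : S, ‖ψ x‖ = ‖x‖ := by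
    intro x
    have : ψ.isometryOfOrthonormal (v := b.toBasis) (by simp) (by
      have : (ψ ∘ b.toBasis : _ → E k) = v := by
        ext1 i; exact b.toBasis.constr_basis ℝ v i
      rw [this]; exact hv) x = ψ x := rfl
    rw [← this, LinearIsometry.norm_map]
  refine ⟨ψ.comp S.orthogonalProjectionOnto.toLinearMap, fun x hx => ?_⟩
  change ‖ψ (S.orthogonalProjectionOnto x)‖ = ‖x‖
  rw [hψ, Submodule.orthogonalProjectionOnto_mem_subspace_eq_self (⟨x, hx⟩ : S)]
  rfl

theorem cls_image_eq {m k : ℕ} {C : Set (E m)} (hC : IsCone C) (S : Submodule ℝ (E m))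
    (hS : C ⊆ S) {φ ψ : E m →ₗ[ℝ] E k} (hφ : ∀ x ∈ S, ‖φ x‖ = ‖x‖) (hψ : ∀ x ∈ S, ‖ψ x‖ = ‖x‖) :
    cls k (φ '' C) = cls k (ψ '' C) := by
  let φ' : S →ₗᵢ[ℝ] E k := ⟨φ.comp S.subtype, fun x => hφ x x.2⟩
  let ψ' : S →ₗᵢ[ℝ] E k := ⟨ψ.comp S.subtype, fun x => hψ x x.2⟩
  let g := (ψ'.comp φ'.equivRange.symm.toLinearIsometry).extend
  let g' : E k ≃ₗᵢ[ℝ] E k := g.toLinearIsometryEquiv rfl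
  have hg : ∀ x ∈ S, g' (φ x) = ψ x := by
    intro x hx
    have h1 : φ x = (φ'.equivRange ⟨x, hx⟩ : E k) := rfl
    change g (φ x) = _
    rw [h1, LinearIsometry.extend_apply]
    change ψ' (φ'.equivRange.symm (φ'.equivRange ⟨x, hx⟩)) = _
    rw [LinearIsometryEquiv.symm_apply_apply]
    rfl
  rw [← cls_image (hC.image φ) g', ← Set.image_comp]
  congr 1
  exact Set.image_congr fun x hx => hg x (hS hx)

open Classical in
/-- The class `⟨C⟩ₖ ∈ Lₖ` of a convex cone `C ⊆ ℝⁿ` of dimension at most `k`: the class of an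
isometric copy of `C` in `ℝᵏ`. -/
def clsLow (n k : ℕ) (C : Set (E n)) : L k :=
  if h : dim C ≤ k then cls k ((exists_isometry_of_le h).choose '' C) else 0

theorem clsLow_eq {n k : ℕ} {C : Set (E n)} (hC : IsCone C) (S : Submodule ℝ (E n))
    (hS : C ⊆ S) {φ : E n →ₗ[ℝ] E k} (hφ : ∀ x ∈ S, ‖φ x‖ = ‖x‖) (h : dim C ≤ k) :
    clsLow n k C = cls k (φ '' C) := by
  rw [clsLow, dif_pos h]
  exact cls_image_eq hC _ Submodule.subset_span (exists_isometry_of_le h).choose_spec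
    fun x hx => hφ x (Submodule.span_le.2 hS hx)

theorem cut_clsLow (n k : ℕ) : Cut k (clsLow n k) := by
  intro P hP a
  obtain ⟨φ, hφ⟩ := exists_isometry_of_le hP.2
  have hinj : Set.InjOn φ P := by
    intro x hx y hy hxy
    have := hφ (x - y) (Submodule.sub_mem _ (Submodule.subset_span hx) (Submodule.subset_span hy))
    rw [map_sub, hxy, sub_self, norm_zero] at this
    exact sub_eq_zero.1 (norm_eq_zero.1 this.symm)
  have key : ∀ Q, KC k Q → Q ⊆ P → clsLow n k Q = cls k (φ '' Q) := fun Q hQ hQP =>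
    clsLow_eq hQ.1.isCone _ (hQP.trans Submodule.subset_span) hφ hQ.2
  rw [key P hP subset_rfl, key _ (hP.eqz a) Set.inter_subset_left,
    key _ (hP.ge a) Set.inter_subset_left, key _ (hP.ge (-a)) Set.inter_subset_left,
    ← cls_union ((hP.ge a).1.image φ).isCone ((hP.ge (-a)).1.image φ).isCone, ← Set.image_union,
    ← hinj.image_inter Set.inter_subset_left Set.inter_subset_left]
  have e1 : P ∩ ge a ∪ P ∩ ge (-a) = P := by
    rw [← Set.inter_union_distrib_left, Set.inter_eq_left]
    intro x _
    simp only [ge, Set.mem_union, Set.mem_ofPred_eq, inner_neg_left, Left.nonneg_neg_iff]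
    exact le_total _ _
  have e2 : P ∩ ge a ∩ (P ∩ ge (-a)) = P ∩ eqz a := by
    ext x
    simp only [ge, eqz, Set.mem_inter_iff, Set.mem_ofPred_eq, inner_neg_left,
      Left.nonneg_neg_iff, le_antisymm_iff]
    tauto
  rw [e1, e2]

/-- The map from conical constructible functions on `ℝⁿ` of dimension at most `k` to `L k`. -/
def clsLowSig (n k : ℕ) : Sig (E n) k →+ L k := ext (cut_clsLow n k)

theorem clsLowSig_isoSig (n k : ℕ) (g : E n ≃ₗᵢ[ℝ] E n) (f : Sig (E n) k) :
    clsLowSig n k (isoSig k g f) = clsLowSig n k f := by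
  have : (clsLowSig n k).comp (isoSig k g) = clsLowSig n k := by
    refine Sig.hom_ext fun C hC => ?_
    obtain ⟨φ, hφ⟩ := exists_isometry_of_le (hC.image g).2
    rw [AddMonoidHom.comp_apply, isoSig_ind g _ (ind_mem_Sig (hC.image g)), clsLowSig,
      ext_ind _ (hC.image g), ext_ind _ hC,
      clsLow_eq (hC.image g).1.isCone _ Submodule.subset_span hφ (hC.image g).2,
      clsLow_eq (φ := φ.comp g.toLinearEquiv.toLinearMap) hC.1.isCone _ Submodule.subset_span
        (fun x hx => ?_) hC.2, ← Set.image_comp]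
    · rfl
    · refine (hφ (g x) ?_).trans (g.norm_map x)
      have : Submodule.span ℝ (g '' C) =
          (Submodule.span ℝ C).map g.toLinearEquiv.toLinearMap := by
        rw [Submodule.map_span]; rfl
      rw [this]
      exact ⟨x, hx, rfl⟩
  exact DFunLike.congr_fun this f

/-! ### The operator `δ` -/

/-- The operator `δₙ : Lₙ → Lₙ₋₁` induced by the boundary operator `ξ ↦ ξ - (-1) ^ n I ξ`
(with `δ₀ = 0`, since there is nothing in negative degrees). -/
def δ : (n : ℕ) → L n →+ L (n - 1)
  | 0 => 0
  | n + 1 => liftSig ((clsLowSig (n + 1) n).comp (boundarySig (E (n + 1)) n)) fun g f => by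
      rw [AddMonoidHom.comp_apply, boundarySig_isoSig, clsLowSig_isoSig]; rfl

/-- The operator `D ∘ δ ∘ D : Lₙ → Lₙ₋₁`. -/
def δbar (n : ℕ) : L n →+ L (n - 1) := (D (n - 1)).comp ((δ n).comp (D n))

/-- `Lₙ⁺`, the kernel of `δₙ`. -/
def Lplus (n : ℕ) : AddSubgroup (L n) := (δ n).ker

end ConeRing

namespace ConeRing

/-! ### The product -/

/-- The projection `ℝ^(i + j) → ℝ^i` to the first `i` coordinates. -/
def fstE (i j : ℕ) : E (i + j) →ₗ[ℝ] E i where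
  toFun x := WithLp.toLp 2 fun a => x (Fin.castAdd j a)
  map_add' _ _ := rfl
  map_smul' _ _ := rfl

/-- The projection `ℝ^(i + j) → ℝ^j` to the last `j` coordinates. -/
def sndE (i j : ℕ) : E (i + j) →ₗ[ℝ] E j where
  toFun x := WithLp.toLp 2 fun a => x (Fin.natAdd i a)
  map_add' _ _ := rfl
  map_smul' _ _ := rfl

theorem fstE_apply {i j : ℕ} (x : E (i + j)) (a : Fin i) : fstE i j x a = x (Fin.castAdd j a) := rfl

theorem sndE_apply {i j : ℕ} (x : E (i + j)) (a : Fin j) : sndE i j x a = x (Fin.natAdd i a) := rfl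

/-- The product `P × Q ⊆ ℝ^(i + j)` of `P ⊆ ℝ^i` and `Q ⊆ ℝ^j`. -/
def prodCone {i j : ℕ} (P : Set (E i)) (Q : Set (E j)) : Set (E (i + j)) :=
  {x | fstE i j x ∈ P ∧ sndE i j x ∈ Q}

theorem IsCone.prod {i j : ℕ} {P : Set (E i)} {Q : Set (E j)} (hP : IsCone P) (hQ : IsCone Q) :
    IsCone (prodCone P Q) := (hP.preimage (fstE i j)).inter (hQ.preimage (sndE i j))

/-- The point of `ℝ^(i + j)` with given components. -/
def pairE {i j : ℕ} (x : E i) (y : E j) : E (i + j) := WithLp.toLp 2 (Fin.append x y)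

@[simp] theorem fstE_pairE {i j : ℕ} (x : E i) (y : E j) : fstE i j (pairE x y) = x := by
  ext a; simp [fstE_apply, pairE]

@[simp] theorem sndE_pairE {i j : ℕ} (x : E i) (y : E j) : sndE i j (pairE x y) = y := by
  ext a; simp [sndE_apply, pairE]

theorem ext_E {i j : ℕ} {x y : E (i + j)} (h1 : fstE i j x = fstE i j y)
    (h2 : sndE i j x = sndE i j y) : x = y := by
  ext a
  induction a using Fin.addCases with
  | left a => exact congrArg (fun z : E i => z a) h1
  | right a => exact congrArg (fun z : E j => z a) h2

theorem norm_sq_E {i j : ℕ} (x : E (i + j)) : ‖x‖ ^ 2 = ‖fstE i j x‖ ^ 2 + ‖sndE i j x‖ ^ 2 := by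
  simp [EuclideanSpace.norm_sq_eq, Fin.sum_univ_add, fstE_apply, sndE_apply]

/-- The product of two linear isometries. -/
def prodIso {i j : ℕ} (g : E i ≃ₗᵢ[ℝ] E i) (h : E j ≃ₗᵢ[ℝ] E j) : E (i + j) ≃ₗᵢ[ℝ] E (i + j) where
  toFun x := pairE (g (fstE i j x)) (h (sndE i j x))
  invFun x := pairE (g.symm (fstE i j x)) (h.symm (sndE i j x))
  map_add' x y := ext_E (by simp) (by simp)
  map_smul' c x := ext_E (by simp) (by simp)
  left_inv x := ext_E (by simp) (by simp)
  right_inv x := ext_E (by simp) (by simp)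
  norm_map' x := by
    have : ‖pairE (g (fstE i j x)) (h (sndE i j x))‖ ^ 2 = ‖x‖ ^ 2 := by
      rw [norm_sq_E, norm_sq_E x]; simp
    exact (sq_eq_sq₀ (norm_nonneg _) (norm_nonneg _)).1 this

theorem prodIso_image {i j : ℕ} (g : E i ≃ₗᵢ[ℝ] E i) (h : E j ≃ₗᵢ[ℝ] E j) (P : Set (E i))
    (Q : Set (E j)) : prodIso g h '' prodCone P Q = prodCone (g '' P) (h '' Q) := by
  ext x
  constructor
  · rintro ⟨y, ⟨h1, h2⟩, rfl⟩
    exact ⟨⟨_, h1, (fstE_pairE _ _).symm⟩, ⟨_, h2, (sndE_pairE _ _).symm⟩⟩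
  · rintro ⟨⟨p, hp, hp'⟩, ⟨q, hq, hq'⟩⟩
    refine ⟨pairE p q, ⟨by simpa using hp, by simpa using hq⟩, ?_⟩
    change pairE (g (fstE i j (pairE p q))) (h (sndE i j (pairE p q))) = x
    rw [fstE_pairE, sndE_pairE, hp', hq']
    exact ext_E (by simp) (by simp)

theorem cls_prod_left {i j : ℕ} (P : Set (E i)) (hP : IsCone P) (g : E j ≃ₗᵢ[ℝ] E j)
    (Q : Set (E j)) (hQ : IsCone Q) :
    cls (i + j) (prodCone P (g '' Q)) = cls (i + j) (prodCone P Q) := by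
  rw [← cls_image (hP.prod hQ) (prodIso (LinearIsometryEquiv.refl ℝ (E i)) g), prodIso_image]
  simp

theorem cls_prod_right {i j : ℕ} (P : Set (E i)) (hP : IsCone P) (g : E i ≃ₗᵢ[ℝ] E i)
    (Q : Set (E j)) (hQ : IsCone Q) :
    cls (i + j) (prodCone (g '' P) Q) = cls (i + j) (prodCone P Q) := by
  rw [← cls_image (hP.prod hQ) (prodIso g (LinearIsometryEquiv.refl ℝ (E j))), prodIso_image]
  simp

open Classical in
/-- Multiplication by the class of a fixed cone `P`. -/
def mulCone (i j : ℕ) (P : Set (E i)) : L j →+ L (i + j) :=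
  if hP : IsCone P then
    lift (fun Q => cls (i + j) (prodCone P Q))
      (by rw [show prodCone P (∅ : Set (E j)) = ∅ by ext; simp [prodCone]]; exact cls_empty)
      (fun Q R hQ hR => by
        rw [← cls_union (hP.prod hQ) (hP.prod hR)]
        congr 2
        · ext x; simp only [prodCone, Set.mem_ofPred_eq, Set.mem_union]; tauto
        · ext x; simp only [prodCone, Set.mem_ofPred_eq, Set.mem_inter_iff]; tauto)
      (fun Q hQ g => cls_prod_left P hP g Q hQ)
  else 0

theorem mulCone_cls {i j : ℕ} {P : Set (E i)} {Q : Set (E j)} (hP : IsCone P) (hQ : IsCone Q) :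
    mulCone i j P (cls j Q) = cls (i + j) (prodCone P Q) := by
  rw [mulCone, dif_pos hP, lift_cls hQ]

/-- The multiplication `Lᵢ × Lⱼ → Lᵢ₊ⱼ`, with `⟨P⟩ᵢ ⟨Q⟩ⱼ = ⟨P × Q⟩ᵢ₊ⱼ`. -/
def mul (i j : ℕ) : L i →+ L j →+ L (i + j) :=
  lift (mulCone i j)
    (L.hom_ext fun Q hQ => by
      rw [mulCone_cls isCone_empty hQ, show prodCone (∅ : Set (E i)) Q = ∅ by ext; simp [prodCone]]
      exact cls_empty)
    (fun P R hP hR => L.hom_ext fun Q hQ => by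
      rw [AddMonoidHom.add_apply, AddMonoidHom.add_apply, mulCone_cls hP hQ, mulCone_cls hR hQ,
        mulCone_cls (hP.union hR) hQ, mulCone_cls (hP.inter hR) hQ,
        ← cls_union (hP.prod hQ) (hR.prod hQ)]
      congr 2
      · ext x; simp only [prodCone, Set.mem_ofPred_eq, Set.mem_union]; tauto
      · ext x; simp only [prodCone, Set.mem_ofPred_eq, Set.mem_inter_iff]; tauto)
    (fun P hP g => L.hom_ext fun Q hQ => by
      rw [mulCone_cls hP hQ, mulCone_cls (hP.image_iso g) hQ, cls_prod_right P hP g Q hQ])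

theorem mul_cls {i j : ℕ} {P : Set (E i)} {Q : Set (E j)} (hP : IsCone P) (hQ : IsCone Q) :
    mul i j (cls i P) (cls j Q) = cls (i + j) (prodCone P Q) := by
  rw [mul, lift_cls hP, mulCone_cls hP hQ]

/-- The identification of `L n` and `L m` when `n = m`. -/
def castL {n m : ℕ} (h : n = m) : L n →+ L m := h ▸ AddMonoidHom.id (L n)

theorem castL_cls {n m : ℕ} (h : n = m) (φ : E n ≃ₗᵢ[ℝ] E m) {P : Set (E n)} (hP : IsCone P) :
    castL h (cls n P) = cls m (φ '' P) := by
  subst h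
  exact (cls_image hP φ).symm

theorem mk_eq_mk {n m : ℕ} (h : n = m) {x : L n} {y : L m} (hxy : castL h x = y) :
    (GradedMonoid.mk n x : GradedMonoid L) = GradedMonoid.mk m y := by
  subst h; subst hxy; rfl

/-- Reindexing of coordinates. -/
def reindexE {n m : ℕ} (e : Fin n ≃ Fin m) : E n ≃ₗᵢ[ℝ] E m :=
  LinearIsometryEquiv.piLpCongrLeft 2 ℝ ℝ e

theorem reindexE_symm_apply {n m : ℕ} (e : Fin n ≃ Fin m) (x : E m) (a : Fin n) :
    (reindexE e).symm x a = x (e a) := by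
  simp [reindexE, LinearIsometryEquiv.piLpCongrLeft_symm]

theorem image_eq_of_symm {n m : ℕ} (φ : E n ≃ₗᵢ[ℝ] E m) {P : Set (E n)} {Q : Set (E m)}
    (h : ∀ x, φ.symm x ∈ P ↔ x ∈ Q) : φ '' P = Q := by
  ext x
  rw [← h]
  constructor
  · rintro ⟨y, hy, rfl⟩; simpa using hy
  · intro hx; exact ⟨_, hx, by simp⟩

instance : GradedMonoid.GMul L where mul {i j} x y := mul i j x y

instance : GradedMonoid.GOne L where one := cls 0 {0}

theorem gmul_def {i j : ℕ} (x : L i) (y : L j) : GradedMonoid.GMul.mul x y = mul i j x y := rfl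

theorem gmul_assoc {i j k : ℕ} (x : L i) (y : L j) (z : L k) :
    castL (add_assoc i j k) (mul (i + j) k (mul i j x y) z) = mul i (j + k) x (mul j k y z) := by
  have h1 : (castL (add_assoc i j k)).comp (((mul (i + j) k).flip z).comp ((mul i j).flip y)) =
      (mul i (j + k)).flip (mul j k y z) := by
    refine L.hom_ext fun P hP => ?_
    have h2 : (castL (add_assoc i j k)).comp (((mul (i + j) k).flip z).comp (mul i j (cls i P))) =
        (mul i (j + k) (cls i P)).comp ((mul j k).flip z) := by
      refine L.hom_ext fun Q hQ => ?_
      have h3 : (castL (add_assoc i j k)).comp (mul (i + j) k (mul i j (cls i P) (cls j Q))) =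
          (mul i (j + k) (cls i P)).comp (mul j k (cls j Q)) := by
        refine L.hom_ext fun R hR => ?_
        simp only [AddMonoidHom.comp_apply]
        rw [mul_cls hP hQ, mul_cls (hP.prod hQ) hR, mul_cls hQ hR, mul_cls hP (hQ.prod hR),
          castL_cls _ (reindexE (finCongr (add_assoc i j k))) ((hP.prod hQ).prod hR)]
        congr 1
        refine image_eq_of_symm _ fun x => ?_
        have e1 : fstE i j (fstE (i + j) k ((reindexE (finCongr (add_assoc i j k))).symm x)) =
            fstE i (j + k) x := by
          ext a
          simp only [fstE_apply, reindexE_symm_apply]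
          exact congrArg x (Fin.ext rfl)
        have e2 : sndE i j (fstE (i + j) k ((reindexE (finCongr (add_assoc i j k))).symm x)) =
            fstE j k (sndE i (j + k) x) := by
          ext a
          simp only [fstE_apply, sndE_apply, reindexE_symm_apply]
          exact congrArg x (Fin.ext rfl)
        have e3 : sndE (i + j) k ((reindexE (finCongr (add_assoc i j k))).symm x) =
            sndE j k (sndE i (j + k) x) := by
          ext a
          simp only [sndE_apply, reindexE_symm_apply]
          exact congrArg x (Fin.ext (by simp [add_assoc]))
        simp only [prodCone, Set.mem_ofPred_eq, e1, e2, e3, and_assoc]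
      exact DFunLike.congr_fun h3 z
    exact DFunLike.congr_fun h2 y
  exact DFunLike.congr_fun h1 x

theorem gmul_comm {i j : ℕ} (x : L i) (y : L j) :
    castL (add_comm i j) (mul i j x y) = mul j i y x := by
  have h1 : (castL (add_comm i j)).comp ((mul i j).flip y) = mul j i y := by
    refine L.hom_ext fun P hP => ?_
    have h2 : (castL (add_comm i j)).comp (mul i j (cls i P)) = (mul j i).flip (cls i P) := by
      refine L.hom_ext fun Q hQ => ?_
      simp only [AddMonoidHom.comp_apply, AddMonoidHom.flip_apply]
      rw [mul_cls hP hQ, mul_cls hQ hP, castL_cls _ (reindexE finAddFlip) (hP.prod hQ)]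
      congr 1
      refine image_eq_of_symm _ fun x => ?_
      have e1 : fstE i j ((reindexE finAddFlip).symm x) = sndE j i x := by
        ext a; simp [fstE_apply, sndE_apply, reindexE_symm_apply]
      have e2 : sndE i j ((reindexE finAddFlip).symm x) = fstE j i x := by
        ext a; simp [fstE_apply, sndE_apply, reindexE_symm_apply]
      simp only [prodCone, Set.mem_ofPred_eq, e1, e2, and_comm]
    exact DFunLike.congr_fun h2 y
  exact DFunLike.congr_fun h1 x

theorem gone_mul {i : ℕ} (x : L i) : castL (zero_add i) (mul 0 i (cls 0 {0}) x) = x := by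
  have h : (castL (zero_add i)).comp (mul 0 i (cls 0 {0})) = AddMonoidHom.id (L i) := by
    refine L.hom_ext fun P hP => ?_
    have h0 : IsCone ({0} : Set (E 0)) := isConvexCone_zero.isCone
    rw [AddMonoidHom.comp_apply, mul_cls h0 hP,
      castL_cls _ (reindexE (finCongr (zero_add i))) (h0.prod hP), AddMonoidHom.id_apply]
    congr 1
    refine image_eq_of_symm _ fun x => ?_
    have e1 : fstE 0 i ((reindexE (finCongr (zero_add i))).symm x) = 0 := Subsingleton.elim _ _
    have e2 : sndE 0 i ((reindexE (finCongr (zero_add i))).symm x) = x := by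
      ext a
      simp only [sndE_apply, reindexE_symm_apply]
      exact congrArg x (Fin.ext (by simp))
    simp only [prodCone, Set.mem_ofPred_eq, e1, e2, Set.mem_singleton_iff, true_and]
  exact DFunLike.congr_fun h x

theorem graded_mul_comm (a b : GradedMonoid L) : a * b = b * a :=
  mk_eq_mk (add_comm a.1 b.1) (gmul_comm a.2 b.2)

theorem graded_one_mul (a : GradedMonoid L) : 1 * a = a :=
  mk_eq_mk (zero_add a.1) (gone_mul a.2)

instance : DirectSum.GCommRing L where
  mul_zero x := map_zero (mul _ _ x)
  zero_mul y := by rw [gmul_def, map_zero]; rfl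
  mul_add x y z := map_add (mul _ _ x) y z
  add_mul x y z := by rw [gmul_def, map_add]; rfl
  one_mul := graded_one_mul
  mul_one a := by rw [graded_mul_comm]; exact graded_one_mul a
  mul_assoc a b c := mk_eq_mk (add_assoc a.1 b.1 c.1) (gmul_assoc a.2 b.2 c.2)
  mul_comm := graded_mul_comm
  natCast n := n • cls 0 {0}
  natCast_zero := zero_smul ℕ _
  natCast_succ n := succ_nsmul _ n
  intCast n := n • cls 0 {0}
  intCast_ofNat n := natCast_zsmul _ n
  intCast_negSucc_ofNat n := negSucc_zsmul _ n

/-- The graded ring `L = ⨁ₙ Lₙ`. -/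
abbrev LRing : Type := DirectSum ℕ L

/-- The class in `L₁` of the origin of the line. -/
def t : L 1 := cls 1 {0}

/-- The class in `L₁` of a closed half-line. -/
def d : L 1 := cls 1 {x | 0 ≤ x 0}

/-- The class in `L₁` of the whole line. -/
def s : L 1 := cls 1 Set.univ

/-- Multiplication by an element of degree one, as a map `Lₙ → Lₙ₊₁`. -/
def mulOne (n : ℕ) (a : L 1) : L n →+ L (n + 1) := (mul n 1).flip a

/-- `D(Lₙ⁺)`. -/
def DLplus (n : ℕ) : AddSubgroup (L n) := (Lplus n).map (D n)

/-! ### Euclidean cones and interior manifold cones -/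

/-- A Euclidean cone of dimension at most `n`: a cone (the union of the finitely many convex cones
`cell i`) in some `ℝ^N`, with a Euclidean structure compatible with its linear structure. The
Euclidean structure is given on each cell by an injective linear map of (the span of) the cell
to `ℝⁿ`, and these structures agree where cells meet. (Thus the metric need not be the
one induced from `ℝ^N`.) -/
structure EuclideanCone (n : ℕ) where
  /-- the dimension of the ambient space -/
  N : ℕ
  /-- the number of cells -/
  k : ℕ
  /-- the cells -/
  cell : Fin k → Set (E N)
  isConvexCone_cell : ∀ i, IsConvexCone (cell i)
  /-- the Euclidean structures of the cells -/
  chart : Fin k → E N →ₗ[ℝ] E n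
  chart_injOn : ∀ i, Set.InjOn (chart i) (Submodule.span ℝ (cell i) : Set (E N))
  compatible : ∀ i j, ∀ x ∈ cell i ∩ cell j, ‖chart i x‖ = ‖chart j x‖

namespace EuclideanCone
variable {n : ℕ}

/-- The underlying cone in `ℝ^N`. -/
def carrier (M : EuclideanCone n) : Set (E M.N) := ⋃ i, M.cell i

/-- The class `⟨M⟩ₙ ∈ Lₙ` of a Euclidean cone of dimension at most `n`, computed from its cells
by inclusion-exclusion: each intersection of cells is isometric (through the chart of any of these
cells) to a convex cone in `ℝⁿ`. -/
def toL (M : EuclideanCone n) : L n :=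
  ∑ S : {S : Finset (Fin M.k) // S.Nonempty},
    (-1 : ℤ) ^ (S.1.card + 1) • cls n (M.chart (S.1.min' S.2) '' ⋂ i ∈ S.1, M.cell i)

end EuclideanCone

section PL
variable {V W : Type*} [NormedAddCommGroup V] [NormedSpace ℝ V] [NormedAddCommGroup W]
  [NormedSpace ℝ W]

/-- `f` is piecewise linear on `A`: every point of `A` has a neighbourhood on which `A` is covered
by finitely many compact convex polytopes such that `f` is affine on the part of `A` in each
of them. -/
def IsPLOn (f : V → W) (A : Set V) : Prop :=
  ∀ x ∈ A, ∃ U ∈ nhds x, ∃ T : Set (Set V), T.Finite ∧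
    (∀ Q ∈ T, ∃ v : Finset V, Q = convexHull ℝ (v : Set V)) ∧ A ∩ U ⊆ ⋃₀ T ∧
      ∀ Q ∈ T, ∃ g : V →ᵃ[ℝ] W, Set.EqOn f g (A ∩ U ∩ Q)

/-- `M` is a PL manifold of dimension `m` without boundary: every point of `M` has an open
neighbourhood in `M` that is PL homeomorphic to an open subset of `ℝ^m`. -/
def IsPLManifold (m : ℕ) (M : Set V) : Prop :=
  ∀ x ∈ M, ∃ O : Set V, IsOpen O ∧ x ∈ O ∧ ∃ O' : Set (E m), IsOpen O' ∧
    ∃ (f : V → E m) (g : E m → V), Set.BijOn f (M ∩ O) O' ∧ Set.InvOn g f (M ∩ O) O' ∧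
      IsPLOn f (M ∩ O) ∧ IsPLOn g O'

end PL

/-- An interior manifold cone of dimension `m` (with Euclidean structure): a nonempty Euclidean
cone that is a PL manifold of dimension `m` with empty boundary. -/
def EuclideanCone.IsInteriorManifold {n : ℕ} (M : EuclideanCone n) (m : ℕ) : Prop :=
  M.carrier.Nonempty ∧ IsPLManifold m M.carrier

/-- `Lₙᵉᵛ`: the subgroup generated by the even-dimensional interior manifold cones. -/
def Lev (n : ℕ) : AddSubgroup (L n) :=
  AddSubgroup.closure {x | ∃ (M : EuclideanCone n) (m : ℕ), Even m ∧ M.IsInteriorManifold m ∧ x = M.toL}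

/-- `Lₙᵒᵈ`: the subgroup generated by the odd-dimensional interior manifold cones. -/
def Lod (n : ℕ) : AddSubgroup (L n) :=
  AddSubgroup.closure {x | ∃ (M : EuclideanCone n) (m : ℕ), Odd m ∧ M.IsInteriorManifold m ∧ x = M.toL}

end ConeRing

end

/-!
The relations of `L n` express that classes of convex cones satisfy the hyperplane cutting relation,
so every operator is determined by its values on simplicial cones (`Sig.hom_ext_simplicial`). On a
simplicial cone the signed interior is the alternating sum of the faces, which gives `I² = 1` and
`D I = (-1)ⁿ I D` (`interiorSig_interiorSig`, `D_I`). Together with the multiplicativity of `I` and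
`D` and with `D t = s`, `D d = d`, `s = 2 d - t`, the formulas that carry the algebra are
`t δ x = x - (-1)ⁿ I x` (`t_δ`), `δ (t x) = x + (-1)ⁿ I x` (`δ_t`), `δ δ = 0` (`δ_δ`), and the
Leibniz rule for multiplication by `d` (`δ_d`), with duals for `δbar = D ∘ δ ∘ D`.

The dual of `t_δ` shows that `I` is the identity on `ker δbar`, and the Leibniz rule then becomes
`δbar (d x) = x` for `δbar x = 0` (`δbar_mulOne_d_of_mem`). Hence `ker δbar = im δbar`, and
`x = (x - d δbar x) + d δbar x` is the unique decomposition of an element of `L` with respect to the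
basis `{1, d}`.

For the equality of `D(Lₙ⁺)` with the image of `1 + I`, one direction is `x + I x = δbar (s x)`. For
the other, an element of `D(Lₙ⁺)` is `δbar w` for some `w` of degree at least two, and there
`w = t y + 2 z` (`exists_eq_t_add_two`). Indeed, a simplicial cone with generators of unit length
is, modulo cones of lower dimension, a signed sum of the cones obtained by replacing one generator
by the circumcenter (`ind_sub_sum_mem`). Repeating this with the remaining generators leads to cones
with a mirror symmetry that exchanges two generators, and such a cone is twice one of its halves,
modulo `t` (`cls_mem_tTwo_of_swap`). Finally `δbar (2 z) = (1 + I) δbar z` and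
`δbar (t y) = t δbar y = (1 + I) (d δbar y)`. As a consequence `D(L⁺)` is closed under
multiplication, it equals `L⁺` in even degrees (`DLplus_even`), and in odd degrees `D(L⁺)` and `L⁺`
are `t` and `s` times `L⁺` of the preceding degree (`DLplus_odd`, `Lplus_odd`).

A PL chart of a manifold cone induces at each point a conewise linear bijection of the tangent cone
onto `ℝᵐ`. The value of the signed interior at a point can be computed in the tangent cone and is
invariant under such bijections, so `I` multiplies the characteristic function of an `m`-dimensional
manifold without boundary by `(-1)ᵐ` (`interiorSig_of_isPLManifold`). Passing to classes, these
lie in `Lₙ⁺` or in `t Lₙ₋₁⁺` according to parity (`EuclideanCone.toL_mem_Lplus`,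
`EuclideanCone.toL_mem_map_t`). Conversely, for a simplicial cone `C` the boundary of `C` and the
double of `C` along its boundary are interior manifold cones with classes `⟨C⟩ ∓ (-1)^(dim C) I ⟨C⟩`
(`exists_boundary_manifold`, `exists_double_manifold`), so the images of `1 + I` and `1 - I` are
generated by interior manifold cones of even and of odd dimension, respectively.
-/


noncomputable section
set_option linter.unusedSectionVars false

namespace ConeRing
open Finset

/-! ### Simplicial cones and circuits -/

section Simplicial
variable {V W : Type*} [NormedAddCommGroup V] [InnerProductSpace ℝ V] [FiniteDimensional ℝ V]
  [NormedAddCommGroup W] [InnerProductSpace ℝ W] [FiniteDimensional ℝ W]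
  {A : Type*} [AddCommGroup A] {ι : Type*}

/-- The cone of nonnegative linear combinations of the vectors `u i`, `i ∈ S`. -/
def pc (u : ι → V) (S : Finset ι) : Set V :=
  {x | ∃ c : ι → ℝ, (∀ i ∈ S, 0 ≤ c i) ∧ ∑ i ∈ S, c i • u i = x}

theorem hull_eq_pc (s : Finset V) : (PointedCone.hull ℝ (s : Set V) : Set V) = pc id s := by
  ext x
  rw [SetLike.mem_coe, PointedCone.hull, Submodule.mem_span_finset]
  constructor
  · rintro ⟨f, -, rfl⟩
    exact ⟨fun i => f i, fun i _ => (f i).2, rfl⟩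
  · rintro ⟨c, hc, rfl⟩
    classical
    refine ⟨fun i => if h : i ∈ s then ⟨c i, hc i h⟩ else 0, ?_, ?_⟩
    · intro i hi
      by_contra h
      exact hi (by simp [show i ∉ s from h])
    · refine sum_congr rfl fun i hi => ?_
      simp only [hi, dif_pos, id]
      rfl

theorem pc_image (φ : V →ₗ[ℝ] W) (u : ι → V) (S : Finset ι) :
    φ '' pc u S = pc (φ ∘ u) S := by
  ext x
  constructor
  · rintro ⟨_, ⟨c, hc, rfl⟩, rfl⟩
    exact ⟨c, hc, by simp⟩
  · rintro ⟨c, hc, rfl⟩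
    exact ⟨_, ⟨c, hc, rfl⟩, by simp⟩

theorem pc_congr {u v : ι → V} {S : Finset ι} (h : ∀ i ∈ S, u i = v i) : pc u S = pc v S := by
  ext x
  simp only [pc, Set.mem_ofPred_eq]
  refine exists_congr fun c => and_congr_right fun _ => ?_
  rw [sum_congr rfl fun i hi => by rw [h i hi]]

theorem mem_pc_of_subset {u : ι → V} {S T : Finset ι} (h : T ⊆ S) {x : V} :
    x ∈ pc u T ↔ ∃ c : ι → ℝ, (∀ i, 0 ≤ c i) ∧ (∀ i, i ∉ T → c i = 0) ∧
      ∑ i ∈ S, c i • u i = x := by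
  classical
  constructor
  · rintro ⟨c, hc, rfl⟩
    refine ⟨fun i => if i ∈ T then c i else 0, ?_, ?_, ?_⟩
    · intro i
      simp only
      split_ifs with hi
      exacts [hc i hi, le_rfl]
    · intro i hi; simp [hi]
    · rw [← sum_subset h]
      · exact sum_congr rfl fun i hi => by simp [hi]
      · intro i _ hi; simp [hi]
  · rintro ⟨c, hc, hc0, rfl⟩
    refine ⟨c, fun i _ => hc i, sum_subset h fun i _ hi => by simp [hc0 i hi]⟩

theorem mem_pc {u : ι → V} {S : Finset ι} {x : V} :
    x ∈ pc u S ↔ ∃ c : ι → ℝ, (∀ i, 0 ≤ c i) ∧ (∀ i, i ∉ S → c i = 0) ∧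
      ∑ i ∈ S, c i • u i = x := mem_pc_of_subset subset_rfl

theorem pc_mono {u : ι → V} {S T : Finset ι} (h : T ⊆ S) : pc u T ⊆ pc u S := by
  intro x hx
  obtain ⟨c, hc, _, e⟩ := (mem_pc_of_subset h).1 hx
  exact ⟨c, fun i _ => hc i, e⟩

theorem mem_pc_self {u : ι → V} {S : Finset ι} {i : ι} (hi : i ∈ S) : u i ∈ pc u S := by
  classical
  refine ⟨fun j => if j = i then 1 else 0, fun j _ => by positivity, ?_⟩
  simp [hi]

theorem pc_image_finset [DecidableEq V] {u : ι → V} {S : Finset ι} (h : Set.InjOn u S) :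
    pc id (S.image u) = pc u S := by
  classical
  ext x
  constructor
  · rintro ⟨c, hc, rfl⟩
    refine ⟨c ∘ u, fun i hi => hc _ (mem_image_of_mem u hi), ?_⟩
    rw [sum_image h]; rfl
  · rintro ⟨c, hc, rfl⟩
    have hinv : ∀ i ∈ S, ∀ hv : u i ∈ S.image u, (mem_image.1 hv).choose = i := fun i hi hv =>
      h (mem_image.1 hv).choose_spec.1 hi (mem_image.1 hv).choose_spec.2
    refine ⟨fun v => if hv : v ∈ S.image u then c (mem_image.1 hv).choose else 0, ?_, ?_⟩
    · intro v hv
      simp only [hv, dif_pos]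
      exact hc _ (mem_image.1 hv).choose_spec.1
    · rw [sum_image h]
      refine sum_congr rfl fun i hi => ?_
      have hv := mem_image_of_mem u hi
      simp only [hv, dif_pos, id, hinv i hi hv]

theorem isConvexCone_pc (u : ι → V) (S : Finset ι) : IsConvexCone (pc u S) := by
  classical
  refine ⟨S.image u, ?_⟩
  ext x
  rw [SetLike.mem_coe]
  constructor
  · rintro ⟨c, hc, rfl⟩
    refine Submodule.sum_mem _ fun i hi => ?_
    exact PointedCone.smul_mem _ (hc i hi)
      (Submodule.subset_span (by simpa using ⟨i, hi, rfl⟩))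
  · intro hx
    induction hx using Submodule.span_induction with
    | mem x hx =>
      obtain ⟨i, hi, rfl⟩ := mem_image.1 (mem_coe.1 hx)
      exact mem_pc_self hi
    | zero => exact ⟨0, by simp, by simp⟩
    | add x y _ _ hx hy =>
      obtain ⟨c, hc, rfl⟩ := hx
      obtain ⟨c', hc', rfl⟩ := hy
      exact ⟨c + c', fun i hi => add_nonneg (hc i hi) (hc' i hi), by
        simp [add_smul, sum_add_distrib]⟩
    | smul r x _ hx =>
      obtain ⟨c, hc, rfl⟩ := hx
      refine ⟨fun i => r * c i, fun i hi => mul_nonneg r.2 (hc i hi), ?_⟩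
      change _ = (r : ℝ) • ∑ i ∈ S, c i • u i
      rw [smul_sum]
      exact sum_congr rfl fun i _ => mul_smul _ _ _

theorem IsConvexCone.exists_pc {P : Set V} (h : IsConvexCone P) : ∃ s : Finset V, P = pc id s := by
  obtain ⟨s, rfl⟩ := h
  exact ⟨s, hull_eq_pc s⟩

theorem span_pc (u : ι → V) (S : Finset ι) :
    Submodule.span ℝ (pc u S) = Submodule.span ℝ (u '' S) := by
  refine le_antisymm (Submodule.span_le.2 ?_) (Submodule.span_mono ?_)
  · rintro _ ⟨c, -, rfl⟩
    exact Submodule.sum_mem _ fun i hi => Submodule.smul_mem _ _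
      (Submodule.subset_span ⟨i, hi, rfl⟩)
  · rintro _ ⟨i, hi, rfl⟩
    exact mem_pc_self hi

theorem dim_pc {u : ι → V} {S : Finset ι} (h : LinearIndepOn ℝ u (S : Set ι)) :
    dim (pc u S) = S.card := by
  rw [dim, span_pc, Set.image_eq_range, finrank_span_eq_card (b := fun i : (S : Set ι) => u i) h]
  simp

theorem dim_pc_le (u : ι → V) (S : Finset ι) : dim (pc u S) ≤ S.card := by
  classical
  rw [dim, span_pc, ← coe_image]
  exact (finrank_span_finset_le_card _).trans card_image_le

theorem ind_biUnion {ι : Type*} (s : Finset ι) (S : ι → Set V) :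
    ind (⋃ i ∈ s, S i) =
      ∑ t ∈ s.powerset with t.Nonempty, (-1 : ℤ) ^ (t.card + 1) • ind (⋂ i ∈ t, S i) := by
  ext a
  simp only [ind, indicator_biUnion_eq_sum_powerset, Finset.sum_apply, Pi.smul_apply]

/-- If the only linear relation between the `u i`, up to scaling, is `∑ α i • u i = 0`, then the
cone they generate is the union of the cones obtained by leaving out one `u i` with `0 < α i`. -/
theorem pc_eq_biUnion_erase [DecidableEq ι] {u : ι → V} {S : Finset ι} {α : ι → ℝ}
    (hα : ∑ i ∈ S, α i • u i = 0) (hne : (S.filter (0 < α ·)).Nonempty) :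
    pc u S = ⋃ i ∈ S.filter (0 < α ·), pc u (S.erase i) := by
  refine Set.Subset.antisymm ?_ (Set.iUnion₂_subset fun i _ => pc_mono (erase_subset _ _))
  rintro _ ⟨c, hc, rfl⟩
  obtain ⟨i, hi, hmin⟩ := exists_min_image _ (fun i => c i / α i) hne
  obtain ⟨hiS, hαi⟩ := mem_filter.1 hi
  refine Set.mem_biUnion hi ?_
  refine ⟨fun j => c j - c i / α i * α j, ?_, ?_⟩
  · intro j hj
    have hjS := mem_of_mem_erase hj
    have h0 : 0 ≤ c i / α i := div_nonneg (hc i hiS) hαi.le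
    rcases lt_or_ge 0 (α j) with h | h
    · have := hmin j (mem_filter.2 ⟨hjS, h⟩)
      rw [le_div_iff₀ h] at this
      linarith
    · nlinarith [hc j hjS, mul_nonneg h0 (neg_nonneg.2 h)]
  · rw [sum_erase _ (by simp [div_mul_cancel₀ _ hαi.ne'])]
    simp only [sub_smul, sum_sub_distrib, mul_smul, ← smul_sum, hα, smul_zero, sub_zero]

/-- In the presence of a single linear relation, the facets opposite to generators with positive
coefficient meet in the expected faces: two representations of a point differ by a multiple of the
relation, so vanishing coordinates can be compared. -/
theorem biInter_pc_erase [DecidableEq ι] {u : ι → V} {S : Finset ι} {α : ι → ℝ}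
    (huniq : ∀ β : ι → ℝ, ∑ i ∈ S, β i • u i = 0 → ∃ r : ℝ, ∀ i ∈ S, β i = r * α i)
    {t : Finset ι} (ht : t ⊆ S.filter (0 < α ·)) (hne : t.Nonempty) :
    ⋂ i ∈ t, pc u (S.erase i) = pc u (S \ t) := by
  refine Set.Subset.antisymm ?_ (Set.subset_iInter₂ fun i hi => pc_mono fun j hj => by
    rw [mem_sdiff] at hj
    exact mem_erase.2 ⟨fun h => hj.2 (h ▸ hi), hj.1⟩)
  intro x hx
  rw [Set.mem_iInter₂] at hx
  obtain ⟨i, hi⟩ := hne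
  obtain ⟨c, hc, hc0, rfl⟩ := (mem_pc_of_subset (erase_subset i S)).1 (hx i hi)
  refine (mem_pc_of_subset sdiff_subset).2 ⟨fun j => if j ∈ S then c j else 0, ?_, ?_, ?_⟩
  · intro j; simp only; split_ifs; exacts [hc j, le_rfl]
  · intro j hj
    by_cases hjS : j ∈ S
    · have hjt : j ∈ t := by simpa [hjS] using hj
      obtain ⟨c', hc', hc0', e⟩ := (mem_pc_of_subset (erase_subset j S)).1 (hx j hjt)
      obtain ⟨r, hr⟩ := huniq (fun k => c k - c' k) (by
        simp only [sub_smul, sum_sub_distrib, e, sub_self])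
      have hαi := (mem_filter.1 (ht hi))
      have hαj := (mem_filter.1 (ht hjt))
      have h1 := hr i hαi.1
      have h2 := hr j hαj.1
      have hci : c i = 0 := hc0 i (by simp)
      have hcj : c' j = 0 := hc0' j (by simp)
      have hr0 : r ≤ 0 := by
        by_contra h
        push Not at h
        nlinarith [mul_pos h hαi.2, hc' i]
      simp only [hjS, if_true]
      refine le_antisymm ?_ (hc j)
      nlinarith [mul_nonneg (neg_nonneg.2 hr0) hαj.2.le]
    · simp [hjS]
  · exact sum_congr rfl fun j hj => by simp [hj]

/-- The circuit relation: inclusion-exclusion for the decomposition of `pc_eq_biUnion_erase`. -/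
theorem ind_pc_circuit [DecidableEq ι] {u : ι → V} {S : Finset ι} {α : ι → ℝ}
    (hα : ∑ i ∈ S, α i • u i = 0) (hne : (S.filter (0 < α ·)).Nonempty)
    (huniq : ∀ β : ι → ℝ, ∑ i ∈ S, β i • u i = 0 → ∃ r : ℝ, ∀ i ∈ S, β i = r * α i) :
    ind (pc u S) = ∑ t ∈ (S.filter (0 < α ·)).powerset with t.Nonempty,
      (-1 : ℤ) ^ (t.card + 1) • ind (pc u (S \ t)) := by
  rw [pc_eq_biUnion_erase hα hne, ind_biUnion]
  refine sum_congr rfl fun t ht => ?_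
  rw [mem_filter, mem_powerset] at ht
  rw [biInter_pc_erase huniq ht.1 ht.2]

/-! ### Generation by simplicial cones -/

theorem union_ge_ge_neg (P : Set V) (a : V) : P ∩ ge a ∪ P ∩ ge (-a) = P := by
  rw [← Set.inter_union_distrib_left, Set.inter_eq_left]
  intro x _
  simp only [ge, Set.mem_union, Set.mem_ofPred_eq, inner_neg_left, Left.nonneg_neg_iff]
  exact le_total _ _

/-- A segment in a convex cone joining the two sides of a hyperplane meets the hyperplane. -/
theorem IsConvexCone.exists_combo {P : Set V} (hP : IsConvexCone P) {a p q : V}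
    (hp : p ∈ P ∩ ge a) (hq : q ∈ P ∩ ge (-a)) :
    ∃ r r' : ℝ, 0 ≤ r ∧ 0 ≤ r' ∧ r + r' = 1 ∧ r • p + r' • q ∈ P ∩ eqz a := by
  have h1 : 0 ≤ inner ℝ a p := hp.2
  have h2 : 0 ≤ - inner ℝ a q := by simpa [ge, inner_neg_left] using hq.2
  rcases h1.eq_or_lt with h0 | h0
  · exact ⟨1, 0, zero_le_one, le_rfl, by norm_num, by simpa using ⟨hp.1, h0.symm⟩⟩
  · have h3 : 0 < inner ℝ a p - inner ℝ a q := by linarith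
    refine ⟨-inner ℝ a q / (inner ℝ a p - inner ℝ a q), inner ℝ a p / (inner ℝ a p - inner ℝ a q),
      by positivity, by positivity, by field_simp; ring, ?_, ?_⟩
    · exact hP.add_mem (hP.smul_mem (by positivity) hp.1) (hP.smul_mem (by positivity) hq.1)
    · change inner ℝ a _ = 0
      rw [inner_add_right, real_inner_smul_right, real_inner_smul_right]
      ring

/-- An operation on sets that preserves inclusions and unions, and maps the two halves of a convex
cone to sets meeting in the image of the cut, satisfies the hyperplane cutting relation. -/
theorem cut_ind_of {k : ℕ} {G : Set V → Set W} (hmono : ∀ P Q, P ⊆ Q → G P ⊆ G Q)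
    (hu : ∀ P Q, G (P ∪ Q) = G P ∪ G Q)
    (hi : ∀ P, IsConvexCone P → ∀ a, G (P ∩ ge a) ∩ G (P ∩ ge (-a)) ⊆ G (P ∩ eqz a)) :
    Cut k fun P => ind (G P) := by
  intro P hP a
  have e2 : G (P ∩ ge a) ∩ G (P ∩ ge (-a)) = G (P ∩ eqz a) := by
    refine Set.Subset.antisymm (hi P hP.1 a) (Set.subset_inter (hmono _ _ ?_) (hmono _ _ ?_))
    · exact fun y hy => ⟨hy.1, le_of_eq (Eq.symm hy.2)⟩
    · exact fun y hy => ⟨hy.1, by have : inner ℝ a y = 0 := hy.2; simp [ge, this]⟩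
  have := ind_union_add_inter (G (P ∩ ge a)) (G (P ∩ ge (-a)))
  rwa [e2, ← hu, union_ge_ge_neg] at this

/-- The Minkowski sum of `P` and the ray through `v`. -/
def addRay (v : V) (P : Set V) : Set V := {x | ∃ r : ℝ, 0 ≤ r ∧ x - r • v ∈ P}

theorem cut_addRay (k : ℕ) (v : V) : Cut k fun P : Set V => ind (addRay v P) := by
  apply cut_ind_of
  · rintro P Q h x ⟨r, hr, hx⟩
    exact ⟨r, hr, h hx⟩
  · intro P Q
    ext x
    simp only [addRay, Set.mem_union, Set.mem_ofPred_eq, and_or_left, exists_or]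
  · rintro P hP a x ⟨⟨r, hr, hx⟩, ⟨r', hr', hx'⟩⟩
    obtain ⟨l, l', hl, hl', h1, hm⟩ := hP.exists_combo hx hx'
    refine ⟨l * r + l' * r', by positivity, ?_⟩
    convert hm using 1
    rw [smul_sub, smul_sub, add_smul, mul_smul, mul_smul]
    nth_rw 1 [← one_smul ℝ x, ← h1, add_smul]
    abel

theorem addRay_pc [DecidableEq ι] {u : ι → V} {S : Finset ι} {i : ι} (hi : i ∉ S) :
    addRay (u i) (pc u S) = pc u (insert i S) := by
  ext x
  constructor
  · rintro ⟨r, hr, c, hc, e⟩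
    refine ⟨fun j => if j = i then r else c j, ?_, ?_⟩
    · intro j hj
      simp only
      split_ifs with h
      exacts [hr, hc j ((mem_insert.1 hj).resolve_left h)]
    · rw [sum_insert hi]
      simp only [if_true]
      rw [sum_congr rfl (g := fun j => c j • u j) fun j hj => by
        rw [if_neg (fun h : j = i => hi (h ▸ hj))], e]
      abel
  · rintro ⟨c, hc, rfl⟩
    refine ⟨c i, hc i (mem_insert_self _ _), c, fun j hj => hc j (mem_insert_of_mem hj), ?_⟩
    rw [sum_insert hi]; abel

theorem addRay_pc_mem {u : ι → V} {S : Finset ι} {i : ι} (hi : i ∈ S) :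
    addRay (u i) (pc u S) = pc u S := by
  ext x
  constructor
  · rintro ⟨r, hr, h⟩
    have := (isConvexCone_pc u S).add_mem h
      ((isConvexCone_pc u S).smul_mem hr (mem_pc_self hi))
    simpa using this
  · intro h
    exact ⟨0, le_rfl, by simpa using h⟩

/-- The group generated by the characteristic functions of the simplicial cones with
generators in `X`. -/
def simp𝒢 (X : Set V) : AddSubgroup (V → ℤ) :=
  AddSubgroup.closure
    {f | ∃ b : Finset V, (b : Set V) ⊆ X ∧ LinearIndepOn ℝ id (b : Set V) ∧ f = ind (pc id b)}

/-- Adding one generator to a simplicial cone either gives a simplicial cone, or creates a unique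
linear relation, and the circuit relation applies. -/
theorem ind_pc_insert_mem {X : Set V} [DecidableEq V] {b : Finset V} {v : V}
    (hX : ((insert v b : Finset V) : Set V) ⊆ X)
    (hb : LinearIndepOn ℝ id (b : Set V)) (hv : v ∉ b) :
    ind (pc id (insert v b)) ∈ simp𝒢 X := by
  by_cases hi : LinearIndepOn ℝ id ((insert v b : Finset V) : Set V)
  · exact AddSubgroup.subset_closure ⟨_, hX, hi, rfl⟩
  have hvs : v ∈ Submodule.span ℝ (b : Set V) := by
    by_contra h
    apply hi
    rw [coe_insert]
    exact hb.id_insert h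
  obtain ⟨μ, -, hμ⟩ := Submodule.mem_span_finset.1 hvs
  have hvb : ∀ i ∈ b, i ≠ v := fun i hi h => hv (h ▸ hi)
  let α : V → ℝ := fun i => if i = v then 1 else - μ i
  have hsum : ∀ β : V → ℝ, ∑ i ∈ insert v b, β i • id i = β v • v + ∑ i ∈ b, β i • i := fun β => by
    rw [sum_insert hv]; rfl
  have hα : ∑ i ∈ insert v b, α i • id i = 0 := by
    rw [hsum, sum_congr rfl (g := fun i => -(μ i • i)) fun i hi => by
      simp only [α, if_neg (hvb i hi), neg_smul], sum_neg_distrib, hμ]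
    simp [α]
  have huniq : ∀ β : V → ℝ, ∑ i ∈ insert v b, β i • id i = 0 →
      ∃ r : ℝ, ∀ i ∈ insert v b, β i = r * α i := by
    intro β hβ
    refine ⟨β v, fun i hi => ?_⟩
    have h1 : ∑ i ∈ insert v b, (β i - β v * α i) • id i = 0 := by
      simp only [sub_smul, mul_smul, sum_sub_distrib, ← smul_sum]
      rw [hβ, hα]; simp
    rw [hsum] at h1
    have h2 : ∑ i ∈ b, (β i - β v * α i) • i = 0 := by simpa [α] using h1
    rcases mem_insert.1 hi with rfl | hi
    · simp [α]
    · have := linearIndepOn_finset_iff.1 hb _ h2 i hi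
      linarith
  rw [ind_pc_circuit hα ⟨v, by simp [α]⟩ huniq]
  refine AddSubgroup.sum_mem _ fun t ht => AddSubgroup.zsmul_mem _ ?_ _
  rw [mem_filter, mem_powerset] at ht
  refine AddSubgroup.subset_closure ⟨_, fun x hx => hX (sdiff_subset hx), ?_, rfl⟩
  obtain ⟨ht, j, hj⟩ := ht
  obtain ⟨hjS, hαj⟩ := mem_filter.1 (ht hj)
  rw [linearIndepOn_finset_iff]
  intro γ hγ i hi
  obtain ⟨r, hr⟩ := huniq (fun i => if i ∈ insert v b \ t then γ i else 0) (by
    rw [← hγ]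
    symm
    rw [sum_congr rfl fun i hi => by rw [← if_pos (c := i ∈ insert v b \ t) (t := γ i)
      (e := (0 : ℝ)) hi]]
    exact sum_subset sdiff_subset fun i _ hi => by simp only [if_neg hi, zero_smul])
  have h1 := hr j hjS
  rw [if_neg (by simp [hj])] at h1
  have hr0 : r = 0 := by
    rcases mul_eq_zero.1 h1.symm with h | h
    exacts [h, absurd h hαj.ne']
  have h2 := hr i (mem_sdiff.1 hi).1
  rw [if_pos hi, hr0, zero_mul] at h2
  exact h2

/-- The characteristic function of a finitely generated cone is a combination of those of the
simplicial cones spanned by independent sets of generators. -/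
theorem ind_pc_mem_simp𝒢 (s : Finset V) : ind (pc id s) ∈ simp𝒢 (s : Set V) := by
  classical
  induction s using Finset.induction_on with
  | empty =>
    exact AddSubgroup.subset_closure ⟨∅, by simp, by simp, rfl⟩
  | insert v s hv ih =>
    have hkc : ∀ b : Finset V, KC (Module.finrank ℝ V) (pc id b) := fun b =>
      ⟨isConvexCone_pc _ _, dim_le _⟩
    have key : ∀ f ∈ simp𝒢 (s : Set V), ∃ hf : f ∈ Sig V (Module.finrank ℝ V),
        ext (cut_addRay _ v) ⟨f, hf⟩ ∈ simp𝒢 ((insert v s : Finset V) : Set V) := by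
      intro f hf
      induction hf using AddSubgroup.closure_induction with
      | mem f h =>
        obtain ⟨b, hb, hi, rfl⟩ := h
        refine ⟨ind_mem_Sig (hkc b), ?_⟩
        rw [ext_ind _ (hkc b)]
        have hsub : ((insert v b : Finset V) : Set V) ⊆ ((insert v s : Finset V) : Set V) := by
          rw [coe_insert, coe_insert]; exact Set.insert_subset_insert hb
        by_cases hvb : v ∈ b
        · rw [show addRay v (pc id b) = pc id b from addRay_pc_mem (u := id) hvb]
          refine AddSubgroup.subset_closure ⟨b, fun x hx => ?_, hi, rfl⟩
          exact hsub (mem_coe.2 (mem_insert_of_mem hx))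
        · rw [show addRay v (pc id b) = pc id (insert v b) from addRay_pc (u := id) hvb]
          exact ind_pc_insert_mem hsub hi hvb
      | zero => exact ⟨zero_mem _, by
          change ext _ (0 : Sig V _) ∈ _
          rw [map_zero]; exact zero_mem _⟩
      | add f g _ _ h h' =>
        obtain ⟨hf, h⟩ := h
        obtain ⟨hg, h'⟩ := h'
        refine ⟨add_mem hf hg, ?_⟩
        have e : (⟨f + g, add_mem hf hg⟩ : Sig V (Module.finrank ℝ V)) = ⟨f, hf⟩ + ⟨g, hg⟩ := rfl
        rw [e, map_add]; exact add_mem h h'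
      | neg f _ h =>
        obtain ⟨hf, h⟩ := h
        refine ⟨neg_mem hf, ?_⟩
        have e : (⟨-f, neg_mem hf⟩ : Sig V (Module.finrank ℝ V)) = -⟨f, hf⟩ := rfl
        rw [e, map_neg]; exact neg_mem h
    obtain ⟨hf, h⟩ := key _ ih
    rw [ext_ind _ (hkc s)] at h
    rwa [show addRay v (pc id s) = pc id (insert v s) from addRay_pc (u := id) hv] at h

theorem kc_pc {k : ℕ} {u : ι → V} {S : Finset ι} (h : S.card ≤ k) : KC k (pc u S) :=
  ⟨isConvexCone_pc _ _, (dim_pc_le _ _).trans h⟩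

/-- Homomorphisms on `Sig V k` that agree on simplicial cones are equal. -/
theorem Sig.hom_ext_simplicial {k : ℕ} {Φ Ψ : Sig V k →+ A}
    (h : ∀ (b : Finset V) (_ : LinearIndepOn ℝ id (b : Set V)) (hk : b.card ≤ k),
      Φ ⟨ind (pc id b), ind_mem_Sig (kc_pc hk)⟩ = Ψ ⟨ind (pc id b), ind_mem_Sig (kc_pc hk)⟩) :
    Φ = Ψ := by
  refine Sig.hom_ext fun C hC => ?_
  obtain ⟨s, rfl⟩ := hC.1.exists_pc
  have key : ∀ f ∈ simp𝒢 (s : Set V), ∃ hf : f ∈ Sig V k, Φ ⟨f, hf⟩ = Ψ ⟨f, hf⟩ := by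
    intro f hf
    induction hf using AddSubgroup.closure_induction with
    | mem f h' =>
      obtain ⟨b, hb, hi, rfl⟩ := h'
      have hk : b.card ≤ k := by
        rw [← dim_pc hi]
        refine le_trans (dim_mono ?_) hC.2
        exact pc_mono (by exact_mod_cast hb)
      exact ⟨_, h b hi hk⟩
    | zero => exact ⟨zero_mem _, (map_zero Φ).trans (map_zero Ψ).symm⟩
    | add f g _ _ h h' =>
      obtain ⟨hf, h⟩ := h
      obtain ⟨hg, h'⟩ := h'
      refine ⟨add_mem hf hg, ?_⟩
      have e : (⟨f + g, add_mem hf hg⟩ : Sig V k) = ⟨f, hf⟩ + ⟨g, hg⟩ := rfl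
      rw [e, map_add, map_add, h, h']
    | neg f _ h =>
      obtain ⟨hf, h⟩ := h
      refine ⟨neg_mem hf, ?_⟩
      have e : (⟨-f, neg_mem hf⟩ : Sig V k) = -⟨f, hf⟩ := rfl
      rw [e, map_neg, map_neg, h]
  exact (key _ (ind_pc_mem_simp𝒢 s)).2

end Simplicial
end ConeRing

namespace ConeRing
open Finset

/-! ### The interior operator on simplicial cones -/

section InteriorSimplicial
variable {V W : Type*} [NormedAddCommGroup V] [InnerProductSpace ℝ V] [FiniteDimensional ℝ V]
  [NormedAddCommGroup W] [InnerProductSpace ℝ W] [FiniteDimensional ℝ W]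
  {A : Type*} [AddCommGroup A] {ι : Type*}

theorem eq_of_sum_smul_eq {u : ι → V} {S : Finset ι} (h : LinearIndepOn ℝ u (S : Set ι))
    {c c' : ι → ℝ} (e : ∑ i ∈ S, c i • u i = ∑ i ∈ S, c' i • u i) {i : ι} (hi : i ∈ S) :
    c i = c' i := by
  have := linearIndepOn_finset_iff.1 h (fun i => c i - c' i) (by
    simp only [sub_smul, sum_sub_distrib, e, sub_self]) i hi
  simpa [sub_eq_zero] using this

theorem relint_pc [DecidableEq ι] {u : ι → V} {S : Finset ι}
    (h : LinearIndepOn ℝ u (S : Set ι)) :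
    relint (pc u S) = pc u S \ ⋃ i ∈ S, pc u (S.erase i) := by
  ext x
  simp only [relint, Set.mem_ofPred_eq, Set.mem_sdiff, Set.mem_iUnion, not_exists]
  refine and_congr_right fun hx => ⟨?_, ?_⟩
  · intro hr i hi hxi
    obtain ⟨c, hc, hc0, rfl⟩ := (mem_pc_of_subset (erase_subset i S)).1 hxi
    obtain ⟨ε, hε, c', hc', e⟩ := hr (u i) (mem_pc_self hi)
    have e' : ∑ j ∈ S, c' j • u j = ∑ j ∈ S, (c j - if j = i then ε else 0) • u j := by
      rw [e]
      simp [sub_smul, sum_sub_distrib, hi]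
    have := eq_of_sum_smul_eq h e' hi
    have h1 := hc' i hi
    rw [this, hc0 i (by simp)] at h1
    simp at h1
    linarith
  · intro hx' y hy
    obtain ⟨c, hc, hc0, rfl⟩ := mem_pc.1 hx
    obtain ⟨c', hc', hc0', rfl⟩ := mem_pc.1 hy
    have hpos : ∀ i ∈ S, 0 < c i := by
      intro i hi
      refine lt_of_le_of_ne (hc i) fun h0 => hx' i hi ?_
      refine (mem_pc_of_subset (erase_subset i S)).2 ⟨c, hc, fun j hj => ?_, rfl⟩
      by_cases hji : j = i
      · rw [hji]; exact h0.symm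
      · exact hc0 j fun hjS => hj (mem_erase.2 ⟨hji, hjS⟩)
    have hev : ∀ᶠ ε : ℝ in nhdsWithin 0 (Set.Ioi 0), ∀ i ∈ S, 0 < c i - ε * c' i := by
      rw [Filter.eventually_all_finset]
      intro i hi
      apply Filter.Eventually.filter_mono nhdsWithin_le_nhds
      have hct : ContinuousAt (fun ε : ℝ => c i - ε * c' i) 0 := by fun_prop
      exact hct.eventually_const_lt (by simpa using hpos i hi)
    obtain ⟨ε, hε, hε0⟩ := (hev.and self_mem_nhdsWithin).exists
    refine ⟨ε, hε0, fun i => c i - ε * c' i, fun i hi => (hε i hi).le, ?_⟩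
    simp only [sub_smul, sum_sub_distrib, mul_smul, smul_sum]

theorem ind_sdiff {P Q : Set V} (h : Q ⊆ P) : ind (P \ Q) = ind P - ind Q := by
  rw [ind, ind, ind, Set.indicator_sdiff h]

theorem sum_powerset_nonempty_add {M : Type*} [AddCommMonoid M] (S : Finset ι) (f : Finset ι → M) :
    f ∅ + ∑ t ∈ S.powerset with t.Nonempty, f t = ∑ t ∈ S.powerset, f t := by
  classical
  rw [← sum_filter_add_sum_filter_not S.powerset (fun t => t.Nonempty), add_comm]
  congr 1
  rw [show S.powerset.filter (fun t => ¬ t.Nonempty) = {∅} by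
    ext t; simp only [mem_filter, mem_powerset, not_nonempty_iff_eq_empty, mem_singleton]
    exact ⟨fun h => h.2, fun h => ⟨h ▸ empty_subset _, h⟩⟩, sum_singleton]

/-- Reindexing a sum over the subsets of `S` by complements. -/
theorem sum_powerset_sdiff [DecidableEq ι] {M : Type*} [AddCommMonoid M] (S : Finset ι)
    (f : Finset ι → M) : ∑ t ∈ S.powerset, f (S \ t) = ∑ t ∈ S.powerset, f t := by
  refine sum_nbij' (fun t => S \ t) (fun t => S \ t) ?_ ?_ ?_ ?_ ?_
  · intro t _; exact mem_powerset.2 sdiff_subset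
  · intro t _; exact mem_powerset.2 sdiff_subset
  · intro t ht; exact Finset.sdiff_sdiff_eq_self (mem_powerset.1 ht)
  · intro t ht; exact Finset.sdiff_sdiff_eq_self (mem_powerset.1 ht)
  · intro t _; rfl

theorem biInter_pc_erase_of_indep [DecidableEq ι] {u : ι → V} {S : Finset ι}
    (h : LinearIndepOn ℝ u (S : Set ι)) {t : Finset ι} (ht : t ⊆ S) (hne : t.Nonempty) :
    ⋂ i ∈ t, pc u (S.erase i) = pc u (S \ t) :=
  biInter_pc_erase (α := 1) (fun β hβ => ⟨0, fun i hi => by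
    rw [linearIndepOn_finset_iff.1 h β hβ i hi, zero_mul]⟩) (by simpa using ht) hne

/-- The relative interior of a simplicial cone, as an alternating sum of its faces. -/
theorem ind_relint_pc [DecidableEq ι] {u : ι → V} {S : Finset ι}
    (h : LinearIndepOn ℝ u (S : Set ι)) :
    ind (relint (pc u S)) = ∑ t ∈ S.powerset, (-1 : ℤ) ^ t.card • ind (pc u (S \ t)) := by
  rw [relint_pc h, ind_sdiff (Set.iUnion₂_subset fun i _ => pc_mono (erase_subset _ _)),
    ind_biUnion, ← sum_powerset_nonempty_add, sub_eq_add_neg, ← sum_neg_distrib]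
  congr 1
  · simp
  · refine sum_congr rfl fun t ht => ?_
    rw [mem_filter, mem_powerset] at ht
    rw [biInter_pc_erase_of_indep h ht.1 ht.2, pow_succ, ← neg_smul]
    simp

theorem signedInterior_pc {u : ι → V} {S : Finset ι} (h : LinearIndepOn ℝ u (S : Set ι)) :
    signedInterior (pc u S) = ∑ t ∈ S.powerset, (-1 : ℤ) ^ t.card • ind (pc u t) := by
  classical
  rw [signedInterior, dim_pc h, ind_relint_pc h, smul_sum,
    ← sum_powerset_sdiff S fun t => (-1 : ℤ) ^ t.card • ind (pc u t)]
  refine sum_congr rfl fun t ht => ?_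
  rw [smul_smul, card_sdiff_of_subset (mem_powerset.1 ht)]
  congr 1
  have hle := card_le_card (mem_powerset.1 ht)
  rw [← Nat.sub_add_cancel hle, Nat.add_sub_cancel, pow_add, mul_assoc, ← mul_pow]
  simp

open Classical in
/-- The simplicial cone `pc u S` as an element of `Sig V k` (zero if it has more than `k`
generators). -/
def pcSig (k : ℕ) (u : ι → V) (S : Finset ι) : Sig V k :=
  if h : S.card ≤ k then ⟨ind (pc u S), ind_mem_Sig (kc_pc h)⟩ else 0

theorem pcSig_of {k : ℕ} {u : ι → V} {S : Finset ι} (h : S.card ≤ k) :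
    pcSig k u S = ⟨ind (pc u S), ind_mem_Sig (kc_pc h)⟩ := dif_pos h

theorem interiorSig_pc {k : ℕ} {u : ι → V} {S : Finset ι} (h : LinearIndepOn ℝ u (S : Set ι))
    (hk : S.card ≤ k) :
    interiorSig V k (pcSig k u S) = ∑ t ∈ S.powerset, (-1 : ℤ) ^ t.card • pcSig k u t := by
  apply Subtype.ext
  rw [pcSig_of hk]
  refine (ext_ind _ (kc_pc hk)).trans ?_
  rw [signedInterior_pc h, AddSubgroup.val_finsetSum]
  refine sum_congr rfl fun t ht => ?_
  rw [pcSig_of ((card_le_card (mem_powerset.1 ht)).trans hk)]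
  rfl

/-- The alternating sum over the interval `[R, S]` of the Boolean lattice. -/
theorem sum_Icc_neg_one_pow [DecidableEq ι] {R S : Finset ι} (h : R ⊆ S) :
    ∑ t ∈ S.powerset with R ⊆ t, (-1 : ℤ) ^ t.card = if R = S then (-1) ^ S.card else 0 := by
  have : ∑ t ∈ S.powerset with R ⊆ t, (-1 : ℤ) ^ t.card =
      ∑ t ∈ (S \ R).powerset, (-1 : ℤ) ^ R.card * (-1) ^ t.card := by
    refine sum_nbij' (fun t => t \ R) (fun t => R ∪ t) ?_ ?_ ?_ ?_ ?_
    · intro t ht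
      simp only [mem_filter, mem_powerset] at ht ⊢
      exact sdiff_subset_sdiff ht.1 subset_rfl
    · intro t ht
      simp only [mem_filter, mem_powerset] at ht ⊢
      exact ⟨union_subset h (ht.trans sdiff_subset), subset_union_left⟩
    · intro t ht
      simp only [mem_filter, mem_powerset] at ht
      exact union_sdiff_of_subset ht.2
    · intro t ht
      simp only [mem_powerset] at ht
      ext x
      simp only [mem_sdiff, mem_union]
      refine ⟨fun h => h.1.resolve_left h.2, fun h => ⟨.inr h, (mem_sdiff.1 (ht h)).2⟩⟩
    · intro t ht
      simp only [mem_filter, mem_powerset] at ht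
      rw [← pow_add, add_comm, card_sdiff_add_card_eq_card ht.2]
  rw [this, ← mul_sum, sum_powerset_neg_one_pow_card]
  by_cases e : R = S
  · subst e; simp
  · rw [if_neg e, if_neg, mul_zero]
    intro h'
    exact e (subset_antisymm h (sdiff_eq_empty_iff_subset.1 h'))

/-- The interior operator is an involution: on a simplicial cone this is Möbius inversion over the
faces. -/
theorem interiorSig_interiorSig {k : ℕ} (f : Sig V k) :
    interiorSig V k (interiorSig V k f) = f := by
  classical
  have : (interiorSig V k).comp (interiorSig V k) = AddMonoidHom.id _ := by
    refine Sig.hom_ext_simplicial fun S hS hk => ?_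
    rw [← pcSig_of (u := id) hk, AddMonoidHom.comp_apply, interiorSig_pc hS hk, map_sum]
    have h1 : ∀ t ∈ S.powerset, interiorSig V k ((-1 : ℤ) ^ t.card • pcSig k (id : V → V) t) =
        ∑ r ∈ t.powerset, (-1 : ℤ) ^ t.card • (-1 : ℤ) ^ r.card • pcSig k id r := by
      intro t ht
      have ht := mem_powerset.1 ht
      rw [map_zsmul, interiorSig_pc (hS.mono (by exact_mod_cast ht))
        ((card_le_card ht).trans hk), smul_sum]
    rw [sum_congr rfl h1, sum_comm' (t' := S.powerset)
      (s' := fun r => S.powerset.filter (r ⊆ ·)) (by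
        intro t r
        simp only [mem_powerset, mem_filter]
        exact ⟨fun h => ⟨h, h.2.trans h.1⟩, fun h => h.1⟩)]
    simp only [← sum_smul]
    rw [sum_congr rfl fun r hr => by rw [sum_Icc_neg_one_pow (mem_powerset.1 hr)]]
    simp [smul_smul, ← mul_pow]
  exact DFunLike.congr_fun this f

/-! ### Change of level, restriction to a convex cone, and linear push-forward -/

/-- The inclusion of the filtration steps. -/
def inclSig {k l : ℕ} (h : k ≤ l) : Sig V k →+ Sig V l := AddSubgroup.inclusion (Sig.mono h)

@[simp] theorem inclSig_coe {k l : ℕ} (h : k ≤ l) (f : Sig V k) :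
    (inclSig h f : V → ℤ) = f := rfl

theorem interiorSig_inclSig {k l : ℕ} (h : k ≤ l) (f : Sig V k) :
    interiorSig V l (inclSig h f) = inclSig h (interiorSig V k f) := by
  have : (interiorSig V l).comp (inclSig h) = (inclSig h).comp (interiorSig V k) := by
    refine Sig.hom_ext fun C hC => Subtype.ext ?_
    exact (ext_ind (cut_signedInterior l) (C := C) ⟨hC.1, hC.2.trans h⟩).trans
      (ext_ind (cut_signedInterior k) hC).symm
  exact DFunLike.congr_fun this f

theorem inclSig_boundarySig (k : ℕ) (f : Sig V (k + 1)) :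
    inclSig (Nat.le_succ k) (boundarySig V k f) =
      f - (-1 : ℤ) ^ (k + 1) • interiorSig V (k + 1) f := Subtype.ext (boundarySig_coe k f)

theorem boundarySig_inclSig (k : ℕ) (f : Sig V k) :
    boundarySig V k (inclSig (Nat.le_succ k) f) = f + (-1 : ℤ) ^ k • interiorSig V k f := by
  apply Subtype.ext
  rw [boundarySig_coe, interiorSig_inclSig]
  simp only [inclSig_coe, AddSubgroup.coe_add, AddSubgroup.coe_zsmul, pow_succ]
  module

theorem boundarySig_boundarySig (k : ℕ) (f : Sig V (k + 1 + 1)) :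
    boundarySig V k (boundarySig V (k + 1) f) = 0 := by
  have h1 := congrArg (boundarySig V (k + 1)) (inclSig_boundarySig (k + 1) f)
  rw [boundarySig_inclSig] at h1
  apply Subtype.ext
  rw [boundarySig_coe]
  have h2 : boundarySig V (k + 1) (f - (-1 : ℤ) ^ (k + 1 + 1) • interiorSig V (k + 1 + 1) f) =
      boundarySig V (k + 1) f + boundarySig V (k + 1) f := by
    apply Subtype.ext
    rw [map_sub, map_zsmul]
    simp only [AddSubgroup.coe_add, AddSubgroupClass.coe_sub, AddSubgroup.coe_zsmul,
      boundarySig_coe, interiorSig_interiorSig, smul_sub, smul_smul, ← mul_pow]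
    simp
    abel
  rw [h2] at h1
  have h3 := add_left_cancel h1
  have h4 := congrArg (fun g : Sig V (k + 1) => (g : V → ℤ)) h3
  simp only [AddSubgroup.coe_zsmul] at h4
  rw [ZeroMemClass.coe_zero, sub_eq_zero]
  exact h4.symm

theorem mul_ind_mem {k : ℕ} {K : Set V} (hK : IsConvexCone K) (f : V → ℤ) (hf : f ∈ Sig V k) :
    f * ind K ∈ AddSubgroup.closure {g | ∃ C, KC k C ∧ C ⊆ K ∧ g = ind C} := by
  induction hf using AddSubgroup.closure_induction with
  | mem f h =>
    obtain ⟨C, hC, rfl⟩ := h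
    refine AddSubgroup.subset_closure ⟨C ∩ K, ⟨hC.1.inter hK,
      (dim_mono Set.inter_subset_left).trans hC.2⟩, Set.inter_subset_right, ?_⟩
    ext x
    simp only [ind, Pi.mul_apply, Set.inter_indicator_one]
  | zero => rw [zero_mul]; exact zero_mem _
  | add f f' _ _ h h' => rw [add_mul]; exact add_mem h h'
  | neg f _ h => rw [neg_mul]; exact neg_mem h

theorem closure_sub_le_Sig (k : ℕ) (K : Set V) :
    AddSubgroup.closure {g | ∃ C, KC k C ∧ C ⊆ K ∧ g = ind C} ≤ Sig V k :=
  AddSubgroup.closure_mono fun _ ⟨C, hC, _, e⟩ => ⟨C, hC, e⟩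

/-- Restriction of conical constructible functions to a convex cone. -/
def resSig (k : ℕ) {K : Set V} (hK : IsConvexCone K) : Sig V k →+ Sig V k where
  toFun f := ⟨f * ind K, closure_sub_le_Sig k K (mul_ind_mem hK f f.2)⟩
  map_zero' := Subtype.ext (zero_mul _)
  map_add' _ _ := Subtype.ext (add_mul _ _ _)

theorem resSig_coe (k : ℕ) {K : Set V} (hK : IsConvexCone K) (f : Sig V k) :
    (resSig k hK f : V → ℤ) = f * ind K := rfl

theorem ind_mul_ind (P Q : Set V) : ind P * ind Q = ind (P ∩ Q) := by
  ext x
  simp only [ind, Pi.mul_apply, Set.inter_indicator_one]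

theorem cut_image (k : ℕ) (φ : V →ₗ[ℝ] W) : Cut k fun P : Set V => ind (φ '' P) :=
  cut_ind_of (fun _ _ h => Set.image_mono h) (fun _ _ => Set.image_union _ _ _) (by
    rintro P hP a x ⟨⟨p, hp, rfl⟩, ⟨q, hq, e⟩⟩
    obtain ⟨l, l', hl, hl', h1, hm⟩ := hP.exists_combo hp hq
    refine ⟨_, hm, ?_⟩
    rw [map_add, map_smul, map_smul, e, ← add_smul, h1, one_smul])

theorem dim_image_le (φ : V →ₗ[ℝ] W) (P : Set V) : dim (φ '' P) ≤ dim P := by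
  rw [dim, dim, ← Submodule.map_span]
  exact Submodule.finrank_map_le _ _

theorem KC.map {k : ℕ} {P : Set V} (h : KC k P) (φ : V →ₗ[ℝ] W) : KC k (φ '' P) :=
  ⟨h.1.image φ, (dim_image_le φ P).trans h.2⟩

/-- Push-forward of conical constructible functions by a linear map (integration of Euler
characteristics along fibres): it takes a convex cone to its image. -/
def pushSig (k : ℕ) (φ : V →ₗ[ℝ] W) : Sig V k →+ Sig W k :=
  (ext (cut_image k φ)).codRestrict (Sig W k) (by
    rintro ⟨f, hf⟩
    induction hf using AddSubgroup.closure_induction with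
    | mem f h =>
      obtain ⟨C, hC, rfl⟩ := h
      rw [ext_ind _ hC]
      exact ind_mem_Sig (hC.map φ)
    | zero => exact (map_zero (ext (cut_image k φ))) ▸ zero_mem _
    | add f f' hf hf' h h' =>
      have e : (⟨f + f', AddSubgroup.add_mem _ hf hf'⟩ : Sig V k) = ⟨f, hf⟩ + ⟨f', hf'⟩ := rfl
      rw [e, map_add]; exact add_mem h h'
    | neg f hf h =>
      have e : (⟨-f, AddSubgroup.neg_mem _ hf⟩ : Sig V k) = -⟨f, hf⟩ := rfl
      rw [e, map_neg]; exact neg_mem h)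

theorem pushSig_ind {k : ℕ} (φ : V →ₗ[ℝ] W) {C : Set V} (h : KC k C) :
    pushSig k φ ⟨ind C, ind_mem_Sig h⟩ = ⟨ind (φ '' C), ind_mem_Sig (h.map φ)⟩ :=
  Subtype.ext (ext_ind _ h)

/-- The conical constructible functions of dimension at most `k` built from convex cones
contained in `K`. -/
def sigOn (k : ℕ) (K : Set V) : AddSubgroup (Sig V k) :=
  AddSubgroup.closure {f | ∃ (C : Set V) (h : KC k C), C ⊆ K ∧ f = ⟨ind C, ind_mem_Sig h⟩}

/-- A conical constructible function that vanishes off a convex cone is built from convex cones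
contained in it. -/
theorem mem_sigOn_of_mul {k : ℕ} {K : Set V} (hK : IsConvexCone K) {f : Sig V k}
    (h : (f : V → ℤ) * ind K = f) : f ∈ sigOn k K := by
  have h1 := mul_ind_mem hK f f.2
  rw [h] at h1
  have key : ∀ g ∈ AddSubgroup.closure {g | ∃ C, KC k C ∧ C ⊆ K ∧ g = ind C},
      ∃ hg : g ∈ Sig V k, (⟨g, hg⟩ : Sig V k) ∈ sigOn k K := by
    intro g hg
    induction hg using AddSubgroup.closure_induction with
    | mem f h =>
      obtain ⟨C, hC, hCK, rfl⟩ := h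
      exact ⟨ind_mem_Sig hC, AddSubgroup.subset_closure ⟨C, hC, hCK, rfl⟩⟩
    | zero => exact ⟨zero_mem _, zero_mem _⟩
    | add f g _ _ h h' =>
      obtain ⟨hf, h⟩ := h
      obtain ⟨hg, h'⟩ := h'
      exact ⟨add_mem hf hg, add_mem h h'⟩
    | neg f _ h =>
      obtain ⟨hf, h⟩ := h
      exact ⟨neg_mem hf, neg_mem h⟩
  exact (key f h1).2

theorem sigOn_mono {k : ℕ} {K K' : Set V} (h : K ⊆ K') : sigOn k K ≤ sigOn k K' :=
  AddSubgroup.closure_mono fun _ ⟨C, hC, hCK, e⟩ => ⟨C, hC, hCK.trans h, e⟩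

/-- Homomorphisms that agree on the convex cones contained in `K` agree on `sigOn k K`. -/
theorem eqOn_sigOn {k : ℕ} {K : Set V} {Φ Ψ : Sig V k →+ A}
    (h : ∀ (C : Set V) (hC : KC k C), C ⊆ K →
      Φ ⟨ind C, ind_mem_Sig hC⟩ = Ψ ⟨ind C, ind_mem_Sig hC⟩) {f : Sig V k} (hf : f ∈ sigOn k K) :
    Φ f = Ψ f := by
  have : sigOn k K ≤ (Φ - Ψ).ker := by
    rw [sigOn, AddSubgroup.closure_le]
    rintro _ ⟨C, hC, hCK, rfl⟩
    simp [h C hC hCK]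
  simpa [sub_eq_zero] using this hf

theorem relint_subset (C : Set V) : relint C ⊆ C := fun _ h => h.1

theorem mul_ind_of_subset {P Q : Set V} (h : P ⊆ Q) : ind P * ind Q = ind P := by
  rw [ind_mul_ind, Set.inter_eq_left.2 h]

theorem boundarySig_mem_sigOn {k : ℕ} {K : Set V} {f : Sig V (k + 1)}
    (hf : f ∈ sigOn (k + 1) K) : boundarySig V k f ∈ sigOn k K := by
  have : sigOn (k + 1) K ≤ (sigOn k K).comap (boundarySig V k) := by
    nth_rw 1 [sigOn]
    rw [AddSubgroup.closure_le]
    rintro _ ⟨C, hC, hCK, rfl⟩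
    refine sigOn_mono hCK (mem_sigOn_of_mul hC.1 ?_)
    rw [boundarySig_coe, sub_mul, smul_mul_assoc, interiorSig_ind hC]
    simp only [AddSubgroup.coe_zsmul, smul_mul_assoc, mul_ind_of_subset subset_rfl,
      mul_ind_of_subset (relint_subset C)]
  exact this hf

theorem Sig.mem_sigOn_univ {k : ℕ} (f : Sig V k) : f ∈ sigOn k (Set.univ : Set V) := by
  obtain ⟨f, hf⟩ := f
  induction hf using AddSubgroup.closure_induction with
  | mem f h =>
    obtain ⟨C, hC, rfl⟩ := h
    exact AddSubgroup.subset_closure ⟨C, hC, Set.subset_univ _, rfl⟩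
  | zero => exact zero_mem _
  | add f g hf hg h h' => exact add_mem (show (⟨f, hf⟩ : Sig V k) ∈ _ from h) h'
  | neg f hf h => exact neg_mem (show (⟨f, hf⟩ : Sig V k) ∈ _ from h)

/-- Push-forward by a map that is injective on `K` is transport of functions. -/
theorem pushSig_apply {k : ℕ} {φ : V →ₗ[ℝ] W} {K : Set V} (hφ : Set.InjOn φ K) {f : Sig V k}
    (hf : f ∈ sigOn k K) {x : V} (hx : x ∈ K) : (pushSig k φ f : W → ℤ) (φ x) = (f : V → ℤ) x := by
  refine eqOn_sigOn (Φ := ((Pi.evalAddMonoidHom _ (φ x)).comp (Sig W k).subtype).comp (pushSig k φ))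
    (Ψ := (Pi.evalAddMonoidHom _ x).comp (Sig V k).subtype) (fun C hC hCK => ?_) hf
  simp only [AddMonoidHom.comp_apply, pushSig_ind φ hC]
  change ind _ _ = ind _ _
  by_cases h : x ∈ C
  · rw [ind_of_mem h, ind_of_mem (Set.mem_image_of_mem _ h)]
  · rw [ind_of_notMem h, ind_of_notMem]
    rintro ⟨y, hy, e⟩
    exact h (hφ (hCK hy) hx e ▸ hy)

theorem pushSig_apply_notMem {k : ℕ} {φ : V →ₗ[ℝ] W} {K : Set V} {f : Sig V k}
    (hf : f ∈ sigOn k K) {y : W} (hy : y ∉ φ '' K) : (pushSig k φ f : W → ℤ) y = 0 := by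
  refine eqOn_sigOn (Φ := ((Pi.evalAddMonoidHom _ y).comp (Sig W k).subtype).comp (pushSig k φ))
    (Ψ := 0) (fun C hC hCK => ?_) hf
  simp only [AddMonoidHom.comp_apply, pushSig_ind φ hC]
  exact ind_of_notMem fun h => hy (Set.image_mono hCK h)

theorem relint_image_of_injOn {φ : V →ₗ[ℝ] W} {C : Set V} (h : Set.InjOn φ (Submodule.span ℝ C)) :
    relint (φ '' C) = φ '' relint C := by
  have hs : C ⊆ Submodule.span ℝ C := Submodule.subset_span
  ext x
  constructor
  · rintro ⟨⟨y, hy, rfl⟩, h'⟩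
    refine ⟨y, ⟨hy, fun z hz => ?_⟩, rfl⟩
    obtain ⟨ε, hε, w, hw, hw'⟩ := h' (φ z) ⟨z, hz, rfl⟩
    refine ⟨ε, hε, ?_⟩
    have : w = y - ε • z := h (hs hw) (Submodule.sub_mem _ (hs hy)
      (Submodule.smul_mem _ _ (hs hz))) (by rw [hw', map_sub, map_smul])
    rwa [← this]
  · rintro ⟨y, ⟨hy, h'⟩, rfl⟩
    refine ⟨⟨y, hy, rfl⟩, ?_⟩
    rintro _ ⟨z, hz, rfl⟩
    obtain ⟨ε, hε, hm⟩ := h' z hz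
    exact ⟨ε, hε, _, hm, by rw [map_sub, map_smul]⟩

theorem dim_image_of_injOn {φ : V →ₗ[ℝ] W} {C : Set V} (h : Set.InjOn φ (Submodule.span ℝ C)) :
    dim (φ '' C) = dim C := by
  rw [dim, dim, ← Submodule.map_span]
  have hinj : Function.Injective (φ.domRestrict (Submodule.span ℝ C)) := fun x y e =>
    Subtype.ext (h x.2 y.2 e)
  rw [← LinearMap.range_domRestrict, LinearMap.finrank_range_of_inj hinj]

/-- Push-forward by a linear map that is injective on a subspace commutes with `I` on functions
supported in that subspace. -/
theorem pushSig_interiorSig {k : ℕ} {φ : V →ₗ[ℝ] W} {S : Submodule ℝ V} (hφ : Set.InjOn φ S)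
    {f : Sig V k} (hf : f ∈ sigOn k (S : Set V)) :
    pushSig k φ (interiorSig V k f) = interiorSig W k (pushSig k φ f) := by
  refine eqOn_sigOn (Φ := (pushSig k φ).comp (interiorSig V k))
    (Ψ := (interiorSig W k).comp (pushSig k φ)) (fun C hC hCK => ?_) hf
  have hs : Set.InjOn φ (Submodule.span ℝ C) := hφ.mono (Submodule.span_le.2 hCK)
  simp only [AddMonoidHom.comp_apply]
  rw [pushSig_ind φ hC, interiorSig_ind hC, interiorSig_ind (hC.map φ), map_zsmul,
    dim_image_of_injOn hs]
  congr 1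
  have hmem : (⟨ind (relint C), ind_relint_mem hC⟩ : Sig V k) ∈ sigOn k C :=
    mem_sigOn_of_mul hC.1 (mul_ind_of_subset (relint_subset C))
  apply Subtype.ext
  ext y
  simp only [relint_image_of_injOn hs]
  have hinj : Set.InjOn φ C := hφ.mono hCK
  by_cases hy : y ∈ φ '' C
  · obtain ⟨x, hx, rfl⟩ := hy
    rw [pushSig_apply hinj hmem hx]
    by_cases h : x ∈ relint C
    · simp only [ind_of_mem h, ind_of_mem (Set.mem_image_of_mem φ h)]
    · simp only [ind_of_notMem h]
      rw [ind_of_notMem]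
      rintro ⟨z, hz, e⟩
      exact h (hinj hz.1 hx e ▸ hz)
  · rw [pushSig_apply_notMem hmem hy, ind_of_notMem]
    exact fun h => hy (Set.image_mono (relint_subset C) h)

theorem pushSig_mem_sigOn {k : ℕ} {φ : V →ₗ[ℝ] W} {K : Set V} {f : Sig V k}
    (hf : f ∈ sigOn k K) : pushSig k φ f ∈ sigOn k (φ '' K) := by
  have : sigOn k K ≤ (sigOn k (φ '' K)).comap (pushSig k φ) := by
    nth_rw 1 [sigOn]
    rw [AddSubgroup.closure_le]
    rintro _ ⟨C, hC, hCK, rfl⟩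
    change pushSig k φ _ ∈ sigOn k (φ '' K)
    rw [pushSig_ind φ hC]
    exact AddSubgroup.subset_closure ⟨_, hC.map φ, Set.image_mono hCK, rfl⟩
  exact this hf

theorem inclSig_pushSig {k l : ℕ} (h : k ≤ l) (φ : V →ₗ[ℝ] W) (f : Sig V k) :
    pushSig l φ (inclSig h f) = inclSig h (pushSig k φ f) := by
  have : (pushSig l φ).comp (inclSig h) = (inclSig h).comp (pushSig k φ) := by
    refine Sig.hom_ext fun C hC => Subtype.ext ?_
    exact (ext_ind (cut_image l φ) (C := C) ⟨hC.1, hC.2.trans h⟩).trans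
      (ext_ind (cut_image k φ) hC).symm
  exact DFunLike.congr_fun this f

theorem inclSig_injective {k l : ℕ} (h : k ≤ l) : Function.Injective (inclSig (V := V) h) :=
  fun _ _ e => Subtype.ext (congrArg (fun g : Sig V l => (g : V → ℤ)) e)

theorem pushSig_boundarySig {k : ℕ} {φ : V →ₗ[ℝ] W} {S : Submodule ℝ V} (hφ : Set.InjOn φ S)
    {f : Sig V (k + 1)} (hf : f ∈ sigOn (k + 1) (S : Set V)) :
    pushSig k φ (boundarySig V k f) = boundarySig W k (pushSig (k + 1) φ f) := by
  apply inclSig_injective (Nat.le_succ k)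
  rw [← inclSig_pushSig, inclSig_boundarySig, inclSig_boundarySig, map_sub, map_zsmul,
    pushSig_interiorSig hφ hf]

end InteriorSimplicial
end ConeRing

namespace ConeRing
open Finset

/-! ### Classes of functions of low dimension and the operator `δ` -/

section Classes
variable {n m j k : ℕ}

theorem clsLowSig_ind {C : Set (E n)} (hC : KC j C) :
    clsLowSig n j ⟨ind C, ind_mem_Sig hC⟩ = clsLow n j C := ext_ind _ hC

theorem clsLowSig_self (f : Sig (E n) n) : clsLowSig n n f = clsSig n f := by
  have : clsLowSig n n = clsSig n := by
    refine Sig.hom_ext fun C hC => ?_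
    rw [clsLowSig_ind hC, clsLow_eq (φ := LinearMap.id) hC.1.isCone ⊤ (Set.subset_univ _)
      (fun x _ => rfl) hC.2, clsSig_ind hC.1.isCone]
    simp
  rw [this]

theorem norm_eq_of_mem_span_image {φ : E m →ₗ[ℝ] E n} {C : Set (E m)} {ψ : E n →ₗ[ℝ] E k}
    (hψ : ∀ x ∈ Submodule.span ℝ (φ '' C), ‖ψ x‖ = ‖x‖) {x : E m}
    (hx : x ∈ Submodule.span ℝ C) : ‖ψ (φ x)‖ = ‖φ x‖ := by
  refine hψ _ ?_
  rw [← Submodule.map_span]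
  exact Submodule.mem_map_of_mem hx

/-- The class of a function of low dimension does not change under isometric embeddings. -/
theorem clsLowSig_pushSig {S : Submodule ℝ (E m)} {φ : E m →ₗ[ℝ] E n}
    (hφ : ∀ x ∈ S, ‖φ x‖ = ‖x‖) {f : Sig (E m) j} (hf : f ∈ sigOn j (S : Set (E m))) :
    clsLowSig n j (pushSig j φ f) = clsLowSig m j f := by
  refine eqOn_sigOn (Φ := (clsLowSig n j).comp (pushSig j φ)) (fun C hC hCS => ?_) hf
  rw [AddMonoidHom.comp_apply, pushSig_ind φ hC, clsLowSig_ind (hC.map φ), clsLowSig_ind hC]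
  obtain ⟨ψ, hψ⟩ := exists_isometry_of_le (hC.map φ).2
  rw [clsLow_eq (hC.map φ).1.isCone _ Submodule.subset_span hψ (hC.map φ).2,
    clsLow_eq (φ := ψ.comp φ) hC.1.isCone _ Submodule.subset_span (fun x hx => ?_) hC.2,
    ← Set.image_comp]
  · rfl
  · rw [LinearMap.comp_apply, norm_eq_of_mem_span_image hψ hx,
      hφ x (Submodule.span_le.2 hCS hx)]

theorem injOn_of_norm_eq {S : Submodule ℝ (E m)} {φ : E m →ₗ[ℝ] E n}
    (hφ : ∀ x ∈ S, ‖φ x‖ = ‖x‖) : Set.InjOn φ S := by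
  intro x hx y hy e
  have := hφ (x - y) (S.sub_mem hx hy)
  rw [map_sub, e, sub_self, norm_zero] at this
  exact sub_eq_zero.1 (norm_eq_zero.1 this.symm)

theorem δ_clsSig (f : Sig (E (n + 1)) (n + 1)) :
    δ (n + 1) (clsSig (n + 1) f) = clsLowSig (n + 1) n (boundarySig (E (n + 1)) n f) := by
  have : (δ (n + 1)).comp (clsSig (n + 1)) =
      (clsLowSig (n + 1) n).comp (boundarySig (E (n + 1)) n) := by
    refine Sig.hom_ext fun C hC => ?_
    rw [AddMonoidHom.comp_apply, clsSig_ind hC.1.isCone]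
    exact liftSig_cls (h := fun g f => by
      rw [AddMonoidHom.comp_apply, boundarySig_isoSig, clsLowSig_isoSig]; rfl) hC.1.isCone
  exact DFunLike.congr_fun this f

/-- `δ` is computed by the boundary operator in any ambient space. -/
theorem δ_clsLowSig (f : Sig (E n) (j + 1)) :
    δ (j + 1) (clsLowSig n (j + 1) f) = clsLowSig n j (boundarySig (E n) j f) := by
  have : (δ (j + 1)).comp (clsLowSig n (j + 1)) = (clsLowSig n j).comp (boundarySig (E n) j) := by
    refine Sig.hom_ext fun C hC => ?_
    obtain ⟨φ, hφ⟩ := exists_isometry_of_le hC.2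
    have hon : (⟨ind C, ind_mem_Sig hC⟩ : Sig (E n) (j + 1)) ∈
        sigOn (j + 1) (Submodule.span ℝ C : Set (E n)) :=
      AddSubgroup.subset_closure ⟨C, hC, Submodule.subset_span, rfl⟩
    simp only [AddMonoidHom.comp_apply]
    rw [← clsLowSig_pushSig hφ hon, clsLowSig_self, δ_clsSig,
      ← pushSig_boundarySig (injOn_of_norm_eq hφ) hon,
      clsLowSig_pushSig hφ (boundarySig_mem_sigOn hon)]
  exact DFunLike.congr_fun this f

theorem I_clsSig (f : Sig (E n) n) : I n (clsSig n f) = clsSig n (interiorSig (E n) n f) := by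
  have : (I n).comp (clsSig n) = (clsSig n).comp (interiorSig (E n) n) := by
    refine Sig.hom_ext fun C hC => ?_
    rw [AddMonoidHom.comp_apply, clsSig_ind hC.1.isCone, I_cls hC.1, AddMonoidHom.comp_apply,
      interiorSig_ind hC, map_zsmul]
  exact DFunLike.congr_fun this f

/-- Every element of `L n` is the class of a conical constructible function, so identities between
operators on `L n` can be checked on functions. -/
theorem clsSig_surjective (n : ℕ) : Function.Surjective (clsSig n) := by
  rw [← AddMonoidHom.range_eq_top, ← QuotientAddGroup.ker_mk' (clsSig n).range,
    AddMonoidHom.ker_eq_top_iff]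
  refine L.hom_ext fun P hP => ?_
  rw [AddMonoidHom.zero_apply, QuotientAddGroup.mk'_apply, QuotientAddGroup.eq_zero_iff]
  exact ⟨_, clsSig_ind hP⟩

/-- The inclusion of the first factor of `ℝ^(i + j)`. -/
def inlE (i j : ℕ) : E i →ₗ[ℝ] E (i + j) where
  toFun x := pairE x 0
  map_add' x y := ext_E (by simp) (by simp)
  map_smul' c x := ext_E (by simp) (by simp)

theorem norm_inlE (i j : ℕ) (x : E i) : ‖inlE i j x‖ = ‖x‖ := by
  have : ‖inlE i j x‖ ^ 2 = ‖x‖ ^ 2 := by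
    rw [norm_sq_E]; simp [inlE]
  exact (sq_eq_sq₀ (norm_nonneg _) (norm_nonneg _)).1 this

theorem image_inlE (i j : ℕ) (P : Set (E i)) : inlE i j '' P = prodCone P ({0} : Set (E j)) := by
  ext x
  constructor
  · rintro ⟨y, hy, rfl⟩
    exact ⟨by simpa [inlE] using hy, by simp [inlE]⟩
  · rintro ⟨h1, h2⟩
    exact ⟨_, h1, ext_E (by simp [inlE]) (by simpa [inlE] using (Eq.symm h2))⟩

theorem isCone_zero {n : ℕ} : IsCone ({0} : Set (E n)) := isConvexCone_zero.isCone

theorem mulOne_cls {P : Set (E n)} {Q : Set (E 1)} (hP : IsCone P) (hQ : IsCone Q) :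
    mulOne n (cls 1 Q) (cls n P) = cls (n + 1) (prodCone P Q) := mul_cls hP hQ

theorem mulOne_t_cls {P : Set (E n)} (hP : IsCone P) :
    mulOne n t (cls n P) = cls (n + 1) (inlE n 1 '' P) := by
  rw [t, mulOne_cls hP isCone_zero, image_inlE]

theorem mulOne_t_clsLowSig (f : Sig (E n) j) :
    mulOne j t (clsLowSig n j f) = clsLowSig n (j + 1) (inclSig (Nat.le_succ j) f) := by
  have : (mulOne j t).comp (clsLowSig n j) =
      (clsLowSig n (j + 1)).comp (inclSig (Nat.le_succ j)) := by
    refine Sig.hom_ext fun C hC => ?_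
    obtain ⟨φ, hφ⟩ := exists_isometry_of_le hC.2
    have hC' : KC (j + 1) C := ⟨hC.1, hC.2.trans (Nat.le_succ j)⟩
    rw [AddMonoidHom.comp_apply, clsLowSig_ind hC,
      clsLow_eq hC.1.isCone _ Submodule.subset_span hφ hC.2, mulOne_t_cls (hC.1.image φ).isCone]
    refine Eq.trans ?_ (clsLowSig_ind hC').symm
    rw [clsLow_eq (φ := (inlE j 1).comp φ) hC'.1.isCone _ Submodule.subset_span
      (fun x hx => (norm_inlE j 1 _).trans (hφ x hx)) hC'.2, ← Set.image_comp]
    rfl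
  exact DFunLike.congr_fun this f

/-- Multiplying by `t` forgets that `δ x` lives in lower dimension. -/
theorem t_δ (x : L (n + 1)) :
    mulOne n t (δ (n + 1) x) = x - (-1 : ℤ) ^ (n + 1) • I (n + 1) x := by
  obtain ⟨f, rfl⟩ := clsSig_surjective _ x
  rw [δ_clsSig]
  refine (mulOne_t_clsLowSig _).trans ?_
  rw [clsLowSig_self, inclSig_boundarySig, map_sub, map_zsmul, I_clsSig]

/-- Multiplication by `t` is the change of ambient dimension. -/
theorem mulOne_t_clsSig (f : Sig (E n) n) :
    mulOne n t (clsSig n f) = clsLowSig n (n + 1) (inclSig (Nat.le_succ n) f) := by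
  rw [← clsLowSig_self, mulOne_t_clsLowSig]

/-- A function of dimension at most `n`, viewed in dimension `n + 1`, has the opposite sign in the
boundary operator; hence the plus sign. -/
theorem δ_t (x : L n) : δ (n + 1) (mulOne n t x) = x + (-1 : ℤ) ^ n • I n x := by
  obtain ⟨f, rfl⟩ := clsSig_surjective _ x
  rw [mulOne_t_clsSig, δ_clsLowSig, boundarySig_inclSig, clsLowSig_self, map_add, map_zsmul,
    I_clsSig]

theorem δ_δ (x : L (n + 1)) : δ n (δ (n + 1) x) = 0 := by
  cases n with
  | zero => rfl
  | succ n =>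
    obtain ⟨f, rfl⟩ := clsSig_surjective _ x
    rw [δ_clsSig]
    refine (δ_clsLowSig _).trans ?_
    rw [boundarySig_boundarySig, map_zero]

theorem δ_I (x : L (n + 1)) : δ (n + 1) (I (n + 1) x) = (-1 : ℤ) ^ n • δ (n + 1) x := by
  obtain ⟨f, rfl⟩ := clsSig_surjective _ x
  rw [I_clsSig, δ_clsSig, δ_clsSig, ← map_zsmul]
  congr 1
  apply Subtype.ext
  simp only [boundarySig_coe, interiorSig_interiorSig, AddSubgroup.coe_zsmul, smul_sub, smul_smul,
    pow_succ]
  have : (-1 : ℤ) ^ n * ((-1) ^ n * -1) = -1 := by rw [← mul_assoc, ← mul_pow]; simp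
  rw [this]
  module

end Classes
end ConeRing

namespace ConeRing
open Finset

/-! ### Products of conical constructible functions -/

section Products
variable {n m i j k l : ℕ}

theorem IsConvexCone.prod {P : Set (E i)} {Q : Set (E j)} (hP : IsConvexCone P)
    (hQ : IsConvexCone Q) : IsConvexCone (prodCone P Q) :=
  (hP.preimage (fstE i j)).inter (hQ.preimage (sndE i j))

/-- The linear identification of `ℝ^(i + j)` with the product. -/
def splitE (i j : ℕ) : E (i + j) ≃ₗ[ℝ] E i × E j where
  toFun x := (fstE i j x, sndE i j x)
  invFun p := pairE p.1 p.2
  map_add' x y := by simp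
  map_smul' c x := by simp
  left_inv x := ext_E (by simp) (by simp)
  right_inv p := by simp

theorem splitE_image (P : Set (E i)) (Q : Set (E j)) : splitE i j '' prodCone P Q = P ×ˢ Q := by
  ext ⟨p, q⟩
  constructor
  · rintro ⟨x, hx, e⟩
    obtain ⟨rfl, rfl⟩ := Prod.mk.inj e
    exact hx
  · rintro ⟨hp, hq⟩
    exact ⟨pairE p q, ⟨by simpa using hp, by simpa using hq⟩, by simp [splitE]⟩

theorem dim_prodCone {P : Set (E i)} {Q : Set (E j)} (hP : (0 : E i) ∈ P) (hQ : (0 : E j) ∈ Q) :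
    dim (prodCone P Q) = dim P + dim Q := by
  have h1 := Submodule.span_prod_eq (R := ℝ) hP hQ
  have h2 : (Submodule.span ℝ (prodCone P Q)).map (splitE i j : E (i + j) →ₗ[ℝ] E i × E j) =
      (Submodule.span ℝ P).prod (Submodule.span ℝ Q) := by
    rw [Submodule.map_span, ← h1, ← splitE_image]
    rfl
  rw [dim, dim, dim, ← LinearEquiv.finrank_map_eq (splitE i j) (Submodule.span ℝ (prodCone P Q))]
  refine (congrArg (fun S : Submodule ℝ (E i × E j) => Module.finrank ℝ S) h2).trans ?_
  let e : ((Submodule.span ℝ P).prod (Submodule.span ℝ Q)) ≃ₗ[ℝ]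
      Submodule.span ℝ P × Submodule.span ℝ Q :=
    { toFun := fun x => (⟨x.1.1, x.2.1⟩, ⟨x.1.2, x.2.2⟩)
      invFun := fun x => ⟨(x.1, x.2), x.1.2, x.2.2⟩
      map_add' := fun _ _ => rfl
      map_smul' := fun _ _ => rfl }
  rw [e.finrank_eq, Module.finrank_prod]

theorem KC.prod {P : Set (E i)} {Q : Set (E j)} (hP : KC k P) (hQ : KC l Q) :
    KC (k + l) (prodCone P Q) :=
  ⟨hP.1.prod hQ.1, by
    rw [dim_prodCone hP.1.zero_mem hQ.1.zero_mem]; exact add_le_add hP.2 hQ.2⟩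

theorem exists_sub_mem_le {P : Set (E n)} (hP : IsConvexCone P) {x y : E n} {ε δ : ℝ} (h : δ ≤ ε)
    (hy : y ∈ P) (hx : x - ε • y ∈ P) : x - δ • y ∈ P := by
  have := hP.add_mem hx (hP.smul_mem (sub_nonneg.2 h) hy)
  convert this using 1
  rw [sub_smul]; abel

theorem relint_prodCone {P : Set (E i)} {Q : Set (E j)} (hP : IsConvexCone P)
    (hQ : IsConvexCone Q) : relint (prodCone P Q) = prodCone (relint P) (relint Q) := by
  ext x
  constructor
  · rintro ⟨⟨hx1, hx2⟩, h⟩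
    refine ⟨⟨hx1, fun y hy => ?_⟩, ⟨hx2, fun y hy => ?_⟩⟩
    · obtain ⟨ε, hε, h1, -⟩ := h (pairE y 0) ⟨by simpa using hy, by simpa using hQ.zero_mem⟩
      exact ⟨ε, hε, by simpa using h1⟩
    · obtain ⟨ε, hε, -, h1⟩ := h (pairE 0 y) ⟨by simpa using hP.zero_mem, by simpa using hy⟩
      exact ⟨ε, hε, by simpa using h1⟩
  · rintro ⟨⟨hx1, h1⟩, ⟨hx2, h2⟩⟩
    refine ⟨⟨hx1, hx2⟩, fun y hy => ?_⟩
    obtain ⟨ε, hε, h1⟩ := h1 _ hy.1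
    obtain ⟨ε', hε', h2⟩ := h2 _ hy.2
    refine ⟨min ε ε', lt_min hε hε', ?_, ?_⟩
    · rw [map_sub, map_smul]; exact exists_sub_mem_le hP (min_le_left _ _) hy.1 h1
    · rw [map_sub, map_smul]; exact exists_sub_mem_le hQ (min_le_right _ _) hy.2 h2

/-- The exterior product of two functions. -/
def box (f : E i → ℤ) (g : E j → ℤ) : E (i + j) → ℤ := fun x => f (fstE i j x) * g (sndE i j x)

theorem box_ind (P : Set (E i)) (Q : Set (E j)) : box (ind P) (ind Q) = ind (prodCone P Q) := by
  classical
  ext x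
  simp only [box, ind, Set.indicator_apply, prodCone, Pi.one_apply, Set.mem_ofPred_eq]
  by_cases h : fstE i j x ∈ P <;> by_cases h' : sndE i j x ∈ Q <;> simp [h, h']

theorem box_mem {f : E i → ℤ} {g : E j → ℤ} (hf : f ∈ Sig (E i) k) (hg : g ∈ Sig (E j) l) :
    box f g ∈ Sig (E (i + j)) (k + l) := by
  induction hf using AddSubgroup.closure_induction with
  | mem f h =>
    obtain ⟨C, hC, rfl⟩ := h
    induction hg using AddSubgroup.closure_induction with
    | mem g h =>
      obtain ⟨C', hC', rfl⟩ := h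
      rw [box_ind]; exact ind_mem_Sig (hC.prod hC')
    | zero =>
      rw [show box (ind C) (0 : E j → ℤ) = 0 by ext; simp [box]]; exact zero_mem _
    | add f f' _ _ h h' =>
      rw [show box (ind C) (f + f') = box (ind C) f + box (ind C) f' by ext; simp [box, mul_add]]
      exact add_mem h h'
    | neg f _ h =>
      rw [show box (ind C) (-f) = - box (ind C) f by ext; simp [box]]
      exact neg_mem h
  | zero => rw [show box (0 : E i → ℤ) g = 0 by ext; simp [box]]; exact zero_mem _
  | add f f' _ _ h h' =>
    rw [show box (f + f') g = box f g + box f' g by ext; simp [box, add_mul]]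
    exact add_mem h h'
  | neg f _ h =>
    rw [show box (-f) g = - box f g by ext; simp [box]]
    exact neg_mem h

/-- The exterior product of conical constructible functions. -/
def boxSig (i j k l : ℕ) : Sig (E i) k →+ Sig (E j) l →+ Sig (E (i + j)) (k + l) :=
  AddMonoidHom.mk' (fun f => AddMonoidHom.mk' (fun g => ⟨box f g, box_mem f.2 g.2⟩)
    fun g g' => Subtype.ext (by ext; simp [box, mul_add]))
    fun f f' => by ext g; simp [box, add_mul]

theorem boxSig_coe (f : Sig (E i) k) (g : Sig (E j) l) :
    (boxSig i j k l f g : E (i + j) → ℤ) = box f g := rfl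

theorem boxSig_ind {P : Set (E i)} {Q : Set (E j)} (hP : KC k P) (hQ : KC l Q) :
    boxSig i j k l ⟨ind P, ind_mem_Sig hP⟩ ⟨ind Q, ind_mem_Sig hQ⟩ =
      ⟨ind (prodCone P Q), ind_mem_Sig (hP.prod hQ)⟩ := Subtype.ext (box_ind P Q)

variable {A : Type*} [AddCommGroup A]

theorem Sig.hom_ext₂ {V W : Type*} [NormedAddCommGroup V] [InnerProductSpace ℝ V]
    [FiniteDimensional ℝ V] [NormedAddCommGroup W] [InnerProductSpace ℝ W] [FiniteDimensional ℝ W]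
    {Φ Ψ : Sig V k →+ Sig W l →+ A}
    (h : ∀ (P : Set V) (hP : KC k P) (Q : Set W) (hQ : KC l Q),
      Φ ⟨ind P, ind_mem_Sig hP⟩ ⟨ind Q, ind_mem_Sig hQ⟩ =
        Ψ ⟨ind P, ind_mem_Sig hP⟩ ⟨ind Q, ind_mem_Sig hQ⟩) : Φ = Ψ :=
  Sig.hom_ext fun P hP => Sig.hom_ext fun Q hQ => h P hP Q hQ

theorem interiorSig_boxSig (f : Sig (E i) k) (g : Sig (E j) l) :
    interiorSig _ (k + l) (boxSig i j k l f g) =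
      boxSig i j k l (interiorSig _ k f) (interiorSig _ l g) := by
  have : (AddMonoidHom.compHom (interiorSig _ (k + l))).comp (boxSig i j k l) =
      (AddMonoidHom.compl₂ (boxSig i j k l) (interiorSig _ l)).comp (interiorSig _ k) := by
    refine Sig.hom_ext₂ fun P hP Q hQ => ?_
    change interiorSig _ (k + l) (boxSig i j k l _ _) =
      boxSig i j k l (interiorSig _ k _) (interiorSig _ l _)
    rw [boxSig_ind hP hQ, interiorSig_ind (hP.prod hQ), interiorSig_ind hP, interiorSig_ind hQ,
      map_zsmul, map_zsmul, AddMonoidHom.smul_apply, smul_smul, ← pow_add,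
      dim_prodCone hP.1.zero_mem hQ.1.zero_mem, add_comm (dim Q)]
    congr 1
    apply Subtype.ext
    rw [boxSig_coe, box_ind]
    exact congrArg ind (relint_prodCone hP.1 hQ.1)
  exact DFunLike.congr_fun (DFunLike.congr_fun this f) g

theorem mul_clsSig (f : Sig (E i) i) (g : Sig (E j) j) :
    mul i j (clsSig i f) (clsSig j g) = clsSig (i + j) (boxSig i j i j f g) := by
  have : (AddMonoidHom.compl₂ (mul i j) (clsSig j)).comp (clsSig i) =
      (AddMonoidHom.compHom (clsSig (i + j))).comp (boxSig i j i j) := by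
    refine Sig.hom_ext₂ fun P hP Q hQ => ?_
    change mul i j (clsSig i _) (clsSig j _) = clsSig (i + j) (boxSig i j i j _ _)
    rw [boxSig_ind hP hQ, clsSig_ind hP.1.isCone, clsSig_ind hQ.1.isCone,
      clsSig_ind (hP.1.isCone.prod hQ.1.isCone), mul_cls hP.1.isCone hQ.1.isCone]
  exact DFunLike.congr_fun (DFunLike.congr_fun this f) g

theorem I_mul (x : L i) (y : L j) : I (i + j) (mul i j x y) = mul i j (I i x) (I j y) := by
  obtain ⟨f, rfl⟩ := clsSig_surjective i x
  obtain ⟨g, rfl⟩ := clsSig_surjective j y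
  rw [mul_clsSig, I_clsSig, I_clsSig, I_clsSig, mul_clsSig, interiorSig_boxSig]

theorem I_mulOne (a : L 1) (x : L n) : I (n + 1) (mulOne n a x) = mulOne n (I 1 a) (I n x) :=
  I_mul x a

/-! ### Duality -/

theorem L.hom_ext_convex {Φ Ψ : L n →+ A}
    (h : ∀ C, IsConvexCone C → Φ (cls n C) = Ψ (cls n C)) : Φ = Ψ := by
  have : Φ.comp (clsSig n) = Ψ.comp (clsSig n) := by
    refine Sig.hom_ext fun C hC => ?_
    rw [AddMonoidHom.comp_apply, AddMonoidHom.comp_apply, clsSig_ind hC.1.isCone, h C hC.1]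
  ext x
  obtain ⟨f, rfl⟩ := clsSig_surjective n x
  exact DFunLike.congr_fun this f

theorem L.hom_ext_simplicial {Φ Ψ : L n →+ A}
    (h : ∀ b : Finset (E n), LinearIndepOn ℝ id (b : Set (E n)) →
      Φ (cls n (pc id b)) = Ψ (cls n (pc id b))) : Φ = Ψ := by
  have : Φ.comp (clsSig n) = Ψ.comp (clsSig n) := by
    refine Sig.hom_ext_simplicial fun b hb _ => ?_
    rw [AddMonoidHom.comp_apply, AddMonoidHom.comp_apply,
      clsSig_ind (isConvexCone_pc id b).isCone, h b hb]
  ext x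
  obtain ⟨f, rfl⟩ := clsSig_surjective n x
  exact DFunLike.congr_fun this f

theorem dualCone_dualCone {C : Set (E n)} (hC : IsConvexCone C) : dualCone (dualCone C) = C := by
  refine Set.Subset.antisymm (fun x hx => ?_) fun x hx w hw => by
    rw [real_inner_comm]; exact hw x hx
  obtain ⟨T, rfl⟩ := isConvexCone_iff.1 hC
  intro a ha
  have := hx (-a) (fun v hv => by rw [inner_neg_left]; linarith [hv a ha])
  rw [inner_neg_right, real_inner_comm] at this
  linarith

theorem D_D (x : L n) : D n (D n x) = x := by
  have : (D n).comp (D n) = AddMonoidHom.id _ := L.hom_ext_convex fun C hC => by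
    rw [AddMonoidHom.comp_apply, D_cls hC, D_cls hC.dualCone, dualCone_dualCone hC]; rfl
  exact DFunLike.congr_fun this x

theorem inner_E (x y : E (i + j)) :
    inner ℝ x y = inner ℝ (fstE i j x) (fstE i j y) + inner ℝ (sndE i j x) (sndE i j y) := by
  simp [PiLp.inner_apply, Fin.sum_univ_add, fstE_apply, sndE_apply]

theorem dualCone_prodCone {P : Set (E i)} {Q : Set (E j)} (hP : (0 : E i) ∈ P)
    (hQ : (0 : E j) ∈ Q) : dualCone (prodCone P Q) = prodCone (dualCone P) (dualCone Q) := by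
  ext x
  constructor
  · intro h
    refine ⟨fun v hv => ?_, fun v hv => ?_⟩
    · have := h (pairE v 0) ⟨by simpa using hv, by simpa using hQ⟩
      simpa [inner_E] using this
    · have := h (pairE 0 v) ⟨by simpa using hP, by simpa using hv⟩
      simpa [inner_E] using this
  · rintro ⟨h1, h2⟩ v ⟨hv1, hv2⟩
    rw [inner_E]
    exact add_nonpos (h1 _ hv1) (h2 _ hv2)

theorem D_mul (x : L i) (y : L j) : D (i + j) (mul i j x y) = mul i j (D i x) (D j y) := by
  have : (AddMonoidHom.compHom (D (i + j))).comp (mul i j) =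
      (AddMonoidHom.compl₂ (mul i j) (D j)).comp (D i) := by
    refine L.hom_ext_convex fun P hP => L.hom_ext_convex fun Q hQ => ?_
    change D (i + j) (mul i j _ _) = mul i j (D i _) (D j _)
    rw [mul_cls hP.isCone hQ.isCone, D_cls (hP.prod hQ), D_cls hP, D_cls hQ,
      mul_cls hP.dualCone.isCone hQ.dualCone.isCone,
      dualCone_prodCone hP.zero_mem hQ.zero_mem]
  exact DFunLike.congr_fun (DFunLike.congr_fun this x) y

theorem D_mulOne (a : L 1) (x : L n) : D (n + 1) (mulOne n a x) = mulOne n (D 1 a) (D n x) :=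
  D_mul x a

theorem dualCone_pc (t : Finset (E n)) :
    dualCone (pc id t) = {w : E n | ∀ a ∈ t, inner ℝ w a ≤ 0} := by
  ext w
  constructor
  · exact fun h a ha => h a (mem_pc_self (u := id) ha)
  · rintro h _ ⟨c, hc, rfl⟩
    rw [inner_sum]
    refine sum_nonpos fun a ha => ?_
    rw [real_inner_smul_right]
    exact mul_nonpos_of_nonneg_of_nonpos (hc a ha) (h a ha)

theorem exists_inner_eq {V : Type*} [NormedAddCommGroup V] [InnerProductSpace ℝ V]
    [FiniteDimensional ℝ V] {b : Finset V} (hb : LinearIndepOn ℝ id (b : Set V)) (r : V → ℝ) :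
    ∃ w : V, ∀ a ∈ b, inner ℝ w a = r a := by
  let B := Module.Basis.extend hb
  let f : V →ₗ[ℝ] ℝ := B.constr ℝ fun a => r a
  refine ⟨(InnerProductSpace.toDual ℝ V).symm f.toContinuousLinearMap, fun a ha => ?_⟩
  rw [InnerProductSpace.toDual_symm_apply]
  have h1 : a ∈ hb.extend (Set.subset_univ _) := hb.subset_extend _ ha
  have h2 : B ⟨a, h1⟩ = a := Module.Basis.extend_apply_self hb _
  change f a = r a
  conv_lhs => rw [← h2]
  exact B.constr_basis ℝ _ _

/-- The dual of a simplicial cone is full-dimensional, and its interior is given by the strict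
inequalities. -/
theorem relint_dualCone_pc {b : Finset (E n)} (hb : LinearIndepOn ℝ id (b : Set (E n))) :
    relint (dualCone (pc id b)) = {w | ∀ a ∈ b, inner ℝ w a < 0} ∧
      dim (dualCone (pc id b)) = n := by
  obtain ⟨w₀, hw₀⟩ := exists_inner_eq hb fun _ => -1
  have hstrict : ∀ w : E n, (∀ a ∈ b, inner ℝ w a < 0) → ∀ y : E n,
      ∃ ε : ℝ, 0 < ε ∧ w - ε • y ∈ dualCone (pc id b) := by
    intro w hw y
    have hev : ∀ᶠ ε : ℝ in nhdsWithin 0 (Set.Ioi 0), ∀ a ∈ b, inner ℝ (w - ε • y) a < 0 := by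
      rw [Filter.eventually_all_finset]
      intro a ha
      apply Filter.Eventually.filter_mono nhdsWithin_le_nhds
      have hct : ContinuousAt (fun ε : ℝ => inner ℝ (w - ε • y) a) 0 := by fun_prop
      exact hct.eventually_lt_const (by simpa using hw a ha)
    obtain ⟨ε, hε, hε0⟩ := (hev.and self_mem_nhdsWithin).exists
    refine ⟨ε, hε0, ?_⟩
    rw [dualCone_pc]
    exact fun a ha => (hε a ha).le
  have hmem : w₀ ∈ dualCone (pc id b) := by
    rw [dualCone_pc]; intro a ha; rw [hw₀ a ha]; norm_num
  constructor
  · ext w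
    constructor
    · rintro ⟨-, h⟩ a ha
      obtain ⟨ε, hε, h⟩ := h w₀ hmem
      rw [dualCone_pc] at h
      have := h a ha
      rw [inner_sub_left, real_inner_smul_left, hw₀ a ha] at this
      linarith
    · intro h
      refine ⟨?_, fun y _ => hstrict w h y⟩
      rw [dualCone_pc]; exact fun a ha => (h a ha).le
  · have : Submodule.span ℝ (dualCone (pc id b)) = ⊤ := by
      rw [eq_top_iff]
      rintro y -
      obtain ⟨ε, hε, h⟩ := hstrict w₀ (fun a ha => by rw [hw₀ a ha]; norm_num) y
      have h1 := Submodule.sub_mem _ (Submodule.subset_span (R := ℝ) hmem)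
        (Submodule.subset_span (R := ℝ) h)
      rw [sub_sub_cancel] at h1
      have := Submodule.smul_mem _ ε⁻¹ h1
      rwa [smul_smul, inv_mul_cancel₀ hε.ne', one_smul] at this
    rw [dim, this, finrank_top]
    simp

theorem cls_neg_image {P Q : Set (E n)} (hP : IsCone P) (h : ∀ x, x ∈ Q ↔ -x ∈ P) :
    cls n Q = cls n P := by
  have : Q = LinearIsometryEquiv.neg ℝ (E := E n) '' P := by
    ext x
    rw [h]
    constructor
    · intro hx; exact ⟨-x, hx, by simp⟩
    · rintro ⟨y, hy, rfl⟩; simpa using hy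
  rw [this, cls_image hP]

/-- Duality and the interior operator commute up to sign. For a simplicial cone `C`, both sides are
the alternating sum of the duals of the faces of `C`: the interior of the dual is the complement of
the half-spaces opposite to those defining it. -/
theorem D_I (x : L n) : D n (I n x) = (-1 : ℤ) ^ n • I n (D n x) := by
  classical
  have : (D n).comp (I n) = (-1 : ℤ) ^ n • (I n).comp (D n) := by
    refine L.hom_ext_simplicial fun b hb => ?_
    have hk : b.card ≤ n := by
      have := dim_pc hb ▸ dim_le (pc id b)
      simpa using this
    have e1 : D n (I n (cls n (pc id b))) =
        ∑ t ∈ b.powerset, (-1 : ℤ) ^ t.card • cls n (dualCone (pc id t)) := by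
      rw [← clsSig_ind (isConvexCone_pc id b).isCone, ← pcSig_of (u := id) hk, I_clsSig,
        interiorSig_pc hb hk, map_sum, map_sum]
      refine sum_congr rfl fun t ht => ?_
      rw [map_zsmul, map_zsmul, pcSig_of ((card_le_card (mem_powerset.1 ht)).trans hk),
        clsSig_ind (isConvexCone_pc id t).isCone, D_cls (isConvexCone_pc id t)]
    obtain ⟨hr, hd⟩ := relint_dualCone_pc hb
    have hN : ∀ t : Finset (E n), IsConvexCone (⋂ a ∈ t, {w : E n | 0 ≤ inner ℝ a w}) := by
      intro t
      refine isConvexCone_iff.2 ⟨t, ?_⟩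
      ext w; simp [hcone]
    have hind : ind (relint (dualCone (pc id b))) = ∑ t ∈ b.powerset,
        (-1 : ℤ) ^ t.card • ind (⋂ a ∈ t, {w : E n | 0 ≤ inner ℝ a w}) := by
      have : relint (dualCone (pc id b)) =
          Set.univ \ ⋃ a ∈ b, {w : E n | 0 ≤ inner ℝ a w} := by
        rw [hr]
        ext w
        simp [real_inner_comm]
      rw [this, ind_sdiff (Set.subset_univ _), ind_biUnion, ← sum_powerset_nonempty_add,
        sub_eq_add_neg, ← sum_neg_distrib]
      congr 1
      · simp
      · exact sum_congr rfl fun t _ => by rw [pow_succ, ← neg_smul]; simp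
    have e2 : I n (D n (cls n (pc id b))) = (-1 : ℤ) ^ n •
        ∑ t ∈ b.powerset, (-1 : ℤ) ^ t.card • cls n (dualCone (pc id t)) := by
      rw [D_cls (isConvexCone_pc id b), I_cls (isConvexCone_pc id b).dualCone, hd]
      congr 1
      have : (⟨ind (relint (dualCone (pc id b))),
          ind_relint_mem (kc (isConvexCone_pc id b).dualCone)⟩ : Sig (E n) n) =
          ∑ t ∈ b.powerset, (-1 : ℤ) ^ t.card • ⟨_, ind_mem (hN t).isCone⟩ := by
        apply Subtype.ext
        rw [AddSubgroup.val_finsetSum]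
        exact hind
      rw [this, map_sum]
      refine sum_congr rfl fun t _ => ?_
      rw [map_zsmul, clsSig_ind (hN t).isCone]
      congr 1
      refine cls_neg_image (isConvexCone_pc id t).dualCone.isCone fun x => ?_
      rw [dualCone_pc]
      simp [real_inner_comm]
    rw [AddMonoidHom.comp_apply, e1, AddMonoidHom.smul_apply, AddMonoidHom.comp_apply, e2,
      smul_smul, ← mul_pow]
    simp
  exact DFunLike.congr_fun this x

end Products
end ConeRing

namespace ConeRing
open Finset

/-! ### The classes `t`, `d`, `s` and the Leibniz rule -/

section Line
variable {n m i j k l : ℕ}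

/-- The closed half-line. -/
def halfLine : Set (E 1) := {x | 0 ≤ x 0}

theorem halfLine_eq_pc : halfLine = pc (EuclideanSpace.basisFun (Fin 1) ℝ) {0} := by
  ext x
  simp only [halfLine, pc, Set.mem_ofPred_eq, mem_singleton, forall_eq, sum_singleton]
  constructor
  · intro h
    refine ⟨fun _ => x 0, h, ?_⟩
    ext a
    fin_cases a
    simp
  · rintro ⟨c, hc, rfl⟩
    simpa using hc

theorem isConvexCone_halfLine : IsConvexCone halfLine := halfLine_eq_pc ▸ isConvexCone_pc _ _

theorem kc_halfLine : KC 1 halfLine := kc isConvexCone_halfLine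

/-- The characteristic function of the closed half-line. -/
def halfSig : Sig (E 1) 1 := ⟨ind halfLine, ind_mem_Sig kc_halfLine⟩

theorem kc_zero {k : ℕ} : KC k ({0} : Set (E n)) := ⟨isConvexCone_zero, by
  rw [dim, Submodule.span_zero_singleton]; simp⟩

/-- The characteristic function of the origin. -/
def zeroSig (n k : ℕ) : Sig (E n) k := ⟨ind {0}, ind_mem_Sig kc_zero⟩

theorem interiorSig_halfSig : interiorSig (E 1) 1 halfSig = zeroSig 1 1 - halfSig := by
  have h : LinearIndepOn ℝ (EuclideanSpace.basisFun (Fin 1) ℝ) (({0} : Finset (Fin 1)) : Set (Fin 1)) :=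
    (EuclideanSpace.basisFun (Fin 1) ℝ).orthonormal.linearIndependent.linearIndepOn _
  have e : halfSig = pcSig 1 (EuclideanSpace.basisFun (Fin 1) ℝ) {0} := by
    rw [pcSig_of (by simp)]
    exact Subtype.ext (congrArg ind halfLine_eq_pc)
  have e0 : zeroSig 1 1 = pcSig 1 (EuclideanSpace.basisFun (Fin 1) ℝ) ∅ := by
    rw [pcSig_of (by simp)]
    refine Subtype.ext (congrArg ind ?_)
    ext x; simp [pc, eq_comm]
  rw [e, e0, interiorSig_pc h (by simp), show ({0} : Finset (Fin 1)).powerset = {∅, {0}} by decide,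
    sum_insert (by simp), sum_singleton]
  simp [sub_eq_add_neg]

theorem clsSig_halfSig : clsSig 1 halfSig = d := clsSig_ind isConvexCone_halfLine.isCone

theorem clsSig_zeroSig : clsSig 1 (zeroSig 1 1) = t := clsSig_ind isCone_zero

theorem I_d : I 1 d = t - d := by
  rw [← clsSig_halfSig, I_clsSig, interiorSig_halfSig, map_sub, clsSig_zeroSig]

theorem relint_zero : relint ({0} : Set (E n)) = {0} := by
  ext x
  simp only [relint, Set.mem_singleton_iff, Set.mem_ofPred_eq, forall_eq]
  exact ⟨fun h => h.1, fun h => ⟨h, 1, one_pos, by simpa using h⟩⟩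

theorem dim_zero : dim ({0} : Set (E n)) = 0 := by
  rw [dim, Submodule.span_zero_singleton]; simp

theorem I_cls_zero : I n (cls n {0}) = cls n {0} := by
  rw [I_cls isConvexCone_zero, dim_zero, pow_zero, one_smul, ← clsSig_ind isCone_zero]
  congr 1
  exact Subtype.ext (congrArg ind relint_zero)

theorem dualCone_zero : dualCone ({0} : Set (E n)) = Set.univ := by
  ext; simp [dualCone]

theorem D_t : D 1 t = s := by
  rw [t, D_cls isConvexCone_zero, dualCone_zero, s]

theorem D_s : D 1 s = t := by rw [← D_t, D_D]

theorem inner_E_one (x y : E 1) : inner ℝ x y = x 0 * y 0 := by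
  simp [PiLp.inner_apply, mul_comm]

theorem D_d : D 1 d = d := by
  change D 1 (cls 1 halfLine) = cls 1 halfLine
  rw [D_cls isConvexCone_halfLine]
  refine cls_neg_image isConvexCone_halfLine.isCone fun x => ?_
  simp only [dualCone, halfLine, Set.mem_ofPred_eq, inner_E_one, PiLp.neg_apply, Left.nonneg_neg_iff]
  constructor
  · intro h
    simpa using h (EuclideanSpace.single 0 1) (by simp)
  · intro h v hv
    exact mul_nonpos_of_nonpos_of_nonneg h hv

/-- The line is the union of two half-lines meeting in the origin. -/
theorem s_eq : s = d + d - t := by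
  have hneg : IsConvexCone (halfLine.preimage (-LinearMap.id : E 1 →ₗ[ℝ] E 1)) :=
    isConvexCone_halfLine.preimage _
  have h := cls_union isConvexCone_halfLine.isCone hneg.isCone
  have e1 : halfLine ∪ halfLine.preimage (-LinearMap.id : E 1 →ₗ[ℝ] E 1) = Set.univ := by
    ext x
    simpa [halfLine] using le_total 0 (x 0)
  have e2 : halfLine ∩ halfLine.preimage (-LinearMap.id : E 1 →ₗ[ℝ] E 1) = {0} := by
    ext x
    simp only [halfLine, Set.mem_inter_iff, Set.mem_ofPred_eq, Set.mem_preimage,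
      LinearMap.neg_apply, LinearMap.id_apply, PiLp.neg_apply, Left.nonneg_neg_iff,
      Set.mem_singleton_iff]
    constructor
    · rintro ⟨h1, h2⟩
      ext a
      fin_cases a
      exact le_antisymm h2 h1
    · rintro rfl; simp
  have e3 : cls 1 (halfLine.preimage (-LinearMap.id : E 1 →ₗ[ℝ] E 1)) = cls 1 halfLine :=
    cls_neg_image isConvexCone_halfLine.isCone fun x => by simp
  rw [e1, e2, e3] at h
  exact eq_sub_of_add_eq h

theorem mulOne_add_left (a b : L 1) (x : L n) :
    mulOne n (a + b) x = mulOne n a x + mulOne n b x := map_add (mul n 1 x) a b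

theorem mulOne_sub_left (a b : L 1) (x : L n) :
    mulOne n (a - b) x = mulOne n a x - mulOne n b x := map_sub (mul n 1 x) a b

theorem norm_prodLin {φ : E n →ₗ[ℝ] E k} (x : E (n + j)) (h : ‖φ (fstE n j x)‖ = ‖fstE n j x‖) :
    ‖(pairE (φ (fstE n j x)) (sndE n j x) : E (k + j))‖ = ‖x‖ := by
  have : ‖(pairE (φ (fstE n j x)) (sndE n j x) : E (k + j))‖ ^ 2 = ‖x‖ ^ 2 := by
    rw [norm_sq_E, norm_sq_E x]; simp [h]
  exact (sq_eq_sq₀ (norm_nonneg _) (norm_nonneg _)).1 this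

/-- The product of a linear map with the identity. -/
def prodLin (j : ℕ) (φ : E n →ₗ[ℝ] E k) : E (n + j) →ₗ[ℝ] E (k + j) where
  toFun x := pairE (φ (fstE n j x)) (sndE n j x)
  map_add' x y := ext_E (by simp) (by simp)
  map_smul' c x := ext_E (by simp) (by simp)

theorem prodLin_image (φ : E n →ₗ[ℝ] E k) (P : Set (E n)) (Q : Set (E j)) :
    prodLin j φ '' prodCone P Q = prodCone (φ '' P) Q := by
  ext x
  constructor
  · rintro ⟨y, hy, rfl⟩
    exact ⟨⟨_, hy.1, by simp [prodLin]⟩, by simpa [prodLin] using hy.2⟩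
  · rintro ⟨⟨p, hp, e⟩, h2⟩
    exact ⟨pairE p (sndE k j x), ⟨by simpa using hp, by simpa using h2⟩,
      ext_E (by simp [prodLin, e]) (by simp [prodLin])⟩

theorem clsLowSig_boxSig_halfSig (g : Sig (E n) k) :
    clsLowSig (n + 1) (k + 1) (boxSig n 1 k 1 g halfSig) = mulOne k d (clsLowSig n k g) := by
  have : (clsLowSig (n + 1) (k + 1)).comp ((boxSig n 1 k 1).flip halfSig) =
      (mulOne k d).comp (clsLowSig n k) := by
    refine Sig.hom_ext fun C hC => ?_
    obtain ⟨φ, hφ⟩ := exists_isometry_of_le hC.2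
    change clsLowSig (n + 1) (k + 1) (boxSig n 1 k 1 _ ⟨ind halfLine, ind_mem_Sig kc_halfLine⟩) =
      mulOne k (cls 1 halfLine) (clsLowSig n k _)
    rw [boxSig_ind hC kc_halfLine, clsLowSig_ind hC, clsLowSig_ind (hC.prod kc_halfLine),
      clsLow_eq hC.1.isCone _ Submodule.subset_span hφ hC.2,
      mulOne_cls (hC.1.image φ).isCone isConvexCone_halfLine.isCone,
      clsLow_eq (φ := prodLin 1 φ) (hC.prod kc_halfLine).1.isCone
        ((Submodule.span ℝ C).comap (fstE n 1)) (fun x hx => Submodule.subset_span hx.1)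
        (fun x hx => norm_prodLin x (hφ _ hx)) (hC.prod kc_halfLine).2, prodLin_image]
  exact DFunLike.congr_fun this g

theorem clsLowSig_boxSig_zeroSig (g : Sig (E n) n) :
    clsLowSig (n + 1) n (boxSig n 1 n 0 g (zeroSig 1 0)) = clsSig n g := by
  have : boxSig n 1 n 0 g (zeroSig 1 0) = pushSig n (inlE n 1) g := by
    have : (boxSig n 1 n 0).flip (zeroSig 1 0) = pushSig n (inlE n 1) := by
      refine Sig.hom_ext fun C hC => ?_
      rw [pushSig_ind _ hC]
      refine (boxSig_ind hC kc_zero).trans (Subtype.ext ?_)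
      simp only [image_inlE]
    exact DFunLike.congr_fun this g
  rw [this, clsLowSig_pushSig (S := ⊤) (fun x _ => norm_inlE n 1 x) (Sig.mem_sigOn_univ g),
    clsLowSig_self]

theorem mulOne_d_clsSig (f : Sig (E n) n) :
    mulOne n d (clsSig n f) = clsSig (n + 1) (boxSig n 1 n 1 f halfSig) := by
  rw [← clsSig_halfSig]; exact mul_clsSig f halfSig

theorem boundarySig_boxSig_halfSig (f : Sig (E n) n) :
    (boundarySig (E (n + 1)) n (boxSig n 1 n 1 f halfSig) : E (n + 1) → ℤ) =
      box (f - (-1 : ℤ) ^ n • interiorSig (E n) n f : Sig (E n) n) (halfSig : E 1 → ℤ) +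
        (-1 : ℤ) ^ n • box (interiorSig (E n) n f : E n → ℤ) (ind {0}) := by
  rw [boundarySig_coe, interiorSig_boxSig, interiorSig_halfSig]
  ext x
  simp only [boxSig_coe, box, AddSubgroupClass.coe_sub, AddSubgroup.coe_zsmul, Pi.sub_apply,
    Pi.add_apply, Pi.smul_apply, smul_eq_mul, zeroSig, pow_succ]
  ring

/-- The Leibniz rule for multiplication by `d`. -/
theorem δ_d (x : L (n + 1)) : δ (n + 1 + 1) (mulOne (n + 1) d x) =
    mulOne n d (δ (n + 1) x) + (-1 : ℤ) ^ (n + 1) • I (n + 1) x := by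
  obtain ⟨f, rfl⟩ := clsSig_surjective _ x
  rw [mulOne_d_clsSig, δ_clsSig]
  have e : boundarySig (E (n + 1 + 1)) (n + 1) (boxSig (n + 1) 1 (n + 1) 1 f halfSig) =
      boxSig (n + 1) 1 n 1 (boundarySig (E (n + 1)) n f) halfSig +
        (-1 : ℤ) ^ (n + 1) • boxSig (n + 1) 1 (n + 1) 0 (interiorSig _ _ f) (zeroSig 1 0) := by
    apply Subtype.ext
    rw [boundarySig_boxSig_halfSig]
    rfl
  rw [e, map_add, map_zsmul, clsLowSig_boxSig_zeroSig, I_clsSig]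
  congr 1
  rw [δ_clsSig]
  exact clsLowSig_boxSig_halfSig _

theorem interiorSig_zero (f : Sig (E 0) 0) : interiorSig (E 0) 0 f = f := by
  have : interiorSig (E 0) 0 = AddMonoidHom.id _ := by
    refine Sig.hom_ext fun C hC => ?_
    have hC0 : C = {0} := by
      ext x
      rw [Subsingleton.elim x 0]
      simpa using hC.1.zero_mem
    subst hC0
    rw [interiorSig_ind hC, dim_zero, pow_zero, one_smul]
    exact Subtype.ext (congrArg ind relint_zero)
  rw [this]; rfl

theorem δ_d_zero (x : L 0) : δ 1 (mulOne 0 d x) = I 0 x := by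
  obtain ⟨f, rfl⟩ := clsSig_surjective _ x
  rw [mulOne_d_clsSig, δ_clsSig]
  have e : boundarySig (E (0 + 1)) 0 (boxSig 0 1 0 1 f halfSig) =
      boxSig 0 1 0 0 (interiorSig _ _ f) (zeroSig 1 0) := by
    apply Subtype.ext
    rw [boundarySig_boxSig_halfSig, interiorSig_zero]
    have : (boxSig 0 1 0 0 f (zeroSig 1 0) : E (0 + 1) → ℤ) = box (f : E 0 → ℤ) (ind {0}) := rfl
    rw [this]
    ext x
    simp [box]
  rw [e, clsLowSig_boxSig_zeroSig, I_clsSig]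

end Line
end ConeRing

namespace ConeRing
open Finset

/-! ### Signed subdivision of a simplicial cone -/

section Subdivision
variable {ι : Type*} [Fintype ι] [DecidableEq ι]

/-- The combinatorial identity behind the signed subdivision: `x i` and `l i` are the coordinates
of a generic point and of the new generator. -/
theorem sum_sign_generic {l x : ι → ℝ} (hpos : ∃ p, 0 < l p) (hx : ∀ i, x i ≠ 0)
    (hg : ∀ i j, i ≠ j → l i ≠ 0 → l j ≠ 0 → x i / l i ≠ x j / l j)
    {w : ι → ℤ} {w₀ : ℤ} {Q : ι → Prop} (hQ : ∀ i, l i ≠ 0 →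
      (Q i ↔ 0 ≤ x i / l i ∧ ∀ j, j ≠ i → 0 ≤ x j - x i / l i * l j))
    (h1 : ∀ i, Q i → w i = 1) (h0 : ∀ i, ¬ Q i → w i = 0)
    (h1' : (∀ i, 0 ≤ x i) → w₀ = 1) (h0' : ¬ (∀ i, 0 ≤ x i) → w₀ = 0) :
    ∑ i, (SignType.sign (l i) : ℤ) * w i = w₀ := by
  classical
  set r : ι → ℝ := fun i => x i / l i with hr
  have hxr : ∀ i, l i ≠ 0 → x i = r i * l i := fun i hi => (div_mul_cancel₀ _ hi).symm
  by_cases hz : ∀ j, l j = 0 → 0 ≤ x j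
  swap
  · push Not at hz
    obtain ⟨j, hj, hxj⟩ := hz
    rw [h0' fun h => absurd (h j) (not_le.2 hxj)]
    refine sum_eq_zero fun i _ => ?_
    by_cases hi : l i = 0
    · simp [hi]
    · rw [h0 i, mul_zero]
      rw [hQ i hi]
      rintro ⟨-, h⟩
      have := h j (fun e => hi (e ▸ hj))
      rw [hj] at this
      linarith
  -- `x` can only lie in the piece with the least ratio `r` among those with `0 < l`, or in the piece
  -- with the greatest ratio among those with `l < 0`
  obtain ⟨p, hp, hmin⟩ := exists_min_image (univ.filter (0 < l ·)) r (by
    obtain ⟨p, hp⟩ := hpos; exact ⟨p, by simpa using hp⟩)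
  simp only [mem_filter, mem_univ, true_and] at hp hmin
  have hQpos : ∀ i, 0 < l i → i ≠ p → ¬ Q i := by
    intro i hi hip h
    have h2 := ((hQ i hi.ne').1 h).2 p hip.symm
    rw [hxr p hp.ne', ← sub_mul] at h2
    have h3 : 0 ≤ r p - r i := nonneg_of_mul_nonneg_left h2 hp
    exact hg i p hip hi.ne' hp.ne' (le_antisymm (by linarith) (hmin i hi))
  have hQp : Q p ↔ 0 ≤ r p ∧ ∀ j, l j < 0 → r j ≤ r p := by
    rw [hQ p hp.ne']
    refine and_congr_right fun hrp => ⟨fun h j hj => ?_, fun h j hj => ?_⟩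
    · have h2 := h j (fun e => by rw [e] at hj; linarith)
      rw [hxr j hj.ne, ← sub_mul] at h2
      nlinarith
    · rcases lt_trichotomy (l j) 0 with h3 | h3 | h3
      · rw [hxr j h3.ne, ← sub_mul]
        exact mul_nonneg_of_nonpos_of_nonpos (by linarith [h j h3]) h3.le
      · rw [h3]; simpa using hz j h3
      · rw [hxr j h3.ne', ← sub_mul]
        exact mul_nonneg (by linarith [hmin j h3]) h3.le
  have hall : (∀ i, 0 ≤ x i) ↔ 0 ≤ r p ∧ ∀ j, l j < 0 → r j ≤ 0 := by
    constructor
    · intro h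
      exact ⟨div_nonneg (h p) hp.le, fun j hj => div_nonpos_of_nonneg_of_nonpos (h j) hj.le⟩
    · rintro ⟨h2, h3⟩ i
      rcases lt_trichotomy (l i) 0 with h4 | h4 | h4
      · rw [hxr i h4.ne]; exact mul_nonneg_of_nonpos_of_nonpos (h3 i h4) h4.le
      · exact hz i h4
      · rw [hxr i h4.ne']; exact mul_nonneg (h2.trans (hmin i h4)) h4.le
  by_cases hN : ∃ q, l q < 0
  swap
  · push Not at hN
    rw [Fintype.sum_eq_single p]
    · rw [sign_pos hp]
      simp only [SignType.coe_one, one_mul]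
      have : Q p ↔ ∀ i, 0 ≤ x i := by
        rw [hQp, hall]
        refine and_congr_right fun _ => ⟨fun _ j hj => ?_, fun _ j hj => ?_⟩ <;>
          exact absurd hj (not_lt.2 (hN j))
      by_cases h : Q p
      · rw [h1 p h, h1' (this.1 h)]
      · rw [h0 p h, h0' fun h' => h (this.2 h')]
    · intro i hi
      rcases (hN i).eq_or_lt with h | h
      · simp [← h]
      · rw [h0 i (hQpos i h hi), mul_zero]
  obtain ⟨q, hq, hmax⟩ := exists_max_image (univ.filter (l · < 0)) r (by
    obtain ⟨q, hq⟩ := hN; exact ⟨q, by simpa using hq⟩)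
  simp only [mem_filter, mem_univ, true_and] at hq hmax
  have hQneg : ∀ i, l i < 0 → i ≠ q → ¬ Q i := by
    intro i hi hiq h
    have h2 := ((hQ i hi.ne).1 h).2 q hiq.symm
    rw [hxr q hq.ne, ← sub_mul] at h2
    have h3 : r q - r i ≤ 0 := by nlinarith
    exact hg i q hiq hi.ne hq.ne (le_antisymm (hmax i hi) (by linarith))
  have hQp' : Q p ↔ 0 ≤ r p ∧ r q ≤ r p := by
    rw [hQp]
    exact and_congr_right fun _ => ⟨fun h => h q hq, fun h j hj => (hmax j hj).trans h⟩
  have hQq : Q q ↔ 0 ≤ r q ∧ r q ≤ r p := by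
    rw [hQ q hq.ne]
    refine and_congr_right fun hrp => ⟨fun h => ?_, fun h j hj => ?_⟩
    · have h2 := h p (fun e => by rw [e] at hp; linarith)
      rw [hxr p hp.ne', ← sub_mul] at h2
      have h3 : 0 ≤ r p - r q := nonneg_of_mul_nonneg_left h2 hp
      linarith
    · rcases lt_trichotomy (l j) 0 with h3 | h3 | h3
      · rw [hxr j h3.ne, ← sub_mul]
        exact mul_nonneg_of_nonpos_of_nonpos (by linarith [hmax j h3]) h3.le
      · rw [h3]; simpa using hz j h3
      · rw [hxr j h3.ne', ← sub_mul]
        exact mul_nonneg (by linarith [hmin j h3]) h3.le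
  have hall' : (∀ i, 0 ≤ x i) ↔ 0 ≤ r p ∧ r q ≤ 0 := by
    rw [hall]
    exact and_congr_right fun _ => ⟨fun h => h q hq, fun h j hj => (hmax j hj).trans h⟩
  have hpq : p ≠ q := fun e => by rw [e] at hp; linarith
  rw [Fintype.sum_eq_add p q hpq]
  · rw [sign_pos hp, sign_neg hq]
    simp only [SignType.coe_one, one_mul, SignType.coe_neg_one, neg_one_mul]
    rcases lt_or_gt_of_ne (div_ne_zero (hx q) hq.ne) with h | h
    · have h : r q < 0 := h
      rw [h0 q fun h' => absurd (hQq.1 h').1 (not_le.2 h)]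
      by_cases h' : 0 ≤ r p
      · rw [h1 p (hQp'.2 ⟨h', by linarith⟩), h1' (hall'.2 ⟨h', h.le⟩)]; rfl
      · rw [h0 p fun h'' => h' (hQp'.1 h'').1, h0' fun h'' => h' (hall'.1 h'').1]; rfl
    · have h : 0 < r q := h
      rw [h0' fun h' => absurd (hall'.1 h').2 (not_le.2 h)]
      by_cases h' : r q ≤ r p
      · rw [h1 p (hQp'.2 ⟨by linarith, h'⟩), h1 q (hQq.2 ⟨h.le, h'⟩)]; rfl
      · rw [h0 p fun h'' => h' (hQp'.1 h'').2, h0 q fun h'' => h' (hQq.1 h'').2]; rfl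
  · rintro i ⟨hip, hiq⟩
    rcases lt_trichotomy (l i) 0 with h | h | h
    · rw [h0 i (hQneg i h hiq), mul_zero]
    · simp [h]
    · rw [h0 i (hQpos i h hip), mul_zero]

variable {V : Type*} [NormedAddCommGroup V] [InnerProductSpace ℝ V] [FiniteDimensional ℝ V]

theorem mem_pc_basis (B : Module.Basis ι ℝ V) (x : V) :
    x ∈ pc B univ ↔ ∀ i, 0 ≤ B.repr x i := by
  constructor
  · rintro ⟨c, hc, rfl⟩ i
    rw [B.repr_sum_self]; exact hc i (mem_univ i)
  · intro h
    exact ⟨fun i => B.repr x i, fun i _ => h i, B.sum_repr x⟩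

theorem mem_pc_update (B : Module.Basis ι ℝ V) (c x : V) {i : ι} (hi : B.repr c i ≠ 0) :
    x ∈ pc (Function.update B i c) univ ↔ 0 ≤ B.repr x i / B.repr c i ∧
      ∀ j, j ≠ i → 0 ≤ B.repr x j - B.repr x i / B.repr c i * B.repr c j := by
  have hsum : ∀ y : ι → ℝ, ∑ j, y j • Function.update B i c j =
      y i • c + ∑ j ∈ univ.erase i, y j • B j := by
    intro y
    rw [← add_sum_erase _ _ (mem_univ i), Function.update_self]
    congr 1
    exact sum_congr rfl fun j hj => by rw [Function.update_of_ne (ne_of_mem_erase hj)]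
  have hrepr : ∀ (y : ι → ℝ) (k : ι), B.repr (∑ j ∈ univ.erase i, y j • B j) k =
      if k = i then 0 else y k := by
    intro y k
    have : ∑ j ∈ univ.erase i, y j • B j = ∑ j, (if j = i then 0 else y j) • B j := by
      rw [← add_sum_erase _ _ (mem_univ i)]
      simp only [if_true, zero_smul, zero_add]
      exact sum_congr rfl fun j hj => by rw [if_neg (ne_of_mem_erase hj)]
    rw [this, B.repr_sum_self]
  constructor
  · rintro ⟨y, hy, rfl⟩
    simp only [hsum, map_add, map_smul, Finsupp.add_apply, Finsupp.smul_apply, smul_eq_mul, hrepr,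
      if_true, add_zero]
    rw [mul_div_cancel_right₀ _ hi]
    refine ⟨hy i (mem_univ i), fun j hj => ?_⟩
    rw [if_neg hj]
    have := hy j (mem_univ j)
    linarith
  · rintro ⟨h1, h2⟩
    refine ⟨fun j => if j = i then B.repr x i / B.repr c i else
      B.repr x j - B.repr x i / B.repr c i * B.repr c j, ?_, ?_⟩
    · intro j _
      simp only
      split_ifs with h
      exacts [h1, h2 j h]
    · rw [hsum]
      apply B.repr.injective
      ext k
      simp only [map_add, map_smul, Finsupp.add_apply, Finsupp.smul_apply, smul_eq_mul, hrepr,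
        if_true]
      split_ifs with h
      · rw [h, div_mul_cancel₀ _ hi, add_zero]
      · ring

theorem mul_ind_mem_low {k m : ℕ} {K : Set V} (hK : KC m K) {f : V → ℤ} (hf : f ∈ Sig V k) :
    f * ind K ∈ Sig V m := by
  have := mul_ind_mem hK.1 f hf
  refine (AddSubgroup.closure_le _).2 ?_ this
  rintro _ ⟨C, hC, hCK, rfl⟩
  exact ind_mem_Sig ⟨hC.1, (dim_mono hCK).trans hK.2⟩

/-- A conical constructible function that vanishes off finitely many cones of dimension at most
`m` has dimension at most `m`. -/
theorem mem_Sig_of_support {κ : Type*} {k m : ℕ} {f : V → ℤ} (hf : f ∈ Sig V k) (s : Finset κ)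
    (H : κ → Set V) (hH : ∀ a ∈ s, KC m (H a)) (h : ∀ x, (∀ a ∈ s, x ∉ H a) → f x = 0) :
    f ∈ Sig V m := by
  have e : f = f * ind (⋃ a ∈ s, H a) := by
    ext x
    by_cases hx : x ∈ ⋃ a ∈ s, H a
    · rw [Pi.mul_apply, ind_of_mem hx, mul_one]
    · rw [Pi.mul_apply, ind_of_notMem hx, mul_zero]
      exact h x (by simpa using hx)
  rw [e, ind_biUnion, mul_sum]
  refine AddSubgroup.sum_mem _ fun t ht => ?_
  rw [mul_smul_comm]
  refine AddSubgroup.zsmul_mem _ (mul_ind_mem_low ?_ hf) _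
  rw [mem_filter, mem_powerset] at ht
  obtain ⟨hts, hne⟩ := ht
  have : ∀ t : Finset κ, t ⊆ s → t.Nonempty → KC m (⋂ a ∈ t, H a) := by
    classical
    intro t
    induction t using Finset.induction_on with
    | empty => intro _ h; exact absurd h (by simp)
    | insert a t ha ih =>
      intro hts _
      rw [set_biInter_insert]
      have h1 := hH a (hts (mem_insert_self a t))
      rcases t.eq_empty_or_nonempty with rfl | hne
      · simpa using h1
      · have h2 := ih ((subset_insert a t).trans hts) hne
        exact ⟨h1.1.inter h2.1, (dim_mono Set.inter_subset_left).trans h1.2⟩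
  exact this t hts hne

theorem kc_ker {m : ℕ} (hm : Module.finrank ℝ V = m + 1) {f : V →ₗ[ℝ] ℝ} (hf : f ≠ 0) :
    KC m {x | f x = 0} := by
  obtain ⟨a, ha⟩ : ∃ a : V, ∀ x, inner ℝ a x = f x := by
    refine ⟨(InnerProductSpace.toDual ℝ V).symm f.toContinuousLinearMap, fun x => ?_⟩
    rw [InnerProductSpace.toDual_symm_apply]; rfl
  have e : {x | f x = 0} = {x : V | inner ℝ a x = 0} := by ext x; simp [ha]
  refine ⟨e ▸ isConvexCone_eq a, ?_⟩
  have : Submodule.span ℝ {x | f x = 0} = LinearMap.ker f := by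
    rw [show {x | f x = 0} = (LinearMap.ker f : Set V) from rfl, Submodule.span_eq]
  rw [dim, this]
  have h1 : LinearMap.ker f < ⊤ := lt_top_iff_ne_top.2 fun h => hf (LinearMap.ker_eq_top.1 h)
  have := Submodule.finrank_lt_finrank_of_lt h1
  rw [finrank_top, hm] at this
  omega

/-- Signed subdivision: replacing in turn each generator of a full-dimensional simplicial cone by
a vector `c` with some positive coordinate expresses the cone, up to lower dimension, as a signed
sum; the signs are those of the coordinates of `c`. -/
theorem ind_sub_sum_mem {m : ℕ} (hm : Module.finrank ℝ V = m + 1) (B : Module.Basis ι ℝ V) (c : V)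
    (hpos : ∃ p, 0 < B.repr c p) :
    ind (pc B univ) - ∑ i, (SignType.sign (B.repr c i) : ℤ) •
      ind (pc (Function.update B i c) univ) ∈ Sig V m := by
  classical
  -- the hyperplanes spanned by the facets of the cones in the sum
  let F : ι ⊕ ι × ι → V →ₗ[ℝ] ℝ := fun a => match a with
    | .inl i => B.coord i
    | .inr p => (B.repr c p.2) • B.coord p.1 - (B.repr c p.1) • B.coord p.2
  refine mem_Sig_of_support (k := m + 1) (sub_mem (ind_mem_Sig ⟨isConvexCone_pc _ _, ?_⟩)
    (AddSubgroup.sum_mem _ fun i _ => AddSubgroup.zsmul_mem _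
      (ind_mem_Sig ⟨isConvexCone_pc _ _, ?_⟩) _)) (univ.filter (F · ≠ 0))
    (fun a => {x | F a x = 0}) ?_ ?_
  · exact hm ▸ dim_le _
  · exact hm ▸ dim_le _
  · exact fun a ha => kc_ker hm (mem_filter.1 ha).2
  · intro x hx
    have hF : ∀ a, F a ≠ 0 → F a x ≠ 0 := fun a ha => hx a (mem_filter.2 ⟨mem_univ a, ha⟩)
    have hx1 : ∀ i, B.repr x i ≠ 0 := fun i => hF (.inl i) fun h => by
      have := LinearMap.congr_fun h (B i)
      simp [F] at this
    have hx2 : ∀ i j, i ≠ j → B.repr c i ≠ 0 → B.repr c j ≠ 0 →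
        B.repr x i / B.repr c i ≠ B.repr x j / B.repr c j := by
      intro i j hij hi hj h
      refine hF (.inr (i, j)) (fun h' => ?_) ?_
      · have := LinearMap.congr_fun h' (B j)
        simp [F, hij, hi] at this
      · rw [div_eq_div_iff hi hj] at h
        simp only [F, LinearMap.sub_apply, LinearMap.smul_apply, Module.Basis.coord_apply,
          smul_eq_mul]
        linarith
    simp only [Pi.sub_apply, Finset.sum_apply, Pi.smul_apply, smul_eq_mul]
    rw [sub_eq_zero, eq_comm]
    refine sum_sign_generic (Q := fun i => x ∈ pc (Function.update B i c) univ) hpos hx1 hx2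
      (fun i hi => mem_pc_update B c x hi) (fun i h => ind_of_mem h) (fun i h => ind_of_notMem h)
      (fun h => ind_of_mem ((mem_pc_basis B x).2 h))
      (fun h => ind_of_notMem fun h' => h ((mem_pc_basis B x).1 h'))

end Subdivision
end ConeRing

namespace ConeRing
open Finset

/-! ### Every class is a multiple of `t` up to a multiple of two -/

section Halving

theorem clsSig_mem_range_t {n : ℕ} {f : E (n + 1) → ℤ} (hf : f ∈ Sig (E (n + 1)) n)
    (hf' : f ∈ Sig (E (n + 1)) (n + 1)) : clsSig (n + 1) ⟨f, hf'⟩ ∈ (mulOne n t).range := by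
  refine ⟨clsLowSig (n + 1) n ⟨f, hf⟩, ?_⟩
  rw [mulOne_t_clsLowSig, clsLowSig_self]
  rfl

theorem cls_mem_range_t {n : ℕ} {C : Set (E (n + 1))} (hC : KC n C) :
    cls (n + 1) C ∈ (mulOne n t).range := by
  rw [← clsSig_ind hC.1.isCone]
  exact clsSig_mem_range_t (ind_mem_Sig hC) _

theorem pc_pos_smul {V ι : Type*} [NormedAddCommGroup V] [InnerProductSpace ℝ V] (u : ι → V)
    (S : Finset ι) {r : ι → ℝ} (hr : ∀ i, 0 < r i) : pc (fun i => r i • u i) S = pc u S := by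
  ext x
  constructor
  · rintro ⟨c, hc, rfl⟩
    exact ⟨fun i => c i * r i, fun i hi => mul_nonneg (hc i hi) (hr i).le,
      sum_congr rfl fun i _ => by rw [mul_smul]⟩
  · rintro ⟨c, hc, rfl⟩
    exact ⟨fun i => c i * (r i)⁻¹, fun i hi => mul_nonneg (hc i hi) (inv_nonneg.2 (hr i).le),
      sum_congr rfl fun i _ => by rw [smul_smul, inv_mul_cancel_right₀ (hr i).ne']⟩

theorem pc_comp_perm {V ι : Type*} [NormedAddCommGroup V] [InnerProductSpace ℝ V] [Fintype ι]
    (u : ι → V) (σ : Equiv.Perm ι) : pc (u ∘ σ) univ = pc u univ := by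
  ext x
  constructor
  · rintro ⟨c, hc, rfl⟩
    refine ⟨c ∘ σ.symm, fun i _ => hc _ (mem_univ _), ?_⟩
    rw [← Equiv.sum_comp σ]; simp
  · rintro ⟨c, hc, rfl⟩
    refine ⟨c ∘ σ, fun i _ => hc _ (mem_univ _), ?_⟩
    rw [← Equiv.sum_comp σ (fun i => c i • u i)]; simp

/-- The subgroup of `L (n + 1)` generated by the multiples of `t` and of two. -/
def tTwo (n : ℕ) : AddSubgroup (L (n + 1)) :=
  (mulOne n t).range ⊔ (zsmulAddGroupHom (2 : ℤ)).range

/-- If a reflection interchanges two generators and fixes the others, the cone is cut by the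
mirror into two congruent halves. -/
theorem cls_mem_tTwo_of_swap {n : ℕ} {ι : Type*} [Fintype ι] {u : ι → E (n + 1)} {p q : ι}
    (hpq : u p ≠ u q) (hn : ‖u p‖ = ‖u q‖)
    (h : ∀ i, i ≠ p → i ≠ q → inner ℝ (u i) (u p) = inner ℝ (u i) (u q)) :
    cls (n + 1) (pc u univ) ∈ tTwo n := by
  classical
  set a := u p - u q with ha
  have ha0 : a ≠ 0 := sub_ne_zero.2 hpq
  set ρ := (Submodule.reflection (ℝ ∙ a)ᗮ) with hρ
  have hp : ρ (u p) = u q := Submodule.reflection_sub hn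
  have hq : ρ (u q) = u p := by rw [← hp]; exact Submodule.reflection_reflection _ _
  have hi : ∀ i, i ≠ p → i ≠ q → ρ (u i) = u i := by
    intro i hip hiq
    apply Submodule.reflection_mem_subspace_eq_self
    rw [Submodule.mem_orthogonal_singleton_iff_inner_left, ha, inner_sub_right, h i hip hiq,
      sub_self]
  have hC : IsConvexCone (pc u univ) := isConvexCone_pc _ _
  have himg : ρ '' pc u univ = pc u univ := by
    refine (pc_image ρ.toLinearEquiv.toLinearMap u univ).trans ?_
    rw [← pc_comp_perm u (Equiv.swap p q)]
    refine pc_congr fun i _ => ?_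
    change ρ (u i) = u (Equiv.swap p q i)
    by_cases h1 : i = p
    · rw [h1, hp, Equiv.swap_apply_left]
    by_cases h2 : i = q
    · rw [h2, hq, Equiv.swap_apply_right]
    rw [hi i h1 h2, Equiv.swap_apply_of_ne_of_ne h1 h2]
  have hρa : ρ a = -a := by rw [ha, map_sub, hp, hq]; abel
  have hge : ρ '' (pc u univ ∩ ge a) = pc u univ ∩ ge (-a) := by
    rw [Set.image_inter ρ.injective, himg]
    congr 1
    ext x
    constructor
    · rintro ⟨y, hy, rfl⟩
      change 0 ≤ inner ℝ (-a) (ρ y)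
      rw [← hρa, LinearIsometryEquiv.inner_map_map]; exact hy
    · intro hx
      refine ⟨ρ x, ?_, Submodule.reflection_reflection _ _⟩
      change 0 ≤ inner ℝ a (ρ x)
      rw [← LinearIsometryEquiv.inner_map_map ρ, hρa]
      rw [show ρ (ρ x) = x from Submodule.reflection_reflection _ _]; exact hx
  have hcut := cut_cls (n := n + 1) (pc u univ) (kc hC) a
  rw [← hge, cls_image (P := pc u univ ∩ ge a) (hC.inter (isConvexCone_ge a)).isCone] at hcut
  rw [eq_sub_of_add_eq hcut]
  refine sub_mem (AddSubgroup.mem_sup_right ⟨cls (n + 1) (pc u univ ∩ ge a), ?_⟩)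
    (AddSubgroup.mem_sup_left (cls_mem_range_t ⟨hC.inter (isConvexCone_eq a), ?_⟩))
  · exact two_zsmul _
  · refine (dim_mono Set.inter_subset_right).trans ?_
    have hf : (innerₗ (E (n + 1)) a) ≠ 0 := fun h0 => ha0 (by
      simpa using LinearMap.congr_fun h0 a)
    exact (kc_ker (by simp) hf).2

/-- The vector in the span of the `B j`, `j ∈ K`, having inner product `1` with each of them; it
has a positive coordinate because `⟪c, c⟫` is the sum of its coordinates. -/
theorem exists_circumcenter {V ι : Type*} [NormedAddCommGroup V] [InnerProductSpace ℝ V]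
    [FiniteDimensional ℝ V] [Fintype ι] (B : Module.Basis ι ℝ V) (K : Finset ι) (hK : K.Nonempty) :
    ∃ c : V, (∀ j ∈ K, inner ℝ c (B j) = 1) ∧ (∀ j, j ∉ K → B.repr c j = 0) ∧
      ∃ j, 0 < B.repr c j := by
  classical
  obtain ⟨w, hw⟩ : ∃ w : V, ∀ j, inner ℝ w (B j) = 1 := by
    refine ⟨(InnerProductSpace.toDual ℝ V).symm
      (B.constr ℝ fun _ => (1 : ℝ)).toContinuousLinearMap, fun j => ?_⟩
    rw [InnerProductSpace.toDual_symm_apply]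
    simp
  set S := Submodule.span ℝ (B '' K) with hS
  set c : V := S.starProjection w with hc
  have hcS : c ∈ S := Submodule.starProjection_apply_mem _ _
  have h1 : ∀ j ∈ K, inner ℝ c (B j) = 1 := by
    intro j hj
    rw [← hw j, hc]
    have hjS : B j ∈ S := Submodule.subset_span ⟨j, hj, rfl⟩
    exact (Submodule.inner_starProjection_left_eq_right S w (B j)).trans (by
      rw [Submodule.starProjection_eq_self_iff.2 hjS])
  have h2 : ∀ j, j ∉ K → B.repr c j = 0 := by
    intro j hj
    have := B.mem_span_image.1 hcS
    by_contra h
    exact hj (this (Finsupp.mem_support_iff.2 h))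
  refine ⟨c, h1, h2, ?_⟩
  by_contra! hneg
  have h3 : inner ℝ c c = ∑ j, B.repr c j * inner ℝ c (B j) := by
    conv_lhs => rw [← B.sum_repr c]
    rw [B.sum_repr c]
    conv_lhs => enter [3]; rw [← B.sum_repr c]
    rw [inner_sum]
    exact sum_congr rfl fun j _ => real_inner_smul_right _ _ _
  have h4 : inner ℝ c c ≤ 0 := by
    rw [h3]
    refine sum_nonpos fun j _ => ?_
    by_cases hj : j ∈ K
    · rw [h1 j hj, mul_one]; exact hneg j
    · rw [h2 j hj, zero_mul]
  have h5 : c = 0 := real_inner_self_nonpos.1 h4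
  obtain ⟨j, hj⟩ := hK
  have := h1 j hj
  rw [h5, inner_zero_left] at this
  exact zero_ne_one this

/-- The induction reducing a simplicial cone to cones with a mirror. The generators indexed by `K`
have unit length, and every other generator has the same inner product with all of them; `K` is
shortened by subdividing at the circumcenter of the generators in `K`. -/
theorem cls_pc_mem_tTwo {n : ℕ} {ι : Type*} [Fintype ι] [DecidableEq ι] (k : ℕ) :
    ∀ (B : Module.Basis ι ℝ (E (n + 1))) (K : Finset ι), K.card = k + 2 →
      (∀ j ∈ K, ‖B j‖ = 1) →
      (∀ i, i ∉ K → ∀ j ∈ K, ∀ j' ∈ K, inner ℝ (B i) (B j) = inner ℝ (B i) (B j')) →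
      cls (n + 1) (pc B univ) ∈ tTwo n := by
  induction k with
  | zero =>
    intro B K hK h1 h2
    obtain ⟨p, q, hpq, rfl⟩ := card_eq_two.1 hK
    refine cls_mem_tTwo_of_swap (p := p) (q := q) (fun h => hpq (B.injective h)) ?_ ?_
    · rw [h1 p (by simp), h1 q (by simp)]
    · exact fun i hp hq => h2 i (by simp [hp, hq]) p (by simp) q (by simp)
  | succ k ih =>
    intro B K hK h1 h2
    obtain ⟨c, hc1, hc2, hpos⟩ := exists_circumcenter B K (card_pos.1 (by omega))
    have hm : Module.finrank ℝ (E (n + 1)) = n + 1 := by simp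
    have hsub := ind_sub_sum_mem hm B c hpos
    set w : ι → Sig (E (n + 1)) (n + 1) := fun i =>
      ⟨ind (pc (Function.update B i c) univ), ind_mem (isConvexCone_pc _ _).isCone⟩ with hw
    set f : Sig (E (n + 1)) (n + 1) := ⟨ind (pc B univ), ind_mem (isConvexCone_pc _ _).isCone⟩
      - ∑ i, (SignType.sign (B.repr c i) : ℤ) • w i with hf
    have hfc : (f : E (n + 1) → ℤ) = ind (pc B univ) - ∑ i, (SignType.sign (B.repr c i) : ℤ) •
        ind (pc (Function.update B i c) univ) := by
      rw [hf, AddSubgroup.coe_sub, AddSubgroup.val_finsetSum]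
      rfl
    have hfr : clsSig (n + 1) f ∈ (mulOne n t).range :=
      clsSig_mem_range_t (hfc ▸ hsub) f.2
    have e : cls (n + 1) (pc B univ) = clsSig (n + 1) f +
        ∑ i, (SignType.sign (B.repr c i) : ℤ) • cls (n + 1) (pc (Function.update B i c) univ) := by
      rw [hf, map_sub, map_sum, clsSig_ind (isConvexCone_pc _ _).isCone]
      simp only [map_zsmul, hw]
      rw [sum_congr rfl fun i _ => by rw [clsSig_ind (isConvexCone_pc _ _).isCone]]
      abel
    rw [e]
    refine add_mem (AddSubgroup.mem_sup_left hfr) (AddSubgroup.sum_mem _ fun i _ => ?_)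
    by_cases hi : B.repr c i = 0
    · simp [hi, zero_mem]
    refine AddSubgroup.zsmul_mem _ ?_ _
    -- the generator with index `i` is replaced by `c`, which has equal inner products with the rest
    have hiK : i ∈ K := by
      by_contra h
      exact hi (hc2 i h)
    have hli : LinearIndependent ℝ (Function.update B i c) := by
      refine B.linearIndependent.update i c ⟨1, one_mem _, B.repr c,
        mem_nonZeroDivisors_of_ne_zero hi, ?_⟩
      rw [one_smul, B.linearCombination_repr]
    let B' : Module.Basis ι ℝ (E (n + 1)) :=
      basisOfLinearIndependentOfCardEqFinrank' _ hli (Module.finrank_eq_card_basis B).symm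
    have hB' : (B' : ι → E (n + 1)) = Function.update B i c := by simp [B']
    rw [← hB']
    refine ih B' (K.erase i) (by rw [card_erase_of_mem hiK]; omega) ?_ ?_
    · intro j hj
      rw [hB', Function.update_of_ne (ne_of_mem_erase hj)]
      exact h1 j (mem_of_mem_erase hj)
    · intro l hl j hj j' hj'
      rw [hB', Function.update_of_ne (ne_of_mem_erase hj),
        Function.update_of_ne (ne_of_mem_erase hj')]
      by_cases hli : l = i
      · rw [hli, Function.update_self, hc1 j (mem_of_mem_erase hj), hc1 j' (mem_of_mem_erase hj')]
      · rw [Function.update_of_ne hli]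
        exact h2 l (fun h => hl (mem_erase.2 ⟨hli, h⟩)) j (mem_of_mem_erase hj) j'
          (mem_of_mem_erase hj')

/-- The bound on `n` is needed: a cone with a single generator has no mirror, and `d` is not of
this form in `L 1`. -/
theorem tTwo_eq_top {n : ℕ} (hn : 1 ≤ n) : tTwo n = ⊤ := by
  rw [← QuotientAddGroup.ker_mk' (tTwo n), AddMonoidHom.ker_eq_top_iff]
  refine L.hom_ext_simplicial fun b hb => ?_
  rw [AddMonoidHom.zero_apply, QuotientAddGroup.mk'_apply, QuotientAddGroup.eq_zero_iff]
  by_cases hc : b.card ≤ n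
  · exact AddSubgroup.mem_sup_left (cls_mem_range_t (kc_pc hc))
  have hcard : Fintype.card b = Module.finrank ℝ (E (n + 1)) := by
    refine le_antisymm (hb.linearIndependent.fintype_card_le_finrank) ?_
    simp; omega
  have hpos : ∀ i : b, 0 < ‖(i : E (n + 1))‖⁻¹ := fun i =>
    inv_pos.2 (norm_pos_iff.2 (hb.linearIndependent.ne_zero i))
  let B₀ := basisOfLinearIndependentOfCardEqFinrank' _ hb.linearIndependent hcard
  let B := B₀.isUnitSMul (w := fun i : b => ‖(i : E (n + 1))‖⁻¹) fun i => (hpos i).ne'.isUnit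
  have hB : ∀ i : b, B i = ‖(i : E (n + 1))‖⁻¹ • (i : E (n + 1)) := fun i => by
    simp [B, B₀, Module.Basis.isUnitSMul_apply]
  have e : pc id b = pc B univ := by
    have : (B : b → E (n + 1)) = fun i : b => ‖(i : E (n + 1))‖⁻¹ • (i : E (n + 1)) := funext hB
    rw [this, pc_pos_smul (fun i : b => (i : E (n + 1))) univ hpos]
    conv_lhs => rw [← attach_image_val (s := b)]
    rw [pc_image_finset Subtype.val_injective.injOn]
    rfl
  rw [e]
  obtain ⟨k, hk⟩ := Nat.exists_eq_add_of_le' hn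
  refine cls_pc_mem_tTwo k B univ (by
    rw [card_univ]; refine hcard.trans ?_; simp; omega) (fun i _ => ?_)
    (fun i hi => absurd (mem_univ i) hi)
  rw [hB, norm_smul, norm_inv, norm_norm, inv_mul_cancel₀]
  exact (inv_pos.1 (hpos i)).ne'

/-- In degree at least two, every class is a multiple of `t` up to a multiple of two. -/
theorem exists_eq_t_add_two {n : ℕ} (hn : 1 ≤ n) (x : L (n + 1)) :
    ∃ (y : L n) (z : L (n + 1)), x = mulOne n t y + (z + z) := by
  have hx : x ∈ tTwo n := by rw [tTwo_eq_top hn]; trivial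
  obtain ⟨_, ⟨y, rfl⟩, _, ⟨z, rfl⟩, h⟩ := AddSubgroup.mem_sup.1 hx
  exact ⟨y, z, by rw [← h, ← two_zsmul]; rfl⟩

end Halving
end ConeRing

namespace ConeRing
open Finset

/-! ### The complex of the operators `δ` and `D ∘ δ ∘ D` -/

section Complex
variable {n : ℕ}

theorem I_zero_apply (x : L 0) : I 0 x = x := by
  obtain ⟨f, rfl⟩ := clsSig_surjective 0 x
  rw [I_clsSig, interiorSig_zero]

theorem δbar_apply (x : L n) : δbar n x = D (n - 1) (δ n (D n x)) := rfl

theorem D_I_D (x : L n) : D n (I n (D n x)) = (-1 : ℤ) ^ n • I n x := by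
  rw [D_I, D_D]

theorem D_injective : Function.Injective (D n) := fun x y h => by
  rw [← D_D x, h, D_D]

theorem mem_DLplus {x : L n} : x ∈ DLplus n ↔ δbar n x = 0 := by
  rw [δbar_apply]
  constructor
  · rintro ⟨y, hy, rfl⟩
    rw [D_D, show δ n y = 0 from hy, map_zero]
  · intro h
    exact ⟨D n x, D_injective (h.trans (map_zero _).symm), D_D x⟩

theorem DLplus_eq_ker : DLplus n = (δbar n).ker := AddSubgroup.ext fun _ => mem_DLplus

theorem mem_DLplus_iff_D {x : L n} : x ∈ DLplus n ↔ D n x ∈ Lplus n :=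
  ⟨by rintro ⟨y, hy, rfl⟩; rwa [D_D], fun h => ⟨D n x, h, D_D x⟩⟩

theorem map_D_DLplus : (DLplus n).map (D n) = Lplus n := by
  ext x
  constructor
  · rintro ⟨y, hy, rfl⟩
    exact mem_DLplus_iff_D.1 hy
  · intro hx
    exact ⟨D n x, ⟨x, hx, rfl⟩, D_D x⟩

theorem DLplus_zero : DLplus 0 = ⊤ :=
  eq_top_iff.2 fun _ _ => mem_DLplus.2 (map_zero (D (0 - 1)))

theorem neg_one_pow_smul_smul {A : Type*} [AddCommGroup A] (k : ℕ) (x : A) :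
    (-1 : ℤ) ^ k • (-1 : ℤ) ^ k • x = x := by
  rw [smul_smul, ← mul_pow]; simp

theorem I_of_mem_Lplus {x : L n} (hx : x ∈ Lplus n) : I n x = (-1 : ℤ) ^ n • x := by
  cases n with
  | zero => rw [I_zero_apply, pow_zero, one_smul]
  | succ n =>
    have h := t_δ x
    rw [show δ (n + 1) x = 0 from hx, map_zero, eq_comm, sub_eq_zero] at h
    conv_rhs => rw [h]
    rw [neg_one_pow_smul_smul]

/-- The dual of `t_δ`. -/
theorem mulOne_s_δbar (x : L (n + 1)) :
    mulOne n s (δbar (n + 1) x) = x - I (n + 1) x := by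
  have h := congrArg (D (n + 1)) (t_δ (D (n + 1) x))
  rw [D_mulOne, D_t, map_sub, map_zsmul, D_I_D, D_D, neg_one_pow_smul_smul] at h
  exact h

/-- The dual of `δ_t`. -/
theorem δbar_mulOne_s (x : L n) : δbar (n + 1) (mulOne n s x) = x + I n x := by
  rw [δbar_apply, D_mulOne, D_s]
  refine (congrArg (D n) (δ_t (D n x))).trans ?_
  rw [map_add, map_zsmul, D_I_D, D_D, neg_one_pow_smul_smul]

theorem I_of_mem_DLplus {x : L n} (hx : x ∈ DLplus n) : I n x = x := by
  cases n with
  | zero => exact I_zero_apply x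
  | succ n =>
    have h := mulOne_s_δbar x
    rw [mem_DLplus.1 hx, map_zero, eq_comm, sub_eq_zero] at h
    exact h.symm

theorem Lplus_eq_range : Lplus n = (δ (n + 1)).range := by
  ext x
  constructor
  · intro hx
    cases n with
    | zero => exact ⟨mulOne 0 d x, by rw [δ_d_zero]; exact I_zero_apply x⟩
    | succ n =>
      refine ⟨mulOne (n + 1) d x, ?_⟩
      rw [δ_d, show δ (n + 1) x = 0 from hx, map_zero, zero_add, I_of_mem_Lplus hx,
        neg_one_pow_smul_smul]
  · rintro ⟨y, rfl⟩
    exact δ_δ y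

/-- `ker = im` for `D ∘ δ ∘ D`, by duality from the same statement for `δ`, where multiplication by
`d` provides the preimages. -/
theorem DLplus_eq_range : DLplus n = (δbar (n + 1)).range := by
  ext x
  rw [mem_DLplus_iff_D, Lplus_eq_range]
  constructor
  · rintro ⟨y, hy⟩
    refine ⟨D (n + 1) y, ?_⟩
    rw [δbar_apply, D_D, hy]
    exact D_D x
  · rintro ⟨y, rfl⟩
    exact ⟨D (n + 1) y, (D_D _).symm⟩

theorem δbar_mem_DLplus (x : L (n + 1)) : δbar (n + 1) x ∈ DLplus n := by
  rw [DLplus_eq_range]; exact ⟨x, rfl⟩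

theorem δbar_mulOne_d (x : L (n + 1)) : δbar (n + 1 + 1) (mulOne (n + 1) d x) =
    mulOne n d (δbar (n + 1) x) + I (n + 1) x := by
  rw [δbar_apply, D_mulOne, D_d, δ_d]
  refine (map_add (D (n + 1)) _ _).trans ?_
  rw [map_zsmul, D_mulOne, D_I_D, D_d, neg_one_pow_smul_smul]
  rfl

/-- Multiplication by `d` is a section of `D ∘ δ ∘ D` over its kernel. -/
theorem δbar_mulOne_d_of_mem {x : L n} (hx : x ∈ DLplus n) : δbar (n + 1) (mulOne n d x) = x := by
  cases n with
  | zero =>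
    rw [δbar_apply, D_mulOne, D_d, δ_d_zero, I_zero_apply]
    exact D_D x
  | succ n =>
    rw [δbar_mulOne_d, mem_DLplus.1 hx, I_of_mem_DLplus hx, map_zero, zero_add]

/-- Multiplication by `t = 2 d - s` commutes with `D ∘ δ ∘ D`. -/
theorem δbar_mulOne_t (x : L (n + 1)) :
    δbar (n + 1 + 1) (mulOne (n + 1) t x) = mulOne n t (δbar (n + 1) x) := by
  have ht : t = d + d - s := by rw [s_eq]; abel
  have hs := mulOne_s_δbar x
  have hI : I (n + 1) x = x - mulOne n s (δbar (n + 1) x) := by rw [hs]; abel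
  rw [ht, mulOne_sub_left, mulOne_add_left, mulOne_sub_left, mulOne_add_left, map_sub, map_add,
    δbar_mulOne_d, δbar_mulOne_s, hI]
  have e : ∀ u v w : L (n + 1), (u + (w - v)) + (u + (w - v)) - (w + (w - v)) = u + u - v := by
    intro u v w; abel
  exact e _ _ _

theorem add_I_mem_DLplus (x : L n) : x + I n x ∈ DLplus n := by
  rw [← δbar_mulOne_s]; exact δbar_mem_DLplus _

/-- In positive degrees `ker (D ∘ δ ∘ D)` is the image of `1 + I`: an element is `δbar w` with
`w = t y + 2 z`, and both terms are of the form `x + I x`. -/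
theorem DLplus_eq_range_one_add_I (hn : 0 < n) :
    DLplus n = (AddMonoidHom.id (L n) + I n).range := by
  ext x
  constructor
  · obtain ⟨m, rfl⟩ := Nat.exists_eq_add_of_le' hn
    rw [DLplus_eq_range]
    rintro ⟨w, rfl⟩
    obtain ⟨y, z, rfl⟩ := exists_eq_t_add_two (n := m + 1) (by omega) w
    rw [map_add, map_add, δbar_mulOne_t]
    -- `t u = d u + I (d u)` for `u = δbar y`, and `v + v = v + I v` for `v = δbar z`
    refine AddSubgroup.add_mem (AddMonoidHom.id (L (m + 1)) + I (m + 1)).range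
      ⟨mulOne m d (δbar (m + 1) y), ?_⟩ ⟨δbar (m + 1 + 1) z, ?_⟩
    · change mulOne m d _ + I (m + 1) (mulOne m d _) = _
      rw [I_mulOne, I_d, mulOne_sub_left, I_of_mem_DLplus (δbar_mem_DLplus y)]
      exact add_sub_cancel _ _
    · exact congrArg ((fun u w : L (m + 1) => u + w) (δbar (m + 1 + 1) z))
        (I_of_mem_DLplus (δbar_mem_DLplus z))
  · rintro ⟨y, rfl⟩
    exact add_I_mem_DLplus y

theorem exists_add_I_eq (hn : 0 < n) {x : L n} (hx : x ∈ DLplus n) : ∃ y, y + I n y = x := by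
  rw [DLplus_eq_range_one_add_I hn] at hx; exact hx

theorem exists_of_mem_Lplus (hn : 0 < n) {x : L n} (hx : x ∈ Lplus n) :
    ∃ y, y + (-1 : ℤ) ^ n • I n y = x := by
  obtain ⟨y, hy⟩ := exists_add_I_eq hn (x := D n x) ⟨x, hx, rfl⟩
  refine ⟨D n y, ?_⟩
  rw [← D_D x, ← hy, map_add, D_I]

/-- In even degree `δ (y + I y) = 0`, so the image of `1 + I` lies in both kernels. -/
theorem DLplus_even {k : ℕ} : DLplus (2 * k) = Lplus (2 * k) := by
  rcases k.eq_zero_or_pos with rfl | hk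
  · rw [mul_zero, DLplus_zero]
    exact (eq_top_iff.2 fun _ _ => rfl).symm
  ext x
  rw [mem_DLplus_iff_D]
  have key : ∀ x : L (2 * k), x ∈ DLplus (2 * k) → x ∈ Lplus (2 * k) := by
    intro x hx
    obtain ⟨y, rfl⟩ := exists_add_I_eq (by omega) hx
    obtain ⟨m, hm⟩ : ∃ m, 2 * k = m + 1 := ⟨2 * k - 1, by omega⟩
    have hodd : (-1 : ℤ) ^ m = -1 := Odd.neg_one_pow (by
      rw [Nat.odd_iff]; omega)
    clear hx
    revert y
    rw [hm]
    intro y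
    change δ (m + 1) (y + I (m + 1) y) = 0
    rw [map_add, δ_I, hodd, neg_one_smul, add_neg_cancel]
  refine ⟨fun h => key x (mem_DLplus_iff_D.2 h), fun h => key _ ⟨x, h, rfl⟩⟩

/-- In odd degree `t δ y = y + I y`. -/
theorem DLplus_odd {k : ℕ} :
    DLplus (2 * k + 1) = (Lplus (2 * k)).map (mulOne (2 * k) t) := by
  have h : ∀ y : L (2 * k + 1), mulOne (2 * k) t (δ (2 * k + 1) y) = y + I (2 * k + 1) y := by
    intro y
    rw [t_δ, pow_succ, pow_mul]
    simp
  rw [DLplus_eq_range_one_add_I (by omega), Lplus_eq_range]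
  ext x
  constructor
  · rintro ⟨y, rfl⟩
    exact ⟨_, ⟨y, rfl⟩, h y⟩
  · rintro ⟨_, ⟨y, rfl⟩, rfl⟩
    exact ⟨y, (h y).symm⟩

theorem Lplus_odd {k : ℕ} :
    Lplus (2 * k + 1) = (Lplus (2 * k)).map (mulOne (2 * k) s) := by
  rw [← map_D_DLplus, DLplus_odd]
  ext x
  constructor
  · rintro ⟨_, ⟨y, hy, rfl⟩, rfl⟩
    refine ⟨D _ y, ?_, ?_⟩
    · rw [← DLplus_even]; exact ⟨y, hy, rfl⟩
    · rw [D_mulOne, D_t]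
  · rintro ⟨y, hy, rfl⟩
    refine ⟨mulOne _ t (D _ y), ⟨D _ y, ?_, rfl⟩, ?_⟩
    · rw [← DLplus_even]; exact ⟨y, hy, rfl⟩
    · rw [D_mulOne, D_t, D_D]

end Complex

/-! ### The subring `D(L⁺)` and the basis `{1, d}` -/

section Ring

/-- The image of `1 + I` is closed under products, since `(x + I x) y = x y + I (x y)` when
`I y = y`. -/
theorem mul_mem_DLplus {i j : ℕ} {x : L i} {y : L j} (hx : x ∈ DLplus i) (hy : y ∈ DLplus j) :
    mul i j x y ∈ DLplus (i + j) := by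
  rcases i.eq_zero_or_pos with rfl | hi
  · rcases j.eq_zero_or_pos with rfl | hj
    · exact DLplus_zero ▸ AddSubgroup.mem_top _
    · obtain ⟨y, rfl⟩ := exists_add_I_eq hj hy
      have : mul 0 j x (y + I j y) = mul 0 j x y + I (0 + j) (mul 0 j x y) := by
        rw [I_mul, I_of_mem_DLplus hx, map_add]
      rw [this]; exact add_I_mem_DLplus _
  · obtain ⟨x, rfl⟩ := exists_add_I_eq hi hx
    have : mul i j (x + I i x) y = mul i j x y + I (i + j) (mul i j x y) := by
      rw [I_mul, I_of_mem_DLplus hy, map_add]; rfl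
    rw [this]; exact add_I_mem_DLplus _

theorem of_mem_iff_forall {n : ℕ} {x : L n} :
    (∀ m, DirectSum.of L n x m ∈ DLplus m) ↔ x ∈ DLplus n := by
  constructor
  · intro h
    have := h n
    rwa [DirectSum.of_eq_same] at this
  · intro h m
    by_cases hm : n = m
    · subst hm; rwa [DirectSum.of_eq_same]
    · rw [DirectSum.of_eq_of_ne _ _ _ (Ne.symm hm)]; exact zero_mem _

/-- The subring `D(L⁺)` of `L`. -/
def DLplusRing : Subring LRing where
  carrier := {x | ∀ n, x n ∈ DLplus n}
  zero_mem' n := by rw [DirectSum.zero_apply]; exact zero_mem _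
  add_mem' hx hy n := by rw [DirectSum.add_apply]; exact add_mem (hx n) (hy n)
  neg_mem' hx n := neg_mem (hx n)
  one_mem' := of_mem_iff_forall.2 (DLplus_zero ▸ AddSubgroup.mem_top _)
  mul_mem' {x y} hx hy := by
    classical
    -- the product is a sum of products of homogeneous components
    have key : ∀ z : LRing, z ∈ AddSubgroup.closure {w : LRing | ∀ n, w n ∈ DLplus n} →
        ∀ n, z n ∈ DLplus n := by
      intro z hz
      induction hz using AddSubgroup.closure_induction with
      | mem z h => exact h
      | zero => intro n; rw [DirectSum.zero_apply]; exact zero_mem _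
      | add a b _ _ ha hb => intro n; rw [DirectSum.add_apply]; exact add_mem (ha n) (hb n)
      | neg a _ ha => exact fun n => neg_mem (ha n)
    apply key
    rw [← DirectSum.sum_support_of x, ← DirectSum.sum_support_of y, sum_mul_sum]
    refine AddSubgroup.sum_mem _ fun i _ => AddSubgroup.sum_mem _ fun j _ =>
      AddSubgroup.subset_closure ?_
    rw [DirectSum.of_mul_of]
    exact of_mem_iff_forall.2 (mul_mem_DLplus (hx i) (hy j))

theorem mem_DLplusRing {x : LRing} : x ∈ DLplusRing ↔ ∀ n, x n ∈ DLplus n := Iff.rfl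

theorem of_mul_of_one {n : ℕ} (x : L n) (a : L 1) :
    DirectSum.of L n x * DirectSum.of L 1 a = DirectSum.of L (n + 1) (mulOne n a x) :=
  DirectSum.of_mul_of x a

theorem mul_of_one_apply (x : LRing) (a : L 1) (n : ℕ) :
    (x * DirectSum.of L 1 a) (n + 1) = mulOne n a (x n) := by
  induction x using DirectSum.induction_on with
  | zero => simp
  | of i x =>
    rw [of_mul_of_one]
    by_cases h : i = n
    · subst h; rw [DirectSum.of_eq_same, DirectSum.of_eq_same]
    · rw [DirectSum.of_eq_of_ne _ _ _ (by omega), DirectSum.of_eq_of_ne _ _ _ (Ne.symm h), map_zero]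
  | add x y hx hy => rw [add_mul, DirectSum.add_apply, hx, hy, DirectSum.add_apply, map_add]

theorem linearIndependent_one_d :
    LinearIndependent DLplusRing ![(1 : LRing), DirectSum.of L 1 d] := by
  rw [LinearIndependent.pair_iff]
  intro a b h
  simp only [Subring.smul_def, smul_eq_mul, mul_one] at h
  -- applying `δbar` to `a + b d = 0` gives `b = 0`
  have hb : b = 0 := by
    apply Subtype.ext
    refine DFinsupp.ext fun n => ?_
    have h1 := DFunLike.congr_fun h (n + 1)
    rw [DirectSum.add_apply, mul_of_one_apply, DirectSum.zero_apply] at h1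
    have h2 := congrArg (δbar (n + 1)) h1
    rw [map_add, mem_DLplus.1 (a.2 (n + 1)), δbar_mulOne_d_of_mem (b.2 n), zero_add, map_zero] at h2
    exact h2
  refine ⟨?_, hb⟩
  rw [hb] at h
  apply Subtype.ext
  simpa using h

theorem span_one_d :
    ⊤ ≤ Submodule.span DLplusRing (Set.range ![(1 : LRing), DirectSum.of L 1 d]) := by
  rintro x -
  have h1 : ∀ {n : ℕ} {y : L n}, y ∈ DLplus n →
      DirectSum.of L n y ∈ Submodule.span DLplusRing (Set.range ![(1 : LRing), DirectSum.of L 1 d]) := by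
    intro n y hy
    have := Submodule.smul_mem (Submodule.span DLplusRing _)
      (⟨DirectSum.of L n y, of_mem_iff_forall.2 hy⟩ : DLplusRing)
      (Submodule.subset_span ⟨(0 : Fin 2), rfl⟩ :
        (1 : LRing) ∈ Submodule.span DLplusRing (Set.range ![(1 : LRing), DirectSum.of L 1 d]))
    simpa [Subring.smul_def] using this
  have h2 : ∀ {n : ℕ} {y : L n}, y ∈ DLplus n → DirectSum.of L (n + 1) (mulOne n d y) ∈
      Submodule.span DLplusRing (Set.range ![(1 : LRing), DirectSum.of L 1 d]) := by
    intro n y hy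
    have := Submodule.smul_mem (Submodule.span DLplusRing _)
      (⟨DirectSum.of L n y, of_mem_iff_forall.2 hy⟩ : DLplusRing)
      (Submodule.subset_span ⟨(1 : Fin 2), rfl⟩ : DirectSum.of L 1 d ∈
        Submodule.span DLplusRing (Set.range ![(1 : LRing), DirectSum.of L 1 d]))
    rw [← of_mul_of_one]
    simpa [Subring.smul_def] using this
  induction x using DirectSum.induction_on with
  | zero => exact zero_mem _
  | add x y hx hy => exact add_mem hx hy
  | of n x =>
    cases n with
    | zero => exact h1 (DLplus_zero ▸ AddSubgroup.mem_top _)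
    | succ n =>
      have hu := δbar_mem_DLplus x
      -- the decomposition `x = (x - d δbar x) + d δbar x`
      have e : x = (x - mulOne n d (δbar (n + 1) x)) + mulOne n d (δbar (n + 1) x) := by abel
      rw [e, map_add]
      refine add_mem (h1 (mem_DLplus.2 ?_)) (h2 hu)
      rw [map_sub, δbar_mulOne_d_of_mem hu]
      exact sub_self _

theorem exists_basis_one_d : ∃ b : Module.Basis (Fin 2) DLplusRing LRing,
    b 0 = 1 ∧ b 1 = DirectSum.of L 1 d := by
  refine ⟨Module.Basis.mk linearIndependent_one_d span_one_d, ?_, ?_⟩ <;>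
    simp [Module.Basis.mk_apply]

end Ring
end ConeRing

namespace ConeRing
open Finset Filter Topology

/-! ### Tangent cones -/

section Tangent
variable {V W : Type*} [NormedAddCommGroup V] [InnerProductSpace ℝ V] [FiniteDimensional ℝ V]
  [NormedAddCommGroup W] [InnerProductSpace ℝ W] [FiniteDimensional ℝ W]

/-- The directions `v` such that a short segment starting at `x` in direction `v` lies in `P`. -/
def tanCone (P : Set V) (x : V) : Set V := {v | ∀ᶠ ε : ℝ in 𝓝[>] 0, x + ε • v ∈ P}

theorem mem_tanCone {P : Set V} {x v : V} :
    v ∈ tanCone P x ↔ ∀ᶠ ε : ℝ in 𝓝[>] 0, x + ε • v ∈ P := Iff.rfl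

theorem exists_pos_of_mem_tanCone {P : Set V} {x v : V} (h : v ∈ tanCone P x) :
    ∃ ε : ℝ, x + ε • v ∈ P ∧ 0 < ε :=
  ((mem_tanCone.1 h).and self_mem_nhdsWithin).exists

theorem tendsto_add_smul (x v : V) : Tendsto (fun ε : ℝ => x + ε • v) (𝓝[>] 0) (𝓝 x) := by
  have : Tendsto (fun ε : ℝ => x + ε • v) (𝓝 0) (𝓝 (x + (0 : ℝ) • v)) :=
    Continuous.tendsto (by fun_prop) 0
  rw [zero_smul, add_zero] at this
  exact this.mono_left nhdsWithin_le_nhds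

theorem mem_tanCone_of_convex {P : Set V} (hP : Convex ℝ P) {x v : V} (hx : x ∈ P) {ε₀ : ℝ}
    (hε₀ : 0 < ε₀) (h : x + ε₀ • v ∈ P) : v ∈ tanCone P x := by
  filter_upwards [Ioc_mem_nhdsGT hε₀] with ε hε
  have h1 : x + ε • v = (1 - ε / ε₀) • x + (ε / ε₀) • (x + ε₀ • v) := by
    rw [smul_add, smul_smul, div_mul_cancel₀ _ hε₀.ne']
    module
  rw [h1]
  exact hP hx h (sub_nonneg.2 ((div_le_one hε₀).2 hε.2)) (div_nonneg hε.1.le hε₀.le) (by ring)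

/-- A closed convex set met by a segment arbitrarily close to its initial point contains a germ of
the segment. -/
theorem mem_tanCone_of_frequently {P : Set V} (hP : Convex ℝ P) (hP' : IsClosed P) {x v : V}
    (h : ∃ᶠ ε : ℝ in 𝓝[>] 0, x + ε • v ∈ P) : x ∈ P ∧ v ∈ tanCone P x := by
  have hx : x ∈ P := hP'.mem_of_frequently_of_tendsto h (tendsto_add_smul x v)
  refine ⟨hx, ?_⟩
  obtain ⟨ε, h1, h2⟩ := (h.and_eventually self_mem_nhdsWithin).exists
  exact mem_tanCone_of_convex hP hx h2 h1

theorem tanCone_biInter {κ : Type*} (t : Finset κ) (K : κ → Set V) (x : V) :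
    tanCone (⋂ a ∈ t, K a) x = ⋂ a ∈ t, tanCone (K a) x := by
  ext v
  simp only [tanCone, Set.mem_iInter, Set.mem_ofPred_eq]
  exact Filter.eventually_all_finset t

theorem tanCone_biUnion {κ : Type*} (s : Finset κ) (K : κ → Set V) (hK : ∀ a ∈ s, Convex ℝ (K a))
    (hK' : ∀ a ∈ s, IsClosed (K a)) (x : V) {v : V} :
    v ∈ tanCone (⋃ a ∈ s, K a) x → ∃ a ∈ s, x ∈ K a ∧ v ∈ tanCone (K a) x := by
  intro hv
  have hv : ∃ᶠ ε : ℝ in 𝓝[>] 0, ∃ a ∈ s, x + ε • v ∈ K a := by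
    refine Eventually.frequently ((mem_tanCone.1 hv).mono fun ε h => ?_)
    simpa using h
  by_contra! hcon
  refine hv ?_
  have : ∀ a ∈ s, ∀ᶠ ε : ℝ in 𝓝[>] 0, x + ε • v ∉ K a := by
    intro a ha
    by_contra h
    have := mem_tanCone_of_frequently (hK a ha) (hK' a ha) h
    exact hcon a ha this.1 this.2
  filter_upwards [(Filter.eventually_all_finset s).2 this] with ε h
  rintro ⟨a, ha, h'⟩
  exact h a ha h'

theorem IsConvexCone.convex {C : Set V} (hC : IsConvexCone C) : Convex ℝ C :=
  fun _ hx _ hy _ _ ha hb _ => hC.add_mem (hC.smul_mem ha hx) (hC.smul_mem hb hy)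

theorem tanCone_hcone (T : Finset V) {x : V} (hx : x ∈ hcone T) :
    tanCone (hcone T) x = hcone (T.filter fun a => inner ℝ a x = 0) := by
  ext v
  have h1 : v ∈ tanCone (hcone T) x ↔ ∀ a ∈ T, ∀ᶠ ε : ℝ in 𝓝[>] 0, 0 ≤ inner ℝ a (x + ε • v) := by
    rw [mem_tanCone, ← Filter.eventually_all_finset T]
    rfl
  rw [h1]
  simp only [hcone, mem_filter, Set.mem_ofPred_eq, and_imp]
  refine forall₂_congr fun a ha => ?_
  rcases (hx a ha).eq_or_lt with h0 | h0
  · simp only [inner_add_right, ← h0, real_inner_smul_right, zero_add, true_imp_iff]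
    constructor
    · intro h
      obtain ⟨ε, h2, h3⟩ := (h.and self_mem_nhdsWithin).exists
      exact nonneg_of_mul_nonneg_right h2 h3
    · intro h
      filter_upwards [self_mem_nhdsWithin] with ε hε
      exact mul_nonneg (le_of_lt hε) h
  · refine ⟨fun _ h => absurd h h0.ne', fun _ => ?_⟩
    have : Tendsto (fun ε : ℝ => inner ℝ a (x + ε • v)) (𝓝[>] 0) (𝓝 (inner ℝ a x)) :=
      (tendsto_const_nhds (x := a)).inner (tendsto_add_smul x v)
    filter_upwards [this.eventually (lt_mem_nhds h0)] with ε h using h.le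

theorem IsConvexCone.tanCone {C : Set V} (hC : IsConvexCone C) {x : V} (hx : x ∈ C) :
    IsConvexCone (tanCone C x) := by
  obtain ⟨T, rfl⟩ := isConvexCone_iff.1 hC
  rw [tanCone_hcone T hx]
  exact isConvexCone_iff.2 ⟨_, rfl⟩

theorem IsConvexCone.subset_tanCone {C : Set V} (hC : IsConvexCone C) {x : V} (hx : x ∈ C) :
    C ⊆ ConeRing.tanCone C x := fun v hv => by
  filter_upwards [self_mem_nhdsWithin] with ε hε
  exact hC.add_mem hx (hC.smul_mem (le_of_lt hε) hv)

theorem dim_tanCone {C : Set V} (hC : IsConvexCone C) {x : V} (hx : x ∈ C) :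
    dim (tanCone C x) = dim C := by
  refine le_antisymm ?_ (dim_mono (hC.subset_tanCone hx))
  refine Submodule.finrank_mono (Submodule.span_le.2 fun v hv => ?_)
  obtain ⟨ε, h1, h2⟩ := exists_pos_of_mem_tanCone hv
  have : v = (ε⁻¹ : ℝ) • ((x + ε • v) - x) := by
    rw [add_sub_cancel_left, smul_smul, inv_mul_cancel₀ (ne_of_gt h2), one_smul]
  rw [this]
  exact Submodule.smul_mem _ _ (Submodule.sub_mem _ (Submodule.subset_span h1)
    (Submodule.subset_span hx))

theorem zero_mem_relint_tanCone {C : Set V} (hC : IsConvexCone C) {x : V} (hx : x ∈ C) :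
    (0 : V) ∈ relint (tanCone C x) ↔ x ∈ relint C := by
  constructor
  · rintro ⟨-, h⟩
    refine ⟨hx, fun y hy => ?_⟩
    obtain ⟨ε, hε, h'⟩ := h y (hC.subset_tanCone hx hy)
    obtain ⟨η, h1, h2⟩ := exists_pos_of_mem_tanCone h'
    refine ⟨η * ε, mul_pos h2 hε, ?_⟩
    rw [zero_sub, smul_neg, smul_smul, ← sub_eq_add_neg] at h1
    exact h1
  · rintro ⟨-, h⟩
    refine ⟨(hC.tanCone hx).zero_mem, fun y hy => ?_⟩
    obtain ⟨η, h1, h2⟩ := exists_pos_of_mem_tanCone hy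
    obtain ⟨ε, hε, h3⟩ := h _ h1
    refine ⟨ε * η, mul_pos hε h2, mem_tanCone_of_convex hC.convex hx one_pos ?_⟩
    have : x + (1 : ℝ) • (0 - (ε * η) • y) = (x - ε • (x + η • y)) + ε • x := by module
    rw [this]
    exact hC.add_mem h3 (hC.smul_mem hε.le hx)

theorem tanCone_eq_empty {C : Set V} (hC : IsClosed C) {x : V} (hx : x ∉ C) : tanCone C x = ∅ := by
  rw [Set.eq_empty_iff_forall_notMem]
  intro v hv
  exact hx (hC.mem_of_tendsto (tendsto_add_smul x v) hv)

theorem signedInterior_apply (C : Set V) (x : V) :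
    signedInterior C x = (-1 : ℤ) ^ dim C * ind (relint C) x := by
  rw [signedInterior, Pi.smul_apply, smul_eq_mul]

theorem signedInterior_of_notMem {C : Set V} {x : V} (hx : x ∉ C) : signedInterior C x = 0 := by
  rw [signedInterior_apply, ind_of_notMem fun h => hx h.1, mul_zero]

/-- The value at `x` of the signed interior of a convex cone only depends on the tangent cone
at `x`. -/
theorem signedInterior_tanCone {C : Set V} (hC : IsConvexCone C) (x : V) :
    signedInterior (tanCone C x) 0 = signedInterior C x := by
  by_cases hx : x ∈ C
  · rw [signedInterior_apply, signedInterior_apply, dim_tanCone hC hx]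
    by_cases h : x ∈ relint C
    · rw [ind_of_mem h, ind_of_mem ((zero_mem_relint_tanCone hC hx).2 h)]
    · rw [ind_of_notMem h, ind_of_notMem fun h' => h ((zero_mem_relint_tanCone hC hx).1 h')]
  · rw [signedInterior_of_notMem hx, tanCone_eq_empty hC.isClosed hx,
      signedInterior_of_notMem (Set.notMem_empty _)]

theorem tanCone_convexHull (w : Finset V) {x : V} (hx : x ∈ convexHull ℝ (w : Set V)) :
    tanCone (convexHull ℝ (w : Set V)) x = pc (fun p => p - x) w := by
  ext v
  constructor
  · intro hv
    obtain ⟨ε, h1, h2⟩ := exists_pos_of_mem_tanCone hv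
    rw [Finset.mem_convexHull'] at h1
    obtain ⟨c, hc, hc1, hcx⟩ := h1
    refine ⟨fun p => ε⁻¹ * c p, fun p hp => mul_nonneg (inv_nonneg.2 h2.le) (hc p hp), ?_⟩
    simp only [mul_smul, ← smul_sum, smul_sub, sum_sub_distrib, ← sum_smul, hc1, hcx, one_smul]
    rw [← smul_sub, add_sub_cancel_left, smul_smul, inv_mul_cancel₀ h2.ne', one_smul]
  · rintro ⟨c, hc, rfl⟩
    set r := 1 + ∑ p ∈ w, c p with hr
    have hs : 0 ≤ ∑ p ∈ w, c p := sum_nonneg hc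
    have hr0 : 0 < r := by linarith
    refine mem_tanCone_of_convex (convex_convexHull ℝ _) hx (inv_pos.2 hr0) ?_
    have : x + r⁻¹ • ∑ p ∈ w, c p • (p - x) = r⁻¹ • x + ∑ p ∈ w, (r⁻¹ * c p) • p := by
      simp only [mul_smul, ← smul_sum, smul_sub, sum_sub_distrib, ← sum_smul]
      have h2 : x = r⁻¹ • (1 + ∑ p ∈ w, c p) • x := by
        rw [← hr, smul_smul, inv_mul_cancel₀ hr0.ne', one_smul]
      nth_rw 1 [h2]
      module
    rw [this]
    have hsum : r⁻¹ + ∑ p ∈ w, r⁻¹ * c p = 1 := by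
      rw [← mul_sum, ← mul_one_add, ← hr, inv_mul_cancel₀ hr0.ne']
    have := (convex_convexHull ℝ (w : Set V)).sum_mem (t := insertNone w)
      (w := fun o => o.elim r⁻¹ fun p => r⁻¹ * c p) (z := fun o => o.elim x id) ?_ ?_ ?_
    · simpa [sum_insertNone] using this
    · rintro (_ | p) hp
      · exact (inv_pos.2 hr0).le
      · exact mul_nonneg (inv_pos.2 hr0).le (hc p (by simpa using hp))
    · simpa [sum_insertNone] using hsum
    · rintro (_ | p) hp
      · exact hx
      · exact subset_convexHull ℝ _ (by simpa using hp)

end Tangent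
end ConeRing

namespace ConeRing
open Finset Filter Topology

/-! ### The interior operator on PL manifolds -/

section Manifold
variable {V W : Type*} [NormedAddCommGroup V] [InnerProductSpace ℝ V] [FiniteDimensional ℝ V]
  [NormedAddCommGroup W] [InnerProductSpace ℝ W] [FiniteDimensional ℝ W]

/-- The germ of a piecewise linear map at a point is conewise linear. -/
theorem IsPLOn.exists_germ {f : V → W} {A : Set V} (hf : IsPLOn f A) {x : V} (hx : x ∈ A) :
    ∃ s : Finset (Set V), (∀ Q ∈ s, IsConvexCone Q) ∧ (∀ v ∈ tanCone A x, ∃ Q ∈ s, v ∈ Q) ∧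
      ∀ Q ∈ s, ∃ g : V →ₗ[ℝ] W, ∀ v ∈ tanCone A x ∩ Q,
        ∀ᶠ ε : ℝ in 𝓝[>] 0, f (x + ε • v) = f x + ε • g v := by
  classical
  obtain ⟨U, hU, T, hT, hQ, hcov, haff⟩ := hf x hx
  have hconv : ∀ Q ∈ T, Convex ℝ Q := by
    intro Q h
    obtain ⟨w, rfl⟩ := hQ Q h
    exact convex_convexHull ℝ _
  have hclosed : ∀ Q ∈ T, IsClosed Q := by
    intro Q h
    obtain ⟨w, rfl⟩ := hQ Q h
    exact w.finite_toSet.isClosed_convexHull ℝ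
  have hgerm : ∀ v ∈ tanCone A x, ∀ᶠ ε : ℝ in 𝓝[>] 0, x + ε • v ∈ A ∩ U := fun v hv =>
    (mem_tanCone.1 hv).and ((tendsto_add_smul x v).eventually hU)
  refine ⟨(hT.toFinset.filter (x ∈ ·)).image (tanCone · x), ?_, ?_, ?_⟩
  · intro Q' h
    simp only [mem_image, mem_filter, Set.Finite.mem_toFinset] at h
    obtain ⟨Q, ⟨hQT, hxQ⟩, rfl⟩ := h
    obtain ⟨w, rfl⟩ := hQ Q hQT
    rw [tanCone_convexHull w hxQ]
    exact isConvexCone_pc _ _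
  · intro v hv
    obtain ⟨Q, h1, h2, h3⟩ := tanCone_biUnion hT.toFinset id (fun Q h => hconv Q (by simpa using h))
      (fun Q h => hclosed Q (by simpa using h)) x (v := v) (by
        rw [mem_tanCone]
        filter_upwards [hgerm v hv] with ε h
        have := hcov h
        simpa [Set.mem_sUnion] using this)
    exact ⟨tanCone Q x, mem_image_of_mem _ (mem_filter.2 ⟨h1, h2⟩), h3⟩
  · intro Q' h
    simp only [mem_image, mem_filter, Set.Finite.mem_toFinset] at h
    obtain ⟨Q, ⟨hQT, hxQ⟩, rfl⟩ := h
    obtain ⟨g, hg⟩ := haff Q hQT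
    refine ⟨g.linear, fun v hv => ?_⟩
    have hgx : f x = g x := hg ⟨⟨hx, mem_of_mem_nhds hU⟩, hxQ⟩
    filter_upwards [hgerm v hv.1, mem_tanCone.1 hv.2] with ε h1 h2
    rw [hg ⟨h1, h2⟩, hgx, add_comm x, ← vadd_eq_add, AffineMap.map_vadd, map_smul, vadd_eq_add,
      add_comm]

theorem isConvexCone_biInter {κ : Type*} (t : Finset κ) (K : κ → Set V)
    (hK : ∀ a ∈ t, IsConvexCone (K a)) : IsConvexCone (⋂ a ∈ t, K a) := by
  classical
  induction t using Finset.induction_on with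
  | empty => simpa using isConvexCone_univ
  | insert a t ha ih =>
    rw [set_biInter_insert]
    exact (hK a (mem_insert_self a t)).inter (ih fun b hb => hK b (mem_insert_of_mem hb))

theorem kc_biInter {κ : Type*} {k : ℕ} {t : Finset κ} (ht : t.Nonempty) (K : κ → Set V)
    (hK : ∀ a ∈ t, KC k (K a)) : KC k (⋂ a ∈ t, K a) :=
  ⟨isConvexCone_biInter t K fun a ha => (hK a ha).1,
    (dim_mono (Set.biInter_subset_of_mem ht.choose_spec)).trans (hK _ ht.choose_spec).2⟩

theorem ind_biUnion_mem_Sig {κ : Type*} {k : ℕ} (s : Finset κ) (K : κ → Set V)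
    (hK : ∀ a ∈ s, KC k (K a)) : ind (⋃ a ∈ s, K a) ∈ Sig V k := by
  rw [ind_biUnion]
  refine AddSubgroup.sum_mem _ fun t ht => AddSubgroup.zsmul_mem _ (ind_mem_Sig ?_) _
  obtain ⟨hts, hne⟩ := mem_filter.1 ht
  exact kc_biInter hne K fun a ha => hK a (mem_powerset.1 hts ha)

/-- The signed interior of a finite union of convex cones, by inclusion-exclusion. -/
theorem interiorSig_biUnion {κ : Type*} {k : ℕ} (s : Finset κ) (K : κ → Set V)
    (hK : ∀ a ∈ s, KC k (K a)) (h : ind (⋃ a ∈ s, K a) ∈ Sig V k) (x : V) :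
    (interiorSig V k ⟨ind (⋃ a ∈ s, K a), h⟩ : V → ℤ) x =
      ∑ t ∈ s.powerset with t.Nonempty,
        (-1 : ℤ) ^ (t.card + 1) * signedInterior (⋂ a ∈ t, K a) x := by
  have hKt : ∀ t ∈ s.powerset.filter (·.Nonempty), KC k (⋂ a ∈ t, K a) := by
    intro t ht
    obtain ⟨hts, hne⟩ := mem_filter.1 ht
    exact kc_biInter hne K fun a ha => hK a (mem_powerset.1 hts ha)
  have e : (⟨ind (⋃ a ∈ s, K a), h⟩ : Sig V k) =
      ∑ t ∈ (s.powerset.filter (·.Nonempty)).attach, (-1 : ℤ) ^ (t.1.card + 1) •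
        (⟨ind (⋂ a ∈ t.1, K a), ind_mem_Sig (hKt t.1 t.2)⟩ : Sig V k) := by
    apply Subtype.ext
    rw [AddSubgroup.val_finsetSum]
    simp only [AddSubgroup.coe_zsmul]
    rw [sum_attach (s.powerset.filter (·.Nonempty))
      fun t => (-1 : ℤ) ^ (t.card + 1) • ind (⋂ a ∈ t, K a)]
    exact ind_biUnion s K
  rw [e, map_sum, AddSubgroup.val_finsetSum, Finset.sum_apply]
  rw [← sum_attach (s.powerset.filter (·.Nonempty))]
  refine sum_congr rfl fun t _ => ?_
  rw [map_zsmul, interiorSig_ind (hKt t.1 t.2)]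
  rfl

theorem IsConvexCone.exists_sub_of_mem_span {C : Set V} (hC : IsConvexCone C) {x : V}
    (hx : x ∈ Submodule.span ℝ C) : ∃ p ∈ C, ∃ q ∈ C, x = p - q := by
  induction hx using Submodule.span_induction with
  | mem x h => exact ⟨x, h, 0, hC.zero_mem, by simp⟩
  | zero => exact ⟨0, hC.zero_mem, 0, hC.zero_mem, by simp⟩
  | add x y _ _ h1 h2 =>
    obtain ⟨p, hp, q, hq, rfl⟩ := h1
    obtain ⟨p', hp', q', hq', rfl⟩ := h2
    exact ⟨p + p', hC.add_mem hp hp', q + q', hC.add_mem hq hq', by abel⟩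
  | smul c x _ h1 =>
    obtain ⟨p, hp, q, hq, rfl⟩ := h1
    rcases le_total 0 c with hc | hc
    · exact ⟨c • p, hC.smul_mem hc hp, c • q, hC.smul_mem hc hq, smul_sub _ _ _⟩
    · refine ⟨(-c) • q, hC.smul_mem (neg_nonneg.2 hc) hq, (-c) • p,
        hC.smul_mem (neg_nonneg.2 hc) hp, ?_⟩
      module

theorem IsConvexCone.injOn_span {C : Set V} (hC : IsConvexCone C) {φ : V →ₗ[ℝ] W}
    (h : Set.InjOn φ C) : Set.InjOn φ (Submodule.span ℝ C) := by
  intro x hx y hy e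
  obtain ⟨p, hp, q, hq, hpq⟩ :=
    hC.exists_sub_of_mem_span (Submodule.sub_mem _ hx hy)
  have h1 : φ (p - q) = 0 := by rw [← hpq, map_sub, e, sub_self]
  rw [map_sub, sub_eq_zero] at h1
  rw [h hp hq h1, sub_self, sub_eq_zero] at hpq
  exact hpq

theorem signedInterior_image_zero {C : Set V} (hC : IsConvexCone C) {φ : V →ₗ[ℝ] W}
    (h : Set.InjOn φ C) : signedInterior (φ '' C) 0 = signedInterior C 0 := by
  have hs := hC.injOn_span h
  rw [signedInterior_apply, signedInterior_apply, dim_image_of_injOn hs, relint_image_of_injOn hs]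
  congr 1
  by_cases h0 : (0 : V) ∈ relint C
  · rw [ind_of_mem h0, ind_of_mem (show (0 : W) ∈ φ '' relint C from ⟨0, h0, map_zero φ⟩)]
  · rw [ind_of_notMem h0, ind_of_notMem]
    rintro ⟨x, hx, hx0⟩
    have : x = 0 := h hx.1 hC.zero_mem (hx0.trans (map_zero φ).symm)
    exact h0 (this ▸ hx)

/-- The value at the origin of the signed interior is invariant under injective conewise linear
maps. -/
theorem interiorSig_conewise_zero {κ : Type*} {k l : ℕ} (s : Finset κ) (K : κ → Set V)
    (hK : ∀ a ∈ s, KC k (K a)) (h : ind (⋃ a ∈ s, K a) ∈ Sig V k) (F : V → W)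
    (G : κ → V →ₗ[ℝ] W) (hFG : ∀ a ∈ s, Set.EqOn F (G a) (K a))
    (hF : Set.InjOn F (⋃ a ∈ s, K a)) (hl : ∀ a ∈ s, KC l (G a '' K a))
    (h' : ind (F '' ⋃ a ∈ s, K a) ∈ Sig W l) :
    (interiorSig W l ⟨ind (F '' ⋃ a ∈ s, K a), h'⟩ : W → ℤ) 0 =
      (interiorSig V k ⟨ind (⋃ a ∈ s, K a), h⟩ : V → ℤ) 0 := by
  have e : F '' (⋃ a ∈ s, K a) = ⋃ a ∈ s, G a '' K a := by
    rw [Set.image_iUnion₂]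
    exact Set.iUnion₂_congr fun a ha => (hFG a ha).image_eq
  have h'' : ind (⋃ a ∈ s, G a '' K a) ∈ Sig W l := e ▸ h'
  have e' : (⟨_, h'⟩ : Sig W l) = ⟨_, h''⟩ := Subtype.ext (congrArg ind e)
  rw [e', interiorSig_biUnion s (fun a => G a '' K a) hl h'', interiorSig_biUnion s K hK h]
  refine sum_congr rfl fun t ht => ?_
  obtain ⟨hts, hne⟩ := mem_filter.1 ht
  rw [mem_powerset] at hts
  have hsub : ∀ a ∈ t, K a ⊆ ⋃ a ∈ s, K a := fun a ha => Set.subset_biUnion_of_mem (hts ha)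
  obtain ⟨a₀, ha₀⟩ := hne
  have hsub₀ : (⋂ a ∈ t, K a) ⊆ K a₀ := Set.biInter_subset_of_mem ha₀
  have e1 : (⋂ a ∈ t, G a '' K a) = G a₀ '' ⋂ a ∈ t, K a := by
    rw [← ((hFG a₀ (hts ha₀)).mono hsub₀).image_eq]
    ext y
    simp only [Set.mem_iInter, Set.mem_image]
    constructor
    · intro hy
      obtain ⟨x, hx, rfl⟩ := hy a₀ ha₀
      refine ⟨x, fun a ha => ?_, hFG a₀ (hts ha₀) hx⟩
      obtain ⟨x', hx', hxx⟩ := hy a ha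
      rw [← hFG a (hts ha) hx', ← hFG a₀ (hts ha₀) hx] at hxx
      rwa [← hF (hsub a ha hx') (hsub a₀ ha₀ hx) hxx]
    · rintro ⟨x, hx, rfl⟩ a ha
      exact ⟨x, hx a ha, (hFG a (hts ha) (hx a ha)).symm⟩
  rw [e1, signedInterior_image_zero (isConvexCone_biInter t K fun a ha => (hK a (hts ha)).1)]
  intro x hx y hy hxy
  rw [← hFG a₀ (hts ha₀) (hsub₀ hx), ← hFG a₀ (hts ha₀) (hsub₀ hy)] at hxy
  exact hF (hsub a₀ ha₀ (hsub₀ hx)) (hsub a₀ ha₀ (hsub₀ hy)) hxy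

theorem interiorSig_univ_zero {m : ℕ} (h : ind (Set.univ : Set (E m)) ∈ Sig (E m) m) :
    (interiorSig (E m) m ⟨ind Set.univ, h⟩ : E m → ℤ) 0 = (-1) ^ m := by
  have hK : KC m (Set.univ : Set (E m)) := kc isConvexCone_univ
  rw [interiorSig_ind hK]
  change signedInterior Set.univ 0 = _
  rw [signedInterior_apply, ind_of_mem, mul_one, dim, Submodule.span_univ, finrank_top]
  · simp
  · exact ⟨Set.mem_univ _, fun y _ => ⟨1, one_pos, Set.mem_univ _⟩⟩

/-- The interior operator multiplies the characteristic function of a PL manifold without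
boundary of dimension `m` by `(-1) ^ m`: at a point `x` of the manifold, a PL chart induces a
conewise linear bijection of the tangent cone at `x` onto `ℝ^m`. -/
theorem interiorSig_of_isPLManifold {κ : Type*} {k m : ℕ} (s : Finset κ) (K : κ → Set V)
    (hK : ∀ a ∈ s, KC k (K a)) (h : ind (⋃ a ∈ s, K a) ∈ Sig V k)
    (hM : IsPLManifold m (⋃ a ∈ s, K a)) :
    interiorSig V k ⟨ind (⋃ a ∈ s, K a), h⟩ = (-1 : ℤ) ^ m • ⟨ind (⋃ a ∈ s, K a), h⟩ := by
  classical
  apply Subtype.ext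
  ext x
  change _ = (-1 : ℤ) ^ m • ind (⋃ a ∈ s, K a) x
  by_cases hx : x ∈ ⋃ a ∈ s, K a
  swap
  · rw [ind_of_notMem hx, smul_zero, interiorSig_biUnion s K hK h]
    refine sum_eq_zero fun t ht => ?_
    obtain ⟨hts, a, ha⟩ := mem_filter.1 ht
    rw [signedInterior_of_notMem, mul_zero]
    intro hxt
    exact hx (Set.mem_biUnion (mem_powerset.1 hts ha) (Set.mem_iInter₂.1 hxt a ha))
  rw [ind_of_mem hx, smul_eq_mul, mul_one]
  obtain ⟨O, hO, hxO, O', hO', f, g, hfg, hinv, hf, hg⟩ := hM x hx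
  set M := ⋃ a ∈ s, K a with hMdef
  set A := M ∩ O with hA
  have hxA : x ∈ A := ⟨hx, hxO⟩
  have htan : ∀ v, v ∈ tanCone M x → v ∈ tanCone A x := fun v hv =>
    (mem_tanCone.1 hv).and ((tendsto_add_smul x v).eventually (hO.mem_nhds hxO))
  obtain ⟨sQ, hsQ, hcov, hgerm⟩ := hf.exists_germ hxA
  choose! G hG using hgerm
  -- the differential of the chart along the tangent cone
  obtain ⟨F, hF⟩ : ∃ F : V → E m, ∀ Q ∈ sQ, ∀ v ∈ tanCone M x ∩ Q, F v = G Q v := by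
    refine ⟨fun v => limUnder (𝓝[>] (0 : ℝ)) fun ε => ε⁻¹ • (f (x + ε • v) - f x),
      fun Q hQ v hv => Tendsto.limUnder_eq ?_⟩
    refine tendsto_const_nhds.congr' ?_
    filter_upwards [hG Q hQ v ⟨htan v hv.1, hv.2⟩, self_mem_nhdsWithin] with ε h1 h2
    rw [h1, add_sub_cancel_left, smul_smul, inv_mul_cancel₀ (ne_of_gt h2), one_smul]
  have hF' : ∀ v ∈ tanCone M x, ∀ᶠ ε : ℝ in 𝓝[>] 0, f (x + ε • v) = f x + ε • F v := by
    intro v hv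
    obtain ⟨Q, hQ, hvQ⟩ := hcov v (htan v hv)
    rw [hF Q hQ v ⟨hv, hvQ⟩]
    exact hG Q hQ v ⟨htan v hv, hvQ⟩
  have hinj : Set.InjOn F (tanCone M x) := by
    intro v hv w hw e
    obtain ⟨ε, ⟨⟨⟨h1, h2⟩, h3⟩, h4⟩, h5⟩ := ((((hF' v hv).and (hF' w hw)).and
      (mem_tanCone.1 (htan v hv))).and (mem_tanCone.1 (htan w hw))).and
        self_mem_nhdsWithin |>.exists
    have h6 := hfg.injOn h3 h4 (by rw [h1, h2, e])
    have h7 : ε • v = ε • w := add_left_cancel h6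
    exact smul_right_injective V (ne_of_gt h5) h7
  -- a preimage of `u` is the differential of the inverse chart in direction `u`
  have hsurj : F '' tanCone M x = Set.univ := by
    rw [Set.eq_univ_iff_forall]
    intro u
    have hy : f x ∈ O' := hfg.mapsTo hxA
    have hu : u ∈ tanCone O' (f x) := (tendsto_add_smul (f x) u).eventually (hO'.mem_nhds hy)
    obtain ⟨s', -, hcov', hgerm'⟩ := hg.exists_germ hy
    obtain ⟨Q, hQ, huQ⟩ := hcov' u hu
    obtain ⟨B, hB⟩ := hgerm' Q hQ
    have hgx : g (f x) = x := hinv.1 hxA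
    have hmem : ∀ y ∈ O', g y ∈ A := fun y hy => by
      obtain ⟨z, hz, rfl⟩ := hfg.surjOn hy
      rwa [hinv.1 hz]
    have h1 : ∀ᶠ ε : ℝ in 𝓝[>] 0, x + ε • B u ∈ A ∧ f (x + ε • B u) = f x + ε • u := by
      filter_upwards [hB u ⟨hu, huQ⟩, mem_tanCone.1 hu] with ε h2 h3
      rw [hgx] at h2
      rw [← h2]
      exact ⟨hmem _ h3, hinv.2 h3⟩
    have hv : B u ∈ tanCone M x := h1.mono fun ε h => h.1.1
    refine ⟨B u, hv, ?_⟩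
    obtain ⟨ε, ⟨h2, h3⟩, h4⟩ := (h1.and (hF' _ hv)).and self_mem_nhdsWithin |>.exists
    rw [h2.2] at h3
    exact (smul_right_injective _ (ne_of_gt h4) (add_left_cancel h3)).symm
  -- the value at `x` is computed in the tangent cone
  set s' := s.filter (x ∈ K ·) with hs'
  have hTK : ∀ a ∈ s', KC k (tanCone (K a) x) := fun a ha => by
    obtain ⟨h1, h2⟩ := mem_filter.1 ha
    exact ⟨(hK a h1).1.tanCone h2, (dim_tanCone (hK a h1).1 h2).trans_le (hK a h1).2⟩
  have hTM : tanCone M x = ⋃ a ∈ s', tanCone (K a) x := by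
    ext v
    constructor
    · intro hv
      obtain ⟨a, h1, h2, h3⟩ := tanCone_biUnion s K (fun a ha => (hK a ha).1.convex)
        (fun a ha => (hK a ha).1.isClosed) x hv
      exact Set.mem_biUnion (mem_filter.2 ⟨h1, h2⟩) h3
    · intro hv
      obtain ⟨a, ha, hva⟩ := Set.mem_iUnion₂.1 hv
      exact (mem_tanCone.1 hva).mono fun ε h => Set.mem_biUnion (mem_filter.1 ha).1 h
  have hT := ind_biUnion_mem_Sig s' (fun a => tanCone (K a) x) hTK
  have step1 : (interiorSig V k ⟨ind M, h⟩ : V → ℤ) x =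
      (interiorSig V k ⟨ind (⋃ a ∈ s', tanCone (K a) x), hT⟩ : V → ℤ) 0 := by
    rw [interiorSig_biUnion s K hK h, interiorSig_biUnion s' _ hTK hT]
    symm
    refine (sum_subset (fun t ht => ?_) fun t ht ht' => ?_).trans (sum_congr rfl fun t ht => ?_)
    · rw [mem_filter, mem_powerset] at ht ⊢
      exact ⟨ht.1.trans (filter_subset _ _), ht.2⟩
    · rw [mem_filter, mem_powerset] at ht ht'
      rw [← tanCone_biInter t K x, signedInterior_tanCone
        (isConvexCone_biInter t K fun a ha => (hK a (ht.1 ha)).1), signedInterior_of_notMem, mul_zero]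
      intro hxt
      exact ht' ⟨fun a ha => mem_filter.2 ⟨ht.1 ha, Set.mem_iInter₂.1 hxt a ha⟩, ht.2⟩
    · rw [mem_filter, mem_powerset] at ht
      rw [← tanCone_biInter t K x, signedInterior_tanCone
        (isConvexCone_biInter t K fun a ha => (hK a (ht.1 ha)).1)]
  -- refine the decomposition of the tangent cone so that the differential is linear on each piece
  set K' : κ × Set V → Set V := fun p => tanCone (K p.1) x ∩ p.2 with hK'
  have hK'c : ∀ p ∈ s' ×ˢ sQ, KC k (K' p) := fun p hp => by
    obtain ⟨h1, h2⟩ := mem_product.1 hp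
    exact ⟨(hTK _ h1).1.inter (hsQ _ h2), (dim_mono Set.inter_subset_left).trans (hTK _ h1).2⟩
  have hTM' : (⋃ a ∈ s', tanCone (K a) x) = ⋃ p ∈ s' ×ˢ sQ, K' p := by
    ext v
    constructor
    · intro hv
      obtain ⟨Q, hQ, hvQ⟩ := hcov v (htan v (hTM ▸ hv))
      obtain ⟨a, ha, hva⟩ := Set.mem_iUnion₂.1 hv
      exact Set.mem_biUnion (show (a, Q) ∈ s' ×ˢ sQ from mem_product.2 ⟨ha, hQ⟩) ⟨hva, hvQ⟩
    · intro hv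
      obtain ⟨p, hp, hvp⟩ := Set.mem_iUnion₂.1 hv
      exact Set.mem_biUnion (mem_product.1 hp).1 hvp.1
  have hT' : ind (⋃ p ∈ s' ×ˢ sQ, K' p) ∈ Sig V k := hTM' ▸ hT
  have hFim : F '' (⋃ p ∈ s' ×ˢ sQ, K' p) = Set.univ := by rw [← hTM', ← hTM]; exact hsurj
  have huniv : ind (Set.univ : Set (E m)) ∈ Sig (E m) m := ind_mem isConvexCone_univ.isCone
  have step2 := interiorSig_conewise_zero (k := k) (l := m) (s' ×ˢ sQ) K' hK'c hT' F (fun p => G p.2)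
    (fun p hp v hv => hF p.2 (mem_product.1 hp).2 v ⟨by
      rw [hTM]; exact Set.mem_biUnion (mem_product.1 hp).1 hv.1, hv.2⟩)
    (by rw [← hTM', ← hTM]; exact hinj) (fun p hp => kc ((hK'c p hp).1.image _))
    (by rw [hFim]; exact huniv)
  have e1 : (⟨_, hT⟩ : Sig V k) = ⟨_, hT'⟩ := Subtype.ext (congrArg ind hTM')
  rw [step1, e1, ← step2]
  have e2 : (⟨ind (F '' ⋃ p ∈ s' ×ˢ sQ, K' p), by rw [hFim]; exact huniv⟩ : Sig (E m) m) =
      ⟨_, huniv⟩ := Subtype.ext (congrArg ind hFim)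
  rw [e2, interiorSig_univ_zero]

end Manifold
end ConeRing

namespace ConeRing
open Finset

/-! ### Classes of Euclidean cones -/

section Support
variable {V : Type*} [NormedAddCommGroup V] [InnerProductSpace ℝ V] [FiniteDimensional ℝ V]

/-- A conical constructible function of dimension at most `k` is supported in finitely many
subspaces of dimension at most `k`. -/
theorem exists_submodules_of_mem_Sig {k : ℕ} {f : V → ℤ} (hf : f ∈ Sig V k) :
    ∃ T : Finset (Submodule ℝ V), (∀ S ∈ T, Module.finrank ℝ S ≤ k) ∧
      ∀ x, f x ≠ 0 → ∃ S ∈ T, x ∈ S := by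
  classical
  induction hf using AddSubgroup.closure_induction with
  | mem f h =>
    obtain ⟨C, hC, rfl⟩ := h
    refine ⟨{Submodule.span ℝ C}, fun S hS => mem_singleton.1 hS ▸ hC.2, fun x hx => ?_⟩
    refine ⟨_, mem_singleton_self _, Submodule.subset_span ?_⟩
    by_contra h
    exact hx (ind_of_notMem h)
  | zero => exact ⟨∅, by simp, fun x hx => absurd rfl hx⟩
  | add f g _ _ hf hg =>
    obtain ⟨T, hT, hT'⟩ := hf
    obtain ⟨U, hU, hU'⟩ := hg
    refine ⟨T ∪ U, fun S hS => (mem_union.1 hS).elim (hT S) (hU S), fun x hx => ?_⟩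
    by_cases h : f x = 0
    · obtain ⟨S, hS, hxS⟩ := hU' x fun h' => hx (by simp [h, h'])
      exact ⟨S, mem_union_right _ hS, hxS⟩
    · obtain ⟨S, hS, hxS⟩ := hT' x h
      exact ⟨S, mem_union_left _ hS, hxS⟩
  | neg f _ hf =>
    obtain ⟨T, hT, hT'⟩ := hf
    exact ⟨T, hT, fun x hx => hT' x fun h => hx (by simp [h])⟩

/-- A convex cone covered by finitely many subspaces lies in one of them. -/
theorem IsConvexCone.exists_subset_of_cover {C : Set V} (hC : IsConvexCone C)
    (T : Finset (Submodule ℝ V)) (h : ∀ x ∈ C, ∃ S ∈ T, x ∈ S) :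
    ∃ S ∈ T, C ⊆ (S : Set V) := by
  classical
  induction T using Finset.induction_on with
  | empty =>
    obtain ⟨S, hS, -⟩ := h 0 hC.zero_mem
    exact absurd hS (notMem_empty S)
  | insert S T hS ih =>
    by_cases hCS : C ⊆ (S : Set V)
    · exact ⟨S, mem_insert_self S T, hCS⟩
    obtain ⟨c, hc, hcS⟩ := Set.not_subset.1 hCS
    obtain ⟨S', hS', hCS'⟩ := ih fun x hx => by
      -- two points of the half-line `x + r c` lie in the same subspace
      choose! σ hσ hσ' using h
      have hmem : ∀ r : ℕ, x + (r : ℝ) • c ∈ C := fun r =>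
        hC.add_mem hx (hC.smul_mem r.cast_nonneg hc)
      obtain ⟨r, r', hne, he⟩ := Finite.exists_ne_map_eq_of_infinite fun r : ℕ =>
        (⟨σ (x + (r : ℝ) • c), hσ _ (hmem r)⟩ : ↥(insert S T))
      have he : σ (x + (r : ℝ) • c) = σ (x + (r' : ℝ) • c) := congrArg Subtype.val he
      set U := σ (x + (r : ℝ) • c) with hU
      have h1 : x + (r : ℝ) • c ∈ U := hσ' _ (hmem r)
      have h2 : x + (r' : ℝ) • c ∈ U := he ▸ hσ' _ (hmem r')
      have h3 : ((r : ℝ) - r') • c ∈ U := by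
        have := U.sub_mem h1 h2
        rwa [add_sub_add_left_eq_sub, ← sub_smul] at this
      have h4 : c ∈ U := by
        rwa [Submodule.smul_mem_iff _ (sub_ne_zero.2 (by exact_mod_cast hne))] at h3
      have h5 : x ∈ U := by
        have := U.sub_mem h1 (U.smul_mem (r : ℝ) h4)
        rwa [add_sub_cancel_right] at this
      refine ⟨U, ?_, h5⟩
      rcases mem_insert.1 (hσ _ (hmem r)) with h6 | h6
      · exact absurd (h6 ▸ h4) hcS
      · exact h6
    exact ⟨S', mem_insert_of_mem hS', hCS'⟩

/-- A convex cone in the support of a function of dimension at most `k` has dimension at most `k`. -/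
theorem IsConvexCone.kc_of_subset_support {k : ℕ} {C : Set V} (hC : IsConvexCone C) {f : V → ℤ}
    (hf : f ∈ Sig V k) (h : ∀ x ∈ C, f x ≠ 0) : KC k C := by
  obtain ⟨T, hT, hT'⟩ := exists_submodules_of_mem_Sig hf
  obtain ⟨S, hS, hCS⟩ := hC.exists_subset_of_cover T fun x hx => hT' x (h x hx)
  exact ⟨hC, (Submodule.finrank_mono (Submodule.span_le.2 hCS)).trans (hT S hS)⟩

end Support

section Charts
variable {m n j : ℕ}

/-- Linear maps inducing the same norm on a convex cone induce the same norm on its span, by the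
parallelogram law. -/
theorem norm_eq_on_span {K : Set (E m)} (hK : IsConvexCone K) {φ ψ : E m →ₗ[ℝ] E n}
    (h : ∀ x ∈ K, ‖φ x‖ = ‖ψ x‖) {x : E m} (hx : x ∈ Submodule.span ℝ K) : ‖φ x‖ = ‖ψ x‖ := by
  obtain ⟨p, hp, q, hq, rfl⟩ := hK.exists_sub_of_mem_span hx
  have h1 := parallelogram_law_with_norm ℝ (φ p) (φ q)
  have h2 := parallelogram_law_with_norm ℝ (ψ p) (ψ q)
  rw [← map_add, ← map_sub, h p hp, h q hq, h _ (hK.add_mem hp hq)] at h1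
  rw [← map_add, ← map_sub] at h2
  have h3 : ‖φ (p - q)‖ * ‖φ (p - q)‖ = ‖ψ (p - q)‖ * ‖ψ (p - q)‖ := by linarith
  exact (mul_self_inj (norm_nonneg _) (norm_nonneg _)).1 h3

/-- The class of a function on a convex cone only depends on the Euclidean structure, not on the
linear chart inducing it. -/
theorem clsLowSig_pushSig_congr {K : Set (E m)} (hK : IsConvexCone K) {φ ψ : E m →ₗ[ℝ] E n}
    (hφ : Set.InjOn φ (Submodule.span ℝ K)) (h : ∀ x ∈ K, ‖φ x‖ = ‖ψ x‖) {f : Sig (E m) j}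
    (hf : f ∈ sigOn j K) :
    clsLowSig n j (pushSig j φ f) = clsLowSig n j (pushSig j ψ f) := by
  have hinj : LinearMap.ker (φ.domRestrict (Submodule.span ℝ K)) = ⊥ :=
    LinearMap.ker_eq_bot.2 fun x y e => Subtype.ext (hφ x.2 y.2 e)
  obtain ⟨g, hg⟩ := LinearMap.exists_leftInverse_of_injective _ hinj
  set θ : E n →ₗ[ℝ] E n := (ψ.domRestrict (Submodule.span ℝ K)).comp g with hθ
  have hθφ : ∀ x ∈ Submodule.span ℝ K, θ (φ x) = ψ x := by
    intro x hx
    have := LinearMap.congr_fun hg ⟨x, hx⟩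
    change ψ (g (φ x)) = ψ x
    exact congrArg (fun z : Submodule.span ℝ K => ψ z) this
  have hpush : pushSig j θ (pushSig j φ f) = pushSig j ψ f := by
    refine eqOn_sigOn (Φ := (pushSig j θ).comp (pushSig j φ)) (fun C hC hCK => ?_) hf
    rw [AddMonoidHom.comp_apply, pushSig_ind φ hC, pushSig_ind θ (hC.map φ), pushSig_ind ψ hC]
    refine Subtype.ext (congrArg ind ?_)
    rw [Set.image_image]
    exact Set.image_congr fun x hx => hθφ x (Submodule.subset_span (hCK hx))
  rw [← hpush]
  refine (clsLowSig_pushSig (S := (Submodule.span ℝ K).map φ) ?_ ?_).symm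
  · rintro _ ⟨x, hx, rfl⟩
    rw [hθφ x hx, norm_eq_on_span hK h hx]
  · refine sigOn_mono ?_ (pushSig_mem_sigOn hf)
    exact Set.image_mono Submodule.subset_span

end Charts

namespace EuclideanCone
variable {n : ℕ} (M : EuclideanCone n) {j : ℕ}

/-- The intersection of a family of cells. -/
def inter (S : Finset (Fin M.k)) : Set (E M.N) := ⋂ i ∈ S, M.cell i

theorem isConvexCone_inter (S : Finset (Fin M.k)) : IsConvexCone (M.inter S) :=
  isConvexCone_biInter S M.cell fun i _ => M.isConvexCone_cell i

theorem inter_subset {S : Finset (Fin M.k)} {i : Fin M.k} (hi : i ∈ S) : M.inter S ⊆ M.cell i :=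
  Set.biInter_subset_of_mem hi

theorem kc_cell (i : Fin M.k) : KC n (M.cell i) := by
  refine ⟨M.isConvexCone_cell i, ?_⟩
  rw [← dim_image_of_injOn (M.chart_injOn i)]
  exact (dim_le _).trans (by simp)

theorem carrier_eq : M.carrier = ⋃ i ∈ (univ : Finset (Fin M.k)), M.cell i := by
  simp [carrier]

theorem ind_carrier : ind M.carrier = ∑ S : {S : Finset (Fin M.k) // S.Nonempty},
    (-1 : ℤ) ^ (S.1.card + 1) • ind (M.inter S.1) := by
  rw [carrier_eq, ind_biUnion]
  exact sum_subtype _ (by simp) (fun S => (-1 : ℤ) ^ (S.card + 1) • ind (M.inter S))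

/-- The class in `L j` of a function on a Euclidean cone: it is restricted to the intersections of
cells, and these are moved to `ℝⁿ` by the charts. -/
def funClass (j : ℕ) : Sig (E M.N) j →+ L j :=
  ∑ S : {S : Finset (Fin M.k) // S.Nonempty}, (-1 : ℤ) ^ (S.1.card + 1) •
    ((clsLowSig n j).comp (pushSig j (M.chart (S.1.min' S.2)))).comp
      (resSig j (M.isConvexCone_inter S.1))

theorem funClass_apply (f : Sig (E M.N) j) : M.funClass j f =
    ∑ S : {S : Finset (Fin M.k) // S.Nonempty}, (-1 : ℤ) ^ (S.1.card + 1) •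
      clsLowSig n j (pushSig j (M.chart (S.1.min' S.2))
        (resSig j (M.isConvexCone_inter S.1) f)) := by
  rw [funClass, AddMonoidHom.finsetSum_apply]
  rfl

theorem resSig_ind {V : Type*} [NormedAddCommGroup V] [InnerProductSpace ℝ V]
    [FiniteDimensional ℝ V] {K C : Set V} (hK : IsConvexCone K) (hC : KC j C) :
    resSig j hK ⟨ind C, ind_mem_Sig hC⟩ = ⟨ind (C ∩ K), ind_mem_Sig
      ⟨hC.1.inter hK, (dim_mono Set.inter_subset_left).trans hC.2⟩⟩ :=
  Subtype.ext (ind_mul_ind C K)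

theorem cell_subset_carrier (i : Fin M.k) : M.cell i ⊆ M.carrier := Set.subset_iUnion M.cell i

theorem inter_subset_carrier {S : Finset (Fin M.k)} (hS : S.Nonempty) :
    M.inter S ⊆ M.carrier := by
  obtain ⟨i, hi⟩ := hS
  exact (M.inter_subset hi).trans (M.cell_subset_carrier i)

theorem funClass_ind_carrier (h : ind M.carrier ∈ Sig (E M.N) n) :
    M.funClass n ⟨ind M.carrier, h⟩ = M.toL := by
  rw [funClass_apply, toL]
  refine sum_congr rfl fun S _ => ?_
  congr 1
  have hS : KC n (M.inter S.1) := ⟨M.isConvexCone_inter S.1,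
    (dim_mono (M.inter_subset (S.1.min'_mem S.2))).trans (M.kc_cell _).2⟩
  have e : resSig n (M.isConvexCone_inter S.1) ⟨ind M.carrier, h⟩ =
      ⟨ind (M.inter S.1), ind_mem_Sig hS⟩ := by
    apply Subtype.ext
    rw [resSig_coe, ind_mul_ind, Set.inter_eq_right.2 (M.inter_subset_carrier S.2)]
  rw [e, pushSig_ind _ hS, clsLowSig_self]
  exact clsSig_ind (hS.1.image _).isCone

/-- On a single cell the class is computed by the chart of the cell. -/
theorem funClass_of_mem_sigOn {i : Fin M.k} {f : Sig (E M.N) j} (hf : f ∈ sigOn j (M.cell i)) :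
    M.funClass j f = clsLowSig n j (pushSig j (M.chart i) f) := by
  refine eqOn_sigOn (Ψ := (clsLowSig n j).comp (pushSig j (M.chart i))) (fun C hC hCi => ?_) hf
  rw [funClass_apply, AddMonoidHom.comp_apply]
  have hsum : (⟨ind C, ind_mem_Sig hC⟩ : Sig (E M.N) j) =
      ∑ S : {S : Finset (Fin M.k) // S.Nonempty}, (-1 : ℤ) ^ (S.1.card + 1) •
        resSig j (M.isConvexCone_inter S.1) ⟨ind C, ind_mem_Sig hC⟩ := by
    apply Subtype.ext
    rw [AddSubgroup.val_finsetSum]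
    simp only [AddSubgroup.coe_zsmul, resSig_coe, ← mul_smul_comm]
    rw [← mul_sum, ← M.ind_carrier, ind_mul_ind,
      Set.inter_eq_left.2 (hCi.trans (M.cell_subset_carrier i))]
  conv_rhs => rw [hsum, map_sum, map_sum]
  refine sum_congr rfl fun S _ => ?_
  rw [map_zsmul, map_zsmul]
  congr 1
  set i₀ := S.1.min' S.2
  have h1 : C ∩ M.inter S.1 ⊆ M.cell i₀ :=
    Set.inter_subset_right.trans (M.inter_subset (S.1.min'_mem S.2))
  have h2 : C ∩ M.inter S.1 ⊆ M.cell i := Set.inter_subset_left.trans hCi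
  refine clsLowSig_pushSig_congr (hC.1.inter (M.isConvexCone_inter S.1))
    ((M.chart_injOn i₀).mono (Submodule.span_mono h1))
    (fun x hx => M.compatible i₀ i x ⟨h1 hx, h2 hx⟩) ?_
  rw [resSig_ind (M.isConvexCone_inter S.1) hC]
  exact AddSubgroup.subset_closure ⟨C ∩ M.inter S.1,
    ⟨hC.1.inter (M.isConvexCone_inter S.1), (dim_mono Set.inter_subset_left).trans hC.2⟩,
    subset_rfl, rfl⟩

/-- The functions built from convex cones each contained in a cell. -/
def cellSig (j : ℕ) : AddSubgroup (Sig (E M.N) j) := ⨆ i, sigOn j (M.cell i)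

theorem sigOn_span {V : Type*} [NormedAddCommGroup V] [InnerProductSpace ℝ V]
    [FiniteDimensional ℝ V] {K : Set V} {f : Sig V j} (hf : f ∈ sigOn j K) :
    f ∈ sigOn j (Submodule.span ℝ K : Set V) := sigOn_mono Submodule.subset_span hf

theorem δ_funClass {f : Sig (E M.N) (j + 1)} (hf : f ∈ M.cellSig (j + 1)) :
    δ (j + 1) (M.funClass (j + 1) f) = M.funClass j (boundarySig (E M.N) j f) := by
  have : M.cellSig (j + 1) ≤ ((δ (j + 1)).comp (M.funClass (j + 1))).eqLocus
      ((M.funClass j).comp (boundarySig (E M.N) j)) := by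
    refine iSup_le fun i f hf => ?_
    change δ (j + 1) (M.funClass (j + 1) f) = M.funClass j (boundarySig (E M.N) j f)
    rw [M.funClass_of_mem_sigOn hf, M.funClass_of_mem_sigOn (boundarySig_mem_sigOn hf),
      δ_clsLowSig, pushSig_boundarySig (M.chart_injOn i) (sigOn_span hf)]
  exact this hf

theorem mulOne_t_funClass (f : Sig (E M.N) j) :
    mulOne j t (M.funClass j f) = M.funClass (j + 1) (inclSig (Nat.le_succ j) f) := by
  rw [funClass_apply, funClass_apply, map_sum]
  refine sum_congr rfl fun S _ => ?_
  rw [map_zsmul, mulOne_t_clsLowSig, ← inclSig_pushSig]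
  rfl

theorem ind_carrier_mem (h : ∀ i, KC j (M.cell i)) : ind M.carrier ∈ Sig (E M.N) j := by
  rw [carrier_eq]; exact ind_biUnion_mem_Sig _ _ fun i _ => h i

theorem ind_carrier_mem_cellSig (h : ∀ i, KC j (M.cell i)) (hM : ind M.carrier ∈ Sig (E M.N) j) :
    (⟨ind M.carrier, hM⟩ : Sig (E M.N) j) ∈ M.cellSig j := by
  have hS : ∀ S : {S : Finset (Fin M.k) // S.Nonempty}, KC j (M.inter S.1) := fun S =>
    kc_biInter S.2 M.cell fun i _ => h i
  have e : (⟨ind M.carrier, hM⟩ : Sig (E M.N) j) =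
      ∑ S : {S : Finset (Fin M.k) // S.Nonempty}, (-1 : ℤ) ^ (S.1.card + 1) •
        (⟨ind (M.inter S.1), ind_mem_Sig (hS S)⟩ : Sig (E M.N) j) := by
    apply Subtype.ext
    rw [AddSubgroup.val_finsetSum]
    exact M.ind_carrier
  rw [e]
  refine AddSubgroup.sum_mem _ fun S _ => AddSubgroup.zsmul_mem _ ?_ _
  refine AddSubgroup.mem_iSup_of_mem (S.1.min' S.2) (AddSubgroup.subset_closure
    ⟨_, hS S, M.inter_subset (S.1.min'_mem S.2), rfl⟩)

theorem interiorSig_ind_carrier {m : ℕ} (hm : M.IsInteriorManifold m) (h : ∀ i, KC j (M.cell i))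
    (hM : ind M.carrier ∈ Sig (E M.N) j) :
    interiorSig (E M.N) j ⟨ind M.carrier, hM⟩ = (-1 : ℤ) ^ m • ⟨ind M.carrier, hM⟩ := by
  have e : (⟨ind M.carrier, hM⟩ : Sig (E M.N) j) =
      ⟨ind (⋃ i ∈ (univ : Finset (Fin M.k)), M.cell i), M.carrier_eq ▸ hM⟩ :=
    Subtype.ext (congrArg ind M.carrier_eq)
  rw [e]
  exact interiorSig_of_isPLManifold univ M.cell (fun i _ => h i) _ (M.carrier_eq ▸ hm.2)

theorem funClass_ind_carrier_mem_Lplus {m : ℕ} (hm : M.IsInteriorManifold m)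
    (h : ∀ i, KC j (M.cell i)) (hM : ind M.carrier ∈ Sig (E M.N) j)
    (hmj : (-1 : ℤ) ^ m = (-1) ^ j) : M.funClass j ⟨ind M.carrier, hM⟩ ∈ Lplus j := by
  cases j with
  | zero => exact (rfl : (0 : L 0 →+ L 0) _ = 0)
  | succ j =>
    change δ (j + 1) _ = 0
    rw [M.δ_funClass (M.ind_carrier_mem_cellSig h hM)]
    have : boundarySig (E M.N) j ⟨ind M.carrier, hM⟩ = 0 := by
      apply inclSig_injective (Nat.le_succ j)
      rw [inclSig_boundarySig, M.interiorSig_ind_carrier hm h, hmj, neg_one_pow_smul_smul,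
        sub_self, map_zero]
    rw [this, map_zero]

theorem toL_mem_Lplus {m : ℕ} (hm : M.IsInteriorManifold m) (hmn : (-1 : ℤ) ^ m = (-1) ^ n) :
    M.toL ∈ Lplus n := by
  rw [← M.funClass_ind_carrier (M.ind_carrier_mem M.kc_cell)]
  exact M.funClass_ind_carrier_mem_Lplus hm M.kc_cell _ hmn

end EuclideanCone

/-- An interior manifold cone of dimension `m` with `m ≢ n + 1` modulo two has dimension at
most `n`, because the boundary operator multiplies its characteristic function by two. -/
theorem EuclideanCone.toL_mem_map_t {n m : ℕ} (M : EuclideanCone (n + 1))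
    (hm : M.IsInteriorManifold m) (hmn : (-1 : ℤ) ^ m = (-1) ^ n) :
    M.toL ∈ (Lplus n).map (mulOne n t) := by
  have hM := M.ind_carrier_mem M.kc_cell
  -- the boundary operator doubles the characteristic function, which therefore has low dimension
  have h2 : (2 : ℤ) • ind M.carrier ∈ Sig (E M.N) n := by
    have h := (boundarySig (E M.N) n ⟨ind M.carrier, hM⟩).2
    rw [boundarySig_coe, M.interiorSig_ind_carrier hm M.kc_cell, hmn, AddSubgroup.coe_zsmul,
      smul_smul, pow_succ, mul_right_comm, ← mul_pow] at h
    simpa [two_smul] using h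
  have hcell : ∀ i, KC n (M.cell i) := fun i =>
    (M.isConvexCone_cell i).kc_of_subset_support h2 fun x hx => by
      rw [Pi.smul_apply, ind_of_mem (M.cell_subset_carrier i hx)]
      decide
  have hM' := M.ind_carrier_mem hcell
  refine ⟨_, M.funClass_ind_carrier_mem_Lplus hm hcell hM' hmn, ?_⟩
  rw [M.mulOne_t_funClass, ← M.funClass_ind_carrier hM]
  rfl

theorem Lev_le_DLplus (n : ℕ) : Lev n ≤ DLplus n := by
  rw [Lev, AddSubgroup.closure_le]
  rintro _ ⟨M, m, hm, hM, rfl⟩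
  rcases n.even_or_odd' with ⟨k, rfl | rfl⟩
  · rw [DLplus_even]
    exact M.toL_mem_Lplus hM (by rw [hm.neg_one_pow, (even_two_mul k).neg_one_pow])
  · rw [DLplus_odd]
    exact M.toL_mem_map_t hM (by rw [hm.neg_one_pow, (even_two_mul k).neg_one_pow])

theorem Lod_le_Lplus (k : ℕ) : Lod (2 * k + 1) ≤ Lplus (2 * k + 1) := by
  rw [Lod, AddSubgroup.closure_le]
  rintro _ ⟨M, m, hm, hM, rfl⟩
  exact M.toL_mem_Lplus hM (by rw [hm.neg_one_pow, Odd.neg_one_pow ⟨k, rfl⟩])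

end ConeRing

namespace ConeRing
open Finset

/-! ### The boundary of a simplicial cone is a PL manifold -/

section BoundaryManifold
variable {V W : Type*} [NormedAddCommGroup V] [InnerProductSpace ℝ V] [FiniteDimensional ℝ V]
  [NormedAddCommGroup W] [InnerProductSpace ℝ W] [FiniteDimensional ℝ W]
  {ι : Type*} [Fintype ι] [DecidableEq ι]

/-- A map is piecewise linear on `A` if `A` is covered by simplicial cones, each generated by all
but one of finitely many vectors `w i`, and the map is linear on each of these. The continuous
coordinates `c` provide polytopes that cover a neighbourhood of a point. -/
theorem isPLOn_of_coordinates {A : Set V} {f : V → W} (w : ι → V) (c : V → ι → ℝ)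
    (hcont : ∀ i, Continuous fun x => c x i) (hc0 : ∀ x ∈ A, ∀ i, 0 ≤ c x i)
    (hc : ∀ x ∈ A, ∑ i, c x i • w i = x) (hcj : ∀ x ∈ A, ∃ j, c x j = 0) (G : ι → V →ₗ[ℝ] W)
    (hG : ∀ j, ∀ x ∈ A, x ∈ pc w (univ.erase j) → f x = G j x) : IsPLOn f A := by
  classical
  intro x₀ hx₀
  -- the cones are truncated at a coordinate sum exceeding that of `x₀`
  set K : ℝ := ∑ i, c x₀ i + 1 with hK
  have hK0 : 0 < K := by
    have : 0 ≤ ∑ i, c x₀ i := sum_nonneg fun i _ => hc0 x₀ hx₀ i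
    linarith
  have hopen : IsOpen {x | ∑ i, c x i < K} :=
    isOpen_lt (continuous_finsetSum _ fun i _ => hcont i) continuous_const
  let Q : ι → Finset V := fun j => insert 0 ((univ.erase j).image fun i => K • w i)
  refine ⟨{x | ∑ i, c x i < K}, hopen.mem_nhds (lt_add_one (∑ i, c x₀ i)),
    Set.range fun j => convexHull ℝ (Q j : Set V), Set.finite_range _, ?_, ?_, ?_⟩
  · rintro _ ⟨j, rfl⟩
    exact ⟨Q j, rfl⟩
  · rintro x ⟨hxA, hxK⟩
    obtain ⟨j, hj⟩ := hcj x hxA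
    refine Set.mem_sUnion.2 ⟨_, ⟨j, rfl⟩, ?_⟩
    have hxK : ∑ i, c x i < K := hxK
    have hsum : (1 - K⁻¹ * ∑ i, c x i) + ∑ i ∈ univ.erase j, K⁻¹ * c x i = 1 := by
      rw [← mul_sum, ← add_sum_erase univ (c x) (mem_univ j), hj, zero_add]
      ring
    have := (convex_convexHull ℝ (Q j : Set V)).sum_mem (t := insertNone (univ.erase j))
      (w := fun o => o.elim (1 - K⁻¹ * ∑ i, c x i) fun i => K⁻¹ * c x i)
      (z := fun o => o.elim 0 fun i => K • w i) ?_ ?_ ?_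
    · simp only [sum_insertNone, Option.elim_none, Option.elim_some, smul_zero, zero_add,
        smul_smul] at this
      have e : ∑ i ∈ univ.erase j, (K⁻¹ * c x i * K) • w i = x := by
        conv_rhs => rw [← hc x hxA, ← add_sum_erase univ _ (mem_univ j), hj, zero_smul, zero_add]
        refine sum_congr rfl fun i _ => ?_
        congr 1
        field_simp
      rwa [e] at this
    · rintro (_ | i) hi
      · change 0 ≤ 1 - K⁻¹ * ∑ i, c x i
        rw [sub_nonneg, inv_mul_le_iff₀ hK0, mul_one]
        exact hxK.le
      · exact mul_nonneg (inv_nonneg.2 hK0.le) (hc0 x hxA i)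
    · simpa [sum_insertNone] using hsum
    · rintro (_ | i) hi
      · exact subset_convexHull ℝ _ (by simp [Q])
      · refine subset_convexHull ℝ _ (mem_coe.2 (mem_insert_of_mem ?_))
        exact mem_image_of_mem (fun i => K • w i) (by simpa using hi)
  · rintro _ ⟨j, rfl⟩
    refine ⟨(G j).toAffineMap, ?_⟩
    rintro x ⟨⟨hxA, -⟩, hxQ⟩
    refine hG j x hxA ?_
    refine convexHull_min ?_ (isConvexCone_pc w _).convex hxQ
    intro y hy
    rcases mem_insert.1 (mem_coe.1 hy) with rfl | hy
    · exact (isConvexCone_pc w _).zero_mem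
    · obtain ⟨i, hi, rfl⟩ := mem_image.1 hy
      exact (isConvexCone_pc w _).smul_mem hK0.le (mem_pc_self hi)

/-- Linear coordinates for a linearly independent family. -/
theorem exists_dual_family {u : ι → V} (hu : LinearIndependent ℝ u) :
    ∃ c : V →ₗ[ℝ] ι → ℝ, ∀ a : ι → ℝ, c (∑ i, a i • u i) = a := by
  let T : (ι → ℝ) →ₗ[ℝ] V := Fintype.linearCombination ℝ u
  obtain ⟨c, hc⟩ := LinearMap.exists_leftInverse_of_injective T
    (LinearMap.ker_eq_bot.2 hu.fintypeLinearCombination_injective)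
  exact ⟨c, fun a => LinearMap.congr_fun hc a⟩

variable {r : ℕ}

/-- The coordinates `(0, y₁, …, y_r)`. -/
def consZero (r : ℕ) : E r →ₗ[ℝ] Fin (r + 1) → ℝ where
  toFun y := Fin.cons 0 y
  map_add' y z := by
    ext i; refine Fin.cases ?_ (fun i => ?_) i <;> simp
  map_smul' a y := by
    ext i; refine Fin.cases ?_ (fun i => ?_) i <;> simp

/-- The smallest of the numbers `0, y₁, …, y_r`. -/
def minZero (y : E r) : ℝ := univ.inf' univ_nonempty (consZero r y)

theorem minZero_le (y : E r) (i : Fin (r + 1)) : minZero y ≤ consZero r y i :=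
  inf'_le _ (mem_univ i)

theorem exists_minZero (y : E r) : ∃ i, consZero r y i = minZero y := by
  obtain ⟨i, -, hi⟩ := exists_mem_eq_inf' univ_nonempty (consZero r y)
  exact ⟨i, hi.symm⟩

theorem continuous_consZero (i : Fin (r + 1)) : Continuous fun y : E r => consZero r y i :=
  (continuous_apply i).comp (consZero r).continuous_of_finiteDimensional

theorem continuous_minZero : Continuous (minZero : E r → ℝ) :=
  Continuous.finset_inf'_apply univ_nonempty fun i _ => continuous_consZero i

/-- The boundary of a simplicial cone with `r + 1` generators is a PL manifold of dimension `r`: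
differences of the coordinates give a PL homeomorphism to `ℝ^r`. -/
theorem isPLManifold_boundary {u : Fin (r + 1) → V} (hu : LinearIndependent ℝ u) :
    IsPLManifold r (⋃ i, pc u (univ.erase i)) := by
  obtain ⟨c, hc⟩ := exists_dual_family hu
  set M := ⋃ i, pc u (univ.erase i) with hM
  have hmem : ∀ x, x ∈ M ↔ (∀ i, 0 ≤ c x i) ∧ (∃ j, c x j = 0) ∧ ∑ i, c x i • u i = x := by
    intro x
    rw [hM, Set.mem_iUnion]
    constructor
    · rintro ⟨j, hj⟩
      obtain ⟨a, ha, haj, rfl⟩ := (mem_pc_of_subset (erase_subset j univ)).1 hj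
      rw [hc]
      exact ⟨ha, ⟨j, haj j (by simp)⟩, rfl⟩
    · rintro ⟨h1, ⟨j, hj⟩, h2⟩
      refine ⟨j, (mem_pc_of_subset (erase_subset j univ)).2 ⟨c x, h1, fun i hi => ?_, h2⟩⟩
      have : i = j := by simpa using hi
      rw [this, hj]
  have hcface : ∀ j, ∀ x ∈ pc u (univ.erase j), c x j = 0 := by
    intro j x hx
    obtain ⟨a, ha, haj, rfl⟩ := (mem_pc_of_subset (erase_subset j univ)).1 hx
    rw [hc]
    exact haj j (by simp)
  let f : V →ₗ[ℝ] E r :=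
    { toFun := fun x => WithLp.toLp 2 fun i => c x i.succ - c x 0
      map_add' := fun x y => by ext i; simp; ring
      map_smul' := fun a x => by ext i; simp; ring }
  have hf : ∀ x i, f x i = c x (Fin.succ i) - c x 0 := fun x i => rfl
  have hfc : ∀ x i, consZero r (f x) i = c x i - c x 0 := by
    intro x i
    refine Fin.cases ?_ (fun i => ?_) i
    · simp [consZero]
    · simp [consZero, hf]
  -- the inverse restores the common shift of the coordinates that makes the smallest one zero
  let g : E r → V := fun y => ∑ i, (consZero r y i - minZero y) • u i
  have hcg : ∀ y, c (g y) = fun i => consZero r y i - minZero y := fun y => hc _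
  have hgM : ∀ y, g y ∈ M := by
    intro y
    rw [hmem, hcg]
    refine ⟨fun i => sub_nonneg.2 (minZero_le y i), ?_, rfl⟩
    obtain ⟨j, hj⟩ := exists_minZero y
    exact ⟨j, sub_eq_zero.2 hj⟩
  have hgf : ∀ x ∈ M, g (f x) = x := by
    intro x hx
    obtain ⟨h1, ⟨j, hj⟩, h2⟩ := (hmem x).1 hx
    have hmin : minZero (f x) = - c x 0 := by
      refine le_antisymm ?_ ?_
      · have := minZero_le (f x) j
        rwa [hfc, hj, zero_sub] at this
      · obtain ⟨i, hi⟩ := exists_minZero (f x)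
        rw [← hi, hfc]
        linarith [h1 i]
    conv_rhs => rw [← h2]
    refine sum_congr rfl fun i _ => ?_
    rw [hmin, hfc]
    congr 1
    ring
  have hfg : ∀ y, f (g y) = y := by
    intro y
    ext i
    rw [hf, hcg]
    simp [consZero]
  have hinv : Set.InvOn g f (M ∩ Set.univ) Set.univ := ⟨fun x hx => hgf x hx.1, fun y _ => hfg y⟩
  refine fun x _ => ⟨Set.univ, isOpen_univ, Set.mem_univ x, Set.univ, isOpen_univ, f, g,
    hinv.bijOn (Set.mapsTo_univ _ _) (fun y _ => ⟨hgM y, Set.mem_univ _⟩), hinv, ?_, ?_⟩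
  · refine isPLOn_of_coordinates u (fun x => c x)
      (fun i => (continuous_apply i).comp c.continuous_of_finiteDimensional)
      (fun x hx => ((hmem x).1 hx.1).1) (fun x hx => ((hmem x).1 hx.1).2.2)
      (fun x hx => ((hmem x).1 hx.1).2.1) (fun _ => f) (fun _ _ _ _ => rfl)
  · -- on the image of the facet opposite to `u j`, the coordinate `j` is the smallest
    let G : Fin (r + 1) → E r →ₗ[ℝ] V := fun j => ∑ i,
      ((LinearMap.proj (φ := fun _ : Fin (r + 1) => ℝ) (R := ℝ) i -
        LinearMap.proj (φ := fun _ : Fin (r + 1) => ℝ) (R := ℝ) j) ∘ₗ consZero r).smulRight (u i)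
    have hGapply : ∀ j y, G j y = ∑ i, (consZero r y i - consZero r y j) • u i := by
      intro j y
      simp [G]
    refine isPLOn_of_coordinates (fun i => f (u i)) (fun y i => consZero r y i - minZero y)
      (fun i => (continuous_consZero i).sub continuous_minZero)
      (fun y _ i => sub_nonneg.2 (minZero_le y i)) (fun y _ => ?_) (fun y _ => ?_) G ?_
    · have := hfg y
      simp only [g, map_sum, map_smul] at this
      exact this
    · obtain ⟨j, hj⟩ := exists_minZero y
      exact ⟨j, sub_eq_zero.2 hj⟩
    · intro j y _ hy
      have hy' : y ∈ f '' pc u (univ.erase j) := by rw [pc_image]; exact hy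
      obtain ⟨x, hx, rfl⟩ := hy'
      have hxM : x ∈ M := Set.mem_iUnion.2 ⟨j, hx⟩
      rw [hgf x hxM, hGapply]
      simp only [hfc, sub_sub_sub_cancel_right, hcface j x hx, sub_zero]
      exact ((hmem x).1 hxM).2.2.symm

end BoundaryManifold
end ConeRing

namespace ConeRing
open Finset

/-! ### Interior manifold cones representing the elements `x ± I x` -/

section Represent
variable {n r : ℕ}

theorem IsConvexCone.sum_mem {V ι : Type*} [NormedAddCommGroup V] [InnerProductSpace ℝ V]
    [FiniteDimensional ℝ V] {C : Set V} (hC : IsConvexCone C) {s : Finset ι} {f : ι → V}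
    (h : ∀ i ∈ s, f i ∈ C) : ∑ i ∈ s, f i ∈ C :=
  sum_induction f (· ∈ C) (fun _ _ => hC.add_mem) hC.zero_mem h

theorem injOn_pc_of_linearIndepOn {V W ι : Type*} [NormedAddCommGroup V] [InnerProductSpace ℝ V]
    [NormedAddCommGroup W] [InnerProductSpace ℝ W] [FiniteDimensional ℝ W] {u : ι → V}
    {S : Finset ι} {φ : V →ₗ[ℝ] W}
    (h : LinearIndepOn ℝ (φ ∘ u) (S : Set ι)) : Set.InjOn φ (pc u S) := by
  rintro _ ⟨c, -, rfl⟩ _ ⟨c', -, rfl⟩ e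
  simp only [map_sum, map_smul] at e
  exact sum_congr rfl fun i hi => by rw [eq_of_sum_smul_eq (u := φ ∘ u) h e hi]

/-- The boundary of a simplicial cone, with the Euclidean structure induced by a linear map that
is injective on each facet. -/
def boundaryCone {N : ℕ} (u : Fin (r + 1) → E N) (φ : E N →ₗ[ℝ] E n)
    (hφ : ∀ j, LinearIndepOn ℝ (φ ∘ u) ((univ.erase j : Finset (Fin (r + 1))) : Set (Fin (r + 1)))) :
    EuclideanCone n where
  N := N
  k := r + 1
  cell j := pc u (univ.erase j)
  isConvexCone_cell _ := isConvexCone_pc _ _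
  chart _ := φ
  chart_injOn j := (isConvexCone_pc _ _).injOn_span (injOn_pc_of_linearIndepOn (hφ j))
  compatible _ _ _ _ := rfl

theorem isInteriorManifold_boundaryCone {N : ℕ} {u : Fin (r + 1) → E N}
    (hu : LinearIndependent ℝ u) (φ : E N →ₗ[ℝ] E n)
    (hφ : ∀ j, LinearIndepOn ℝ (φ ∘ u) ((univ.erase j : Finset (Fin (r + 1))) : Set (Fin (r + 1)))) :
    (boundaryCone u φ hφ).IsInteriorManifold r :=
  ⟨⟨0, Set.mem_iUnion.2 ⟨(0 : Fin (r + 1)), (isConvexCone_pc _ _).zero_mem⟩⟩,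
    isPLManifold_boundary hu⟩

/-- The class of the boundary of a simplicial cone with linear chart `φ`, by inclusion-exclusion over
the facets. -/
theorem toL_boundaryCone {N : ℕ} {u : Fin (r + 1) → E N} (hu : LinearIndependent ℝ u)
    (φ : E N →ₗ[ℝ] E n)
    (hφ : ∀ j, LinearIndepOn ℝ (φ ∘ u) ((univ.erase j : Finset (Fin (r + 1))) : Set (Fin (r + 1))))
    {F : Sig (E n) n} (hF : (F : E n → ℤ) =
      ∑ S ∈ (univ : Finset (Fin (r + 1))).powerset with S.Nonempty,
        (-1 : ℤ) ^ (S.card + 1) • ind (pc (φ ∘ u) (univ \ S))) :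
    (boundaryCone u φ hφ).toL = clsSig n F := by
  have e : F = ∑ S ∈ (univ : Finset (Fin (r + 1))).powerset with S.Nonempty,
      (-1 : ℤ) ^ (S.card + 1) •
        (⟨ind (pc (φ ∘ u) (univ \ S)), ind_mem (isConvexCone_pc _ _).isCone⟩ : Sig (E n) n) := by
    apply Subtype.ext
    rw [AddSubgroup.val_finsetSum]
    exact hF
  rw [e, map_sum, sum_subtype (p := Finset.Nonempty) _ (by simp)]
  refine sum_congr rfl fun S _ => ?_
  rw [map_zsmul, clsSig_ind (isConvexCone_pc _ _).isCone]
  congr 2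
  exact (congrArg (φ '' ·) (biInter_pc_erase_of_indep (hu.linearIndepOn _)
    (subset_univ S.1) S.2)).trans (pc_image φ u _)

theorem exists_fin_family (b : Finset (E n)) (hb : LinearIndepOn ℝ id (b : Set (E n))) :
    ∃ v : Fin b.card → E n, LinearIndependent ℝ v ∧ pc id b = pc v univ := by
  classical
  have hinj : Function.Injective fun i => (b.equivFin.symm i : E n) :=
    Subtype.val_injective.comp b.equivFin.symm.injective
  refine ⟨fun i => b.equivFin.symm i, hb.linearIndependent.comp _ b.equivFin.symm.injective, ?_⟩
  rw [← pc_image_finset hinj.injOn]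
  congr 1
  ext x
  simp only [mem_image, mem_univ, true_and]
  exact ⟨fun hx => ⟨b.equivFin ⟨x, hx⟩, by simp⟩, by rintro ⟨i, rfl⟩; exact (b.equivFin.symm i).2⟩

theorem neg_one_pow_I_cls {m : ℕ} {v : Fin m → E n} (hv : LinearIndependent ℝ v)
    (h : ind (relint (pc v univ)) ∈ Sig (E n) n) :
    clsSig n ⟨ind (relint (pc v univ)), h⟩ = (-1 : ℤ) ^ m • I n (cls n (pc v univ)) := by
  rw [I_cls (isConvexCone_pc _ _), dim_pc (hv.linearIndepOn _), card_univ, Fintype.card_fin,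
    neg_one_pow_smul_smul]

/-- The boundary of a simplicial cone is the cone without its relative interior. -/
theorem exists_boundary_manifold {v : Fin (r + 1) → E n} (hv : LinearIndependent ℝ v) :
    ∃ M : EuclideanCone n, M.IsInteriorManifold r ∧
      M.toL = cls n (pc v univ) - (-1 : ℤ) ^ (r + 1) • I n (cls n (pc v univ)) := by
  have hφ : ∀ j, LinearIndepOn ℝ ((LinearMap.id : E n →ₗ[ℝ] E n) ∘ v)
      ((univ.erase j : Finset (Fin (r + 1))) : Set (Fin (r + 1))) := fun j => hv.linearIndepOn _
  refine ⟨_, isInteriorManifold_boundaryCone hv LinearMap.id hφ, ?_⟩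
  have hC := kc (isConvexCone_pc v univ)
  rw [toL_boundaryCone hv LinearMap.id hφ (F := ⟨ind (pc v univ), ind_mem_Sig hC⟩ -
    ⟨ind (relint (pc v univ)), ind_relint_mem hC⟩), map_sub,
    clsSig_ind (isConvexCone_pc _ _).isCone, neg_one_pow_I_cls hv]
  rw [AddSubgroup.coe_sub]
  change ind (pc v univ) - ind (relint (pc v univ)) = _
  rw [ind_relint_pc (hv.linearIndepOn _), ← sum_powerset_nonempty_add]
  simp only [card_empty, pow_zero, one_smul, sdiff_empty, sub_add_cancel_left, ← sum_neg_distrib,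
    pow_succ, mul_neg_one, neg_smul]
  rfl

/-- The only linear relation between the sum of independent vectors and the vectors themselves. -/
theorem coord_of_sum_cons {V : Type*} [AddCommGroup V] [Module ℝ V] {m : ℕ} {v : Fin m → V}
    (hv : LinearIndependent ℝ v) {β : Fin (m + 1) → ℝ}
    (h : ∑ i, β i • (Fin.cons (∑ k, v k) v : Fin (m + 1) → V) i = 0) (k : Fin m) :
    β k.succ = - β 0 := by
  rw [Fin.sum_univ_succ] at h
  simp only [Fin.cons_zero, Fin.cons_succ, smul_sum, ← sum_add_distrib, ← add_smul] at h
  have := Fintype.linearIndependent_iff.1 hv _ h k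
  linarith

/-- Two copies of a simplicial cone glued along the boundary; one of the copies is subdivided by
the sum of the generators, so that the union is the boundary of a simplicial cone in a space of
one more dimension. -/
theorem exists_double_manifold {m : ℕ} (hm : 0 < m) {v : Fin m → E n}
    (hv : LinearIndependent ℝ v) :
    ∃ M : EuclideanCone n, M.IsInteriorManifold m ∧
      M.toL = cls n (pc v univ) + (-1 : ℤ) ^ m • I n (cls n (pc v univ)) := by
  classical
  -- the generators of the cone in `ℝ^(n + 1)` are `u`; `φ` folds its boundary onto the given cone
  set w : Fin (m + 1) → E n := Fin.cons (∑ k, v k) v with hw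
  let e₀ : E 1 := EuclideanSpace.single 0 1
  let u : Fin (m + 1) → E (n + 1) := Fin.cons (pairE 0 e₀) (inlE n 1 ∘ v)
  let φ : E (n + 1) →ₗ[ℝ] E n := fstE n 1 +
    ((EuclideanSpace.proj (0 : Fin 1) : E 1 →L[ℝ] ℝ).toLinearMap ∘ₗ sndE n 1).smulRight (∑ k, v k)
  have hφu : φ ∘ u = w := by
    funext i
    refine Fin.cases ?_ (fun i => ?_) i
    · simp [φ, u, w, e₀]
    · simp [φ, u, w, inlE]
  have hu : LinearIndependent ℝ u := by
    rw [linearIndependent_finCons]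
    refine ⟨hv.map' (inlE n 1) (LinearMap.ker_eq_bot.2 fun x y h => ?_), fun h => ?_⟩
    · have := congrArg (fstE n 1) h
      simpa [inlE] using this
    · have hle : Submodule.span ℝ (Set.range (inlE n 1 ∘ v)) ≤ LinearMap.ker (sndE n 1) := by
        rw [Submodule.span_le]
        rintro _ ⟨i, rfl⟩
        simp [inlE]
      have h1 := LinearMap.mem_ker.1 (hle h)
      rw [sndE_pairE] at h1
      have := congrArg (fun z : E 1 => z 0) h1
      simp [e₀] at this
  have hφ : ∀ j, LinearIndepOn ℝ (φ ∘ u)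
      ((univ.erase j : Finset (Fin (m + 1))) : Set (Fin (m + 1))) := by
    intro j
    rw [hφu, linearIndepOn_finset_iff]
    intro g hg i hi
    set β : Fin (m + 1) → ℝ := fun i => if i = j then 0 else g i with hβ
    have hsum : ∑ i, β i • w i = 0 := by
      rw [← add_sum_erase _ _ (mem_univ j), hβ]
      simp only [if_true, zero_smul, zero_add]
      rw [← hg]
      exact sum_congr rfl fun i hi => by rw [if_neg (ne_of_mem_erase hi)]
    have hk := coord_of_sum_cons hv hsum
    have h0 : β 0 = 0 := by
      have hj : β j = 0 := if_pos rfl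
      revert hj
      refine Fin.cases (fun h => h) (fun k h => ?_) j
      have := hk k
      rw [h] at this
      linarith
    have hall : ∀ i, β i = 0 := fun i => Fin.cases h0 (fun k => by rw [hk k, h0, neg_zero]) i
    simpa [hβ, ne_of_mem_erase hi] using hall i
  refine ⟨_, isInteriorManifold_boundaryCone hu φ hφ, ?_⟩
  have hC := kc (isConvexCone_pc v univ)
  rw [toL_boundaryCone hu φ hφ (F := ⟨ind (pc v univ), ind_mem_Sig hC⟩ +
    ⟨ind (relint (pc v univ)), ind_relint_mem hC⟩), map_add,
    clsSig_ind (isConvexCone_pc _ _).isCone, neg_one_pow_I_cls hv]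
  rw [AddSubgroup.coe_add, hφu]
  change ind (pc v univ) + ind (relint (pc v univ)) = _
  set A : Finset (Fin (m + 1)) := univ.erase 0 with hA
  have hA0 : (0 : Fin (m + 1)) ∉ A := notMem_erase _ _
  have hAi : insert 0 A = univ := insert_erase (mem_univ _)
  have hAsucc : A = univ.image Fin.succ := by
    ext i
    simp only [hA, mem_erase, mem_univ, and_true, mem_image, true_and]
    exact Fin.exists_succ_eq.symm
  have hwA : LinearIndepOn ℝ w (A : Set (Fin (m + 1))) := hφu ▸ hφ 0
  have hpcA : pc w A = pc v univ := by
    rw [← pc_image_finset hwA.injOn, ← pc_image_finset hv.injective.injOn, hAsucc, image_image]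
    rfl
  have hpcu : pc w univ = pc v univ := by
    refine Set.Subset.antisymm ?_ (hpcA ▸ pc_mono (subset_univ A))
    rintro _ ⟨c, hc, rfl⟩
    refine (isConvexCone_pc v univ).sum_mem fun i _ =>
      (isConvexCone_pc v univ).smul_mem (hc i (mem_univ i)) ?_
    refine Fin.cases ?_ (fun k => ?_) i
    · exact ⟨1, fun _ _ => zero_le_one, by simp [w]⟩
    · exact mem_pc_self (u := v) (mem_univ k)
  -- the relation between the sum of the generators and the generators
  set α : Fin (m + 1) → ℝ := Fin.cons (-1) fun _ => 1 with hα
  have hαA : univ.filter (0 < α ·) = A := by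
    ext i
    refine Fin.cases ?_ (fun k => ?_) i
    · simp [hα, hA]
    · simp [hα, hA]
  have hcirc := ind_pc_circuit (u := w) (S := univ) (α := α) (by
      rw [Fin.sum_univ_succ]
      simp [hα, w]) (by
      rw [hαA, hAsucc]
      exact ⟨_, mem_image_of_mem _ (mem_univ ⟨0, hm⟩)⟩) (fun β hβ => ⟨-β 0, fun i _ => by
      have hk := coord_of_sum_cons hv hβ
      refine Fin.cases ?_ (fun k => ?_) i
      · simp [hα]
      · simp [hα, hk k]⟩)
  rw [hαA] at hcirc
  -- in the inclusion-exclusion sum, the sets without the index `0` of the additional generator give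
  -- the closed cone by the circuit relation, and the sets containing it give the relative interior
  have h1 := sum_powerset_nonempty_add (univ : Finset (Fin (m + 1)))
    fun S => (-1 : ℤ) ^ (S.card + 1) • ind (pc w (univ \ S))
  have h2 := sum_powerset_nonempty_add A fun S => (-1 : ℤ) ^ (S.card + 1) • ind (pc w (univ \ S))
  have h3 := sum_powerset_insert hA0 fun S => (-1 : ℤ) ^ (S.card + 1) • ind (pc w (univ \ S))
  rw [hAi] at h3
  have h4 : ∑ t ∈ A.powerset, (-1 : ℤ) ^ ((insert 0 t).card + 1) • ind (pc w (univ \ insert 0 t)) =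
      ind (relint (pc v univ)) := by
    rw [← hpcA, ind_relint_pc hwA]
    refine sum_congr rfl fun t ht => ?_
    rw [mem_powerset] at ht
    rw [card_insert_of_notMem fun h => hA0 (ht h), pow_succ, pow_succ, mul_assoc, neg_one_mul,
      neg_neg, mul_one, ← hAi, insert_sdiff_insert, sdiff_insert_of_notMem hA0]
  rw [← hcirc] at h2
  simp only [card_empty, zero_add, pow_one, sdiff_empty, neg_smul, one_smul, neg_add_cancel] at h1 h2
  rw [← h2, zero_add, h4] at h3
  rw [h3] at h1
  rw [← h1, hpcu]
  abel

/-- The point, as the boundary of a half-line. -/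
theorem cls_zero_mem_Lev : cls n {0} ∈ Lev n := by
  have hu : LinearIndependent ℝ (fun _ : Fin 1 => (EuclideanSpace.single 0 1 : E 1)) :=
    LinearIndependent.of_subsingleton 0 (by simp)
  have hφ : ∀ j, LinearIndepOn ℝ ((0 : E 1 →ₗ[ℝ] E n) ∘ fun _ : Fin 1 =>
      (EuclideanSpace.single 0 1 : E 1))
      ((univ.erase j : Finset (Fin 1)) : Set (Fin 1)) := by
    intro j
    have : (univ.erase j : Finset (Fin 1)) = ∅ := by
      ext i; simp [Subsingleton.elim i j]
    rw [this, coe_empty]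
    exact linearIndepOn_empty _ _
  refine AddSubgroup.subset_closure
    ⟨_, 0, Even.zero, isInteriorManifold_boundaryCone (r := 0) hu 0 hφ, ?_⟩
  rw [toL_boundaryCone (r := 0) hu 0 hφ (F := ⟨ind {0}, ind_mem isCone_zero⟩), clsSig_ind isCone_zero]
  have : (univ : Finset (Fin 1)).powerset.filter (·.Nonempty) = {univ} := by decide
  rw [this, sum_singleton, sdiff_self]
  have h0 : pc ((0 : E 1 →ₗ[ℝ] E n) ∘ fun _ : Fin 1 =>
      (EuclideanSpace.single 0 1 : E 1)) ∅ = {0} := by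
    ext x
    simp [pc, eq_comm]
  change _ = (-1 : ℤ) ^ (1 + 1) • ind (pc _ ∅)
  rw [h0]
  simp

theorem pc_id_empty : pc id (∅ : Finset (E n)) = {0} := by
  ext x
  simp [pc, eq_comm]

/-- The image of `1 + I` is generated by even-dimensional manifolds: a simplicial cone of odd
dimension contributes its boundary, one of even dimension its double. -/
theorem add_I_mem_Lev (x : L n) : x + I n x ∈ Lev n := by
  have : (QuotientAddGroup.mk' (Lev n)).comp (AddMonoidHom.id (L n) + I n) = 0 := by
    refine L.hom_ext_simplicial fun b hb => ?_
    rw [AddMonoidHom.zero_apply, AddMonoidHom.comp_apply, QuotientAddGroup.mk'_apply,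
      QuotientAddGroup.eq_zero_iff]
    change cls n (pc id b) + I n (cls n (pc id b)) ∈ Lev n
    obtain ⟨v, hv, e⟩ := exists_fin_family b hb
    rcases b.eq_empty_or_nonempty with rfl | hne
    · rw [pc_id_empty, I_cls_zero]
      exact add_mem cls_zero_mem_Lev cls_zero_mem_Lev
    obtain ⟨m, hm⟩ : ∃ m, b.card = m + 1 := ⟨b.card - 1, by have := hne.card_pos; omega⟩
    rw [e]
    clear e
    revert v
    rw [hm]
    intro v hv
    rcases m.even_or_odd with he | ho
    · obtain ⟨M, hM, hM'⟩ := exists_boundary_manifold hv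
      refine AddSubgroup.subset_closure ⟨M, m, he, hM, ?_⟩
      rw [hM', he.add_one.neg_one_pow, neg_one_smul, sub_neg_eq_add]
    · obtain ⟨M, hM, hM'⟩ := exists_double_manifold (show 0 < m + 1 by omega) hv
      refine AddSubgroup.subset_closure ⟨M, m + 1, ho.add_one, hM, ?_⟩
      rw [hM', ho.add_one.neg_one_pow, one_smul]
  have h := DFunLike.congr_fun this x
  rwa [AddMonoidHom.zero_apply, AddMonoidHom.comp_apply, QuotientAddGroup.mk'_apply,
    QuotientAddGroup.eq_zero_iff] at h

/-- The image of `1 - I` is generated by odd-dimensional manifolds: a simplicial cone of even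
dimension contributes its boundary, one of odd dimension its double. -/
theorem sub_I_mem_Lod (x : L n) : x - I n x ∈ Lod n := by
  have : (QuotientAddGroup.mk' (Lod n)).comp (AddMonoidHom.id (L n) - I n) = 0 := by
    refine L.hom_ext_simplicial fun b hb => ?_
    rw [AddMonoidHom.zero_apply, AddMonoidHom.comp_apply, QuotientAddGroup.mk'_apply,
      QuotientAddGroup.eq_zero_iff]
    change cls n (pc id b) - I n (cls n (pc id b)) ∈ Lod n
    obtain ⟨v, hv, e⟩ := exists_fin_family b hb
    rcases b.eq_empty_or_nonempty with rfl | hne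
    · rw [pc_id_empty, I_cls_zero, sub_self]
      exact zero_mem _
    obtain ⟨m, hm⟩ : ∃ m, b.card = m + 1 := ⟨b.card - 1, by have := hne.card_pos; omega⟩
    rw [e]
    clear e
    revert v
    rw [hm]
    intro v hv
    rcases m.even_or_odd with he | ho
    · obtain ⟨M, hM, hM'⟩ := exists_double_manifold (show 0 < m + 1 by omega) hv
      refine AddSubgroup.subset_closure ⟨M, m + 1, he.add_one, hM, ?_⟩
      rw [hM', he.add_one.neg_one_pow, neg_one_smul, sub_eq_add_neg]
    · obtain ⟨M, hM, hM'⟩ := exists_boundary_manifold hv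
      refine AddSubgroup.subset_closure ⟨M, m, ho, hM, ?_⟩
      rw [hM', ho.add_one.neg_one_pow, one_smul]
  have h := DFunLike.congr_fun this x
  rwa [AddMonoidHom.zero_apply, AddMonoidHom.comp_apply, QuotientAddGroup.mk'_apply,
    QuotientAddGroup.eq_zero_iff] at h

theorem Lev_zero : Lev 0 = ⊤ := by
  rw [← QuotientAddGroup.ker_mk' (Lev 0), AddMonoidHom.ker_eq_top_iff]
  refine L.hom_ext_convex fun C hC => ?_
  rw [AddMonoidHom.zero_apply, QuotientAddGroup.mk'_apply, QuotientAddGroup.eq_zero_iff]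
  have : C = {0} := by
    ext x
    rw [Subsingleton.elim x 0]
    simp [hC.zero_mem]
  rw [this]
  exact cls_zero_mem_Lev

theorem DLplus_eq_Lev (n : ℕ) : DLplus n = Lev n := by
  refine le_antisymm ?_ (Lev_le_DLplus n)
  rcases n.eq_zero_or_pos with rfl | hn
  · rw [Lev_zero]; exact le_top
  · intro x hx
    obtain ⟨y, rfl⟩ := exists_add_I_eq hn hx
    exact add_I_mem_Lev y

theorem Lplus_eq_Lod (k : ℕ) : Lplus (2 * k + 1) = Lod (2 * k + 1) := by
  refine le_antisymm (fun x hx => ?_) (Lod_le_Lplus k)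
  obtain ⟨y, rfl⟩ := exists_of_mem_Lplus (show 0 < 2 * k + 1 by omega) hx
  rw [Odd.neg_one_pow ⟨k, rfl⟩, neg_one_smul, ← sub_eq_add_neg]
  exact sub_I_mem_Lod y

end Represent
end ConeRing

end

theorem mainTheorem7 :
    (∀ n : ℕ, ConeRing.DLplus n = (ConeRing.δbar n).ker) ∧
    (∀ n : ℕ, ConeRing.DLplus n = (ConeRing.δbar (n + 1)).range) ∧
    (∃ R : Subring ConeRing.LRing,
      (∀ x : ConeRing.LRing, x ∈ R ↔ ∀ n : ℕ, x n ∈ ConeRing.DLplus n) ∧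
      ∃ b : Module.Basis (Fin 2) R ConeRing.LRing,
        b 0 = 1 ∧ b 1 = DirectSum.of ConeRing.L 1 ConeRing.d) ∧
    ConeRing.D 1 ConeRing.d = ConeRing.d ∧
    (∀ n : ℕ, 0 < n → ConeRing.DLplus n = (AddMonoidHom.id (ConeRing.L n) + ConeRing.I n).range) ∧
    (∀ n : ℕ, ConeRing.DLplus n = ConeRing.Lev n) ∧
    (∀ k : ℕ, ConeRing.Lev (2 * k + 1) =
      (ConeRing.Lplus (2 * k)).map (ConeRing.mulOne (2 * k) ConeRing.t)) ∧
    (∀ k : ℕ, ConeRing.Lplus (2 * k + 1) = ConeRing.Lod (2 * k + 1) ∧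
      ConeRing.Lplus (2 * k + 1) = (ConeRing.Lev (2 * k + 1)).map (ConeRing.D (2 * k + 1)) ∧
      ConeRing.Lplus (2 * k + 1) =
        (ConeRing.Lplus (2 * k)).map (ConeRing.mulOne (2 * k) ConeRing.s)) :=
  ⟨fun _ => ConeRing.DLplus_eq_ker, fun _ => ConeRing.DLplus_eq_range,
    ⟨ConeRing.DLplusRing, fun _ => ConeRing.mem_DLplusRing, ConeRing.exists_basis_one_d⟩,
    ConeRing.D_d, fun _ hn => ConeRing.DLplus_eq_range_one_add_I hn, ConeRing.DLplus_eq_Lev,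
    fun k => (ConeRing.DLplus_eq_Lev (2 * k + 1)).symm.trans ConeRing.DLplus_odd,
    fun k => ⟨ConeRing.Lplus_eq_Lod k, by
      rw [← ConeRing.DLplus_eq_Lev, ConeRing.map_D_DLplus], ConeRing.Lplus_odd⟩⟩
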